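/- There is a universal constant $C>0$ such that the following holds for every integer $p\ge 2$. Let $(Y,Y')$ be an exchangeable pair of random variables, defined on a probability space $(\Omega,\mathcal A,\mathbb P)$ and taking values in a measurable space $(E,\mathcal E)$; that is, $(Y,Y')$ and $(Y',Y)$ have the same law. Let $\mathsf W:E\to\mathbb R^p$ be measurable, and set $W:=\mathsf W(Y)$, $W':=\mathsf W(Y')$ and $D:=W'-W$. Let $\mathsf G:E^2\to\mathbb R^p$ be a measurable function which is antisymmetric in the sense that $\mathsf G(Y,Y')=-\mathsf G(Y',Y)$ almost surely, and such that $G:=\mathsf G(Y,Y')$ is integrable and satisfies \[ \mathbb E[G\mid Y]=-(W+R)\quad\text{a.s.} \] for some random vector $R$ in $\mathbb R^p$. Let $\Sigma$ be a $p\times p$ positive semidefinite symmetric matrix with $\underline\sigma:=\min_{1\le j\le p}\sqrt{\Sigma_{jj}}>0$, and let $Z\sim N(0,\Sigma)$. Then, for every $\varepsilon>0$, \[ \sup_{A}\left|\mathbb P(W\in A)-\mathbb P(Z\in A)\right| \le\frac{C}{\underline\sigma}\left(\mathbb E[\|R^\varepsilon\|_\infty]\sqrt{\log p}+\varepsilon^{-1}\,\mathbb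 E[\|V^\varepsilon\|_\infty](\log p)^{3/2}+\varepsilon^{-3}\,\mathbb E[\Gamma^\varepsilon](\log p)^{7/2}+\varepsilon\sqrt{\log p}\right), \] where the supremum is over all rectangles $A=I_1\times\dots\times I_p$ in $\mathbb R^p$ (each $I_j\subseteq\mathbb R$ an interval of any kind, bounded or not), the expectations on the right-hand side take values in $[0,\infty]$, $\|\cdot\|_\infty$ denotes the largest absolute value of an entry of a vector or matrix, and, with $\beta:=\varepsilon^{-1}\log p$, \[ R^\varepsilon:=R+\mathbb E\left[G\,1_{\{\|D\|_\infty>\beta^{-1}\}}\mid Y\right],\qquad V^\varepsilon:=\tfrac12\,\mathbb E\left[GD^\top 1_{\{\|D\|_\infty\le\beta^{-1}\}}\mid Y\right]-\Sigma, \] \[ \Gamma^\varepsilon:=\max_{1\le j,k,l,m\le p}\mathbb E\left[|G_jD_kD_lD_m|\,1_{\{\|D\|_\infty\le\beta^{-1}\}}\mid Y\right]. \] -/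

import Mathlib

open MeasureTheory ProbabilityTheory
open scoped ENNReal

noncomputable section

/-- A rectangle in `ℝ^p`: a product of `p` intervals. Each side is an arbitrary order-convex subset
of `ℝ`, so it may be open, closed or half-open, bounded or unbounded, degenerate or empty. -/
def IsRectangle {p : ℕ} (A : Set (Fin p → ℝ)) : Prop :=
  ∃ I : Fin p → Set ℝ, (∀ j, (I j).OrdConnected) ∧ A = Set.univ.pi I

/-- `sup_A |μ(A) - ν(A)|` over all rectangles `A` in `ℝ^p`, for probability measures `μ`, `ν`. -/
def rectDist {p : ℕ} (μ ν : Measure (Fin p → ℝ)) : ℝ≥0∞ :=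
  ⨆ (A : Set (Fin p → ℝ)) (_ : IsRectangle A), ENNReal.ofReal |μ.real A - ν.real A|

/-- The centred Gaussian law `N(0, Σ)`, as a measure on `Fin p → ℝ`. -/
def gaussianLaw {p : ℕ} (S : Matrix (Fin p) (Fin p) ℝ) : Measure (Fin p → ℝ) :=
  (multivariateGaussian 0 S).map WithLp.ofLp

/-- `(Y, Y')` is an exchangeable pair: `(Y, Y')` and `(Y', Y)` have the same law. -/
def IsExchangeablePair {Ω E : Type*} [MeasurableSpace Ω] [MeasurableSpace E]
    (P : Measure Ω) (Y Y' : Ω → E) : Prop :=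
  Measurable Y ∧ Measurable Y' ∧
    P.map (fun ω => (Y ω, Y' ω)) = P.map (fun ω => (Y' ω, Y ω))

/-- The conditional expectation `E[ξ ∣ Y]` of a real random variable `ξ` given a random element
`Y`. -/
def condExpGiven {Ω E : Type*} [MeasurableSpace Ω] [mE : MeasurableSpace E]
    (P : Measure Ω) (Y : Ω → E) (ξ : Ω → ℝ) : Ω → ℝ :=
  P[ξ | mE.comap Y]

section Truncated

variable {Ω E : Type*} [MeasurableSpace Ω] [MeasurableSpace E] {p : ℕ}

/-- `β = ε⁻¹ log p`. -/
def betaParam (p : ℕ) (ε : ℝ) : ℝ := ε⁻¹ * Real.log p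

/-- `R^ε = R + E[G 1{‖D‖_∞ > β⁻¹} ∣ Y]`. The norm of `Fin p → ℝ` is the max norm. -/
def truncR (P : Measure Ω) (Y : Ω → E) (R G D : Ω → Fin p → ℝ) (ε : ℝ) (ω : Ω) : Fin p → ℝ :=
  fun j => R ω j +
    condExpGiven P Y ({ω' | (betaParam p ε)⁻¹ < ‖D ω'‖}.indicator fun ω' => G ω' j) ω

/-- `V^ε = (1/2) E[G Dᵀ 1{‖D‖_∞ ≤ β⁻¹} ∣ Y] - Σ`. It is a function of the two indices, so its norm
is the largest absolute value of an entry. -/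
def truncV (P : Measure Ω) (Y : Ω → E) (G D : Ω → Fin p → ℝ) (S : Matrix (Fin p) (Fin p) ℝ)
    (ε : ℝ) (ω : Ω) : Fin p → Fin p → ℝ :=
  fun j k => (1 / 2) * condExpGiven P Y
    ({ω' | ‖D ω'‖ ≤ (betaParam p ε)⁻¹}.indicator fun ω' => G ω' j * D ω' k) ω - S j k

/-- `Γ^ε = max_{j,k,l,m} E[|G_j D_k D_l D_m| 1{‖D‖_∞ ≤ β⁻¹} ∣ Y]`. -/
def truncΓ (P : Measure Ω) (Y : Ω → E) (G D : Ω → Fin p → ℝ) (ε : ℝ) (ω : Ω) : ℝ :=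
  ⨆ i : Fin p × Fin p × Fin p × Fin p, condExpGiven P Y
    ({ω' | ‖D ω'‖ ≤ (betaParam p ε)⁻¹}.indicator fun ω' =>
      |G ω' i.1 * D ω' i.2.1 * D ω' i.2.2.1 * D ω' i.2.2.2|) ω

end Truncated

/-- `σ = min_j √Σ_jj`. -/
def minStdDev {p : ℕ} (S : Matrix (Fin p) (Fin p) ℝ) : ℝ := ⨅ j, √(S j j)

end

/-!
The proof compares `W` and `Z` on a smoothed indicator of a box, and pays for the smoothing with
Gaussian anti-concentration. Both depend on the dimension only through powers of `log p`.

*Smoothing.* With `L = log p` and `β = L / ε`, the sum `q(x)` of the `2 p` exponentials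
`exp (β (x_j - b_j))` and `exp (β (a_j - x_j))` tells inside from outside of the box `[a, b]` up to
`O(ε)`, because `log p / β = ε`. The smoothed indicator is `h = H(q)` with a profile `H` that falls
from `1` to `0` while `log q` crosses an interval of length `L` (`exists_isLogCutoff`). Derivatives
of a function of a sum of exponentials are averages for the Gibbs weights, so the `k`-th derivatives
of `h` have entrywise `ℓ¹` norm `O(β ^ k / L)`, independently of `p`; they live where `q` is between
`1` and `p`, which is a shell of width `O(ε)` around the boundary of the box
(`band_boxFamily_subset`).

*Exchangeable pairs.* By antisymmetry `G (f(W) + f(W'))`, truncated to `‖D‖ ≤ 1 / β`, has mean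
zero. Expand `f(W') - f(W)` by the trapezoidal rule rather than by Taylor's formula at one end: by
symmetry the linear term `½ E[G Dᵀ : (∇f(W) + ∇f(W'))]` equals `E[G Dᵀ : ∇f(W)]`, which is where
`V^ε` comes from, and the remainder already has four factors `G D D D`.
Hence `E[W · f(W)]` and `E[Σ : ∇f(W)]` differ by the three errors `R^ε`, `V^ε`, `Γ^ε`, weighted by
bounds on `f` and its first and third derivatives (`abs_integral_stein_le`). The bound on the third
derivatives is stable under moves of size `1 / β`, as these change each exponential by at most a
factor `e` (`ExpFamily.abs_grad_sub_trapezoid_le`).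

*Interpolation.* Along `cos θ W + sin θ Z` the derivative of `E h` is such a difference for
`f = E_Z ∇h(cos θ · + sin θ Z)`, by Gaussian integration by parts. Averaging over `Z` bounds each
derivative by `β ^ k / L` times the probability that `sin θ Z` falls in a translate of a shell of
width `O(ε)`, which is `O(ε √L / (σ sin θ))`; the factor `sin θ` from the interpolation cancels the
singularity (`ExpFamily.abs_smoothed_sub_le`). So the `k`-th derivatives contribute
`(β ^ k / L) (ε √L / σ)`, and `k = 1, 2, 4` give the three main terms.

*Anti-concentration.* Nazarov's inequality (`gaussianLaw_shell_le`) is proved for a covariance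
matrix that may be singular. If the `j`-th coordinate of `Z` is replaced by a number `y` and the
other ones are moved by their regression on it, then the result for an independent Gaussian `y` has
again the law of `Z` (`map_resample_gaussianLaw`). This disintegrates the law over the facets of the
polyhedron `{x ≤ b}`. The regression rays that leave the facets outwards are disjoint, so the
Gaussian tails beyond the facets sum to at most one, and `σ` times a density is at most `O(√L)`
times the tail unless it is `O(1 / p)`.

Finally, boxes are sandwiched between smoothed boxes, and a rectangle is exhausted by compact boxes.
-/

noncomputable section

/-! ### Gaussian laws and resampling of one coordinate -/

section GaussianLaw
variable {p : ℕ} {S : Matrix (Fin p) (Fin p) ℝ}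

instance isProbabilityMeasure_gaussianLaw : IsProbabilityMeasure (gaussianLaw S) := by
  unfold gaussianLaw
  exact Measure.isProbabilityMeasure_map (Measurable.aemeasurable (by fun_prop))

/-- Replaces the `j`-th coordinate of `x` by `y` and moves the others by their regression on it under
`N(0, S)`. The coordinate is really replaced only if `S j j ≠ 0`. -/
def resample (S : Matrix (Fin p) (Fin p) ℝ) (j : Fin p) (y : ℝ) (x : Fin p → ℝ) : Fin p → ℝ :=
  fun k => x k + (y - x j) * (S k j / S j j)

lemma resample_apply_self {j : Fin p} (hj : S j j ≠ 0) (y : ℝ) (x : Fin p → ℝ) :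
    resample S j y x j = y := by
  simp [resample, hj]

lemma resample_resample {j : Fin p} (hj : S j j ≠ 0) (y y' : ℝ) (x : Fin p → ℝ) :
    resample S j y' (resample S j y x) = resample S j y' x := by
  ext k
  rw [resample, resample_apply_self hj]
  simp only [resample]; ring

lemma measurable_resample (j : Fin p) :
    Measurable fun z : ℝ × (Fin p → ℝ) => resample S j z.1 z.2 := by
  unfold resample; fun_prop

lemma integral_exp_dual_gaussianLaw (hS : S.PosSemidef) (ξ : Fin p → ℝ) :
    ∫ x, Complex.exp ((ξ ⬝ᵥ x : ℝ) * Complex.I) ∂gaussianLaw S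
      = Complex.exp (-((ξ ⬝ᵥ S.mulVec ξ : ℝ) : ℂ) / 2) := by
  have h := charFun_multivariateGaussian (μ := 0) hS (WithLp.toLp 2 ξ)
  rw [gaussianLaw, integral_map (Measurable.aemeasurable (by fun_prop))
    (Measurable.aestronglyMeasurable (by fun_prop))]
  rw [charFun_apply] at h
  simp only [inner_zero_right, Complex.ofReal_zero, zero_mul, zero_sub] at h
  rw [neg_div]
  convert h using 5
  rw [EuclideanSpace.inner_eq_star_dotProduct]
  simp

lemma ext_of_integral_exp_dual {μ ν : Measure (Fin p → ℝ)} [IsFiniteMeasure μ] [IsFiniteMeasure ν]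
    (h : ∀ ξ : Fin p → ℝ, ∫ x, Complex.exp ((ξ ⬝ᵥ x : ℝ) * Complex.I) ∂μ
      = ∫ x, Complex.exp ((ξ ⬝ᵥ x : ℝ) * Complex.I) ∂ν) : μ = ν := by
  apply Measure.ext_of_charFunDual
  ext L
  have hL : ∀ x, L x = (fun j => L (Pi.single j 1)) ⬝ᵥ x := by
    intro x
    conv_lhs => rw [← Finset.univ_sum_single x]
    rw [map_sum]
    refine Finset.sum_congr rfl fun j _ => ?_
    have : Pi.single j (x j) = x j • (Pi.single j 1 : Fin p → ℝ) := by
      rw [← Pi.single_smul, smul_eq_mul, mul_one]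
    rw [this, map_smul, smul_eq_mul, mul_comm]
  have e : ∀ μ : Measure (Fin p → ℝ), charFunDual μ L
      = ∫ x, Complex.exp (((fun j => L (Pi.single j 1)) ⬝ᵥ x : ℝ) * Complex.I) ∂μ := by
    intro μ
    rw [charFunDual_apply]
    congr 1
    ext x
    rw [← hL x]
  rw [e, e, h]

/-- The `j`-th coordinate of a Gaussian vector may be replaced by an independent copy of itself: the
residuals of the regression of the other coordinates on it are independent of it. -/
lemma map_resample_gaussianLaw (hS : S.PosSemidef) {j : Fin p} (hj : 0 < S j j) :
    ((gaussianReal 0 (S j j).toNNReal).prod (gaussianLaw S)).map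
      (fun z => resample S j z.1 z.2) = gaussianLaw S := by
  have := Measure.isProbabilityMeasure_map (μ := (gaussianReal 0 (S j j).toNNReal).prod
    (gaussianLaw S)) (measurable_resample (S := S) j).aemeasurable
  apply ext_of_integral_exp_dual
  intro ξ
  -- the characteristic function factors over the new coordinate and the residuals
  rw [integral_map (measurable_resample j).aemeasurable
    (Measurable.aestronglyMeasurable (by fun_prop)), integral_exp_dual_gaussianLaw hS]
  set a : ℝ := ∑ k, ξ k * (S k j / S j j) with ha
  have key : ∀ z : ℝ × (Fin p → ℝ),
      Complex.exp ((ξ ⬝ᵥ resample S j z.1 z.2 : ℝ) * Complex.I)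
      = Complex.exp ((a * z.1 : ℝ) * Complex.I)
        * Complex.exp (((ξ - Pi.single j a) ⬝ᵥ z.2 : ℝ) * Complex.I) := by
    intro z
    rw [← Complex.exp_add, ← add_mul, ← Complex.ofReal_add]
    congr 3
    simp only [dotProduct, resample, Pi.sub_apply, mul_add, sub_mul, Finset.sum_add_distrib,
      Finset.sum_sub_distrib, Pi.single_apply, ite_mul, zero_mul, Finset.sum_ite_eq',
      Finset.mem_univ, if_true]
    have : ∑ k, ξ k * (S k j / S j j) * (z.1 - z.2 j) = a * (z.1 - z.2 j) := by
      rw [ha, Finset.sum_mul]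
    have h2 : ∑ k, ξ k * (z.1 * (S k j / S j j) - z.2 j * (S k j / S j j))
        = a * z.1 - a * z.2 j := by
      rw [← mul_sub, ← this]; exact Finset.sum_congr rfl fun k _ => by ring
    linarith
  simp only [key]
  have hprod := integral_prod_mul (L := ℂ) (μ := gaussianReal 0 (S j j).toNNReal)
    (ν := gaussianLaw S) (fun y => Complex.exp ((a * y : ℝ) * Complex.I))
    (fun x => Complex.exp (((ξ - Pi.single j a) ⬝ᵥ x : ℝ) * Complex.I))
  rw [hprod]
  rw [integral_exp_dual_gaussianLaw hS]
  have h1 := charFun_gaussianReal (μ := 0) (v := (S j j).toNNReal) a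
  rw [charFun_apply_real] at h1
  simp only [Complex.ofReal_mul]
  rw [h1, ← Complex.exp_add]
  congr 1
  have hsym : ∀ k, S j k = S k j := fun k => by
    have := congrFun (congrFun hS.1 k) j
    simpa [Matrix.conjTranspose_apply] using this
  have hq : (ξ - Pi.single j a) ⬝ᵥ S.mulVec (ξ - Pi.single j a)
      = ξ ⬝ᵥ S.mulVec ξ - S j j * a ^ 2 := by
    have e1 : ξ ⬝ᵥ S.mulVec (Pi.single j a) = S j j * a ^ 2 := by
      simp only [Matrix.mulVec_single, dotProduct, Pi.smul_apply, Matrix.col_apply]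
      have : ∀ k, ξ k * (MulOpposite.op a • S k j) = ξ k * (S k j / S j j) * (S j j * a) := by
        intro k
        simp only [MulOpposite.smul_eq_mul_unop, MulOpposite.unop_op]
        field_simp
      simp only [this, ← Finset.sum_mul, ← ha]
      ring
    have e2 : (Pi.single j a) ⬝ᵥ S.mulVec ξ = S j j * a ^ 2 := by
      rw [Matrix.dotProduct_mulVec, ← Matrix.mulVec_transpose, dotProduct_comm]
      have : S.transpose = S := by ext k l; simpa [Matrix.transpose_apply] using (by
        have := congrFun (congrFun hS.1 k) l
        simpa [Matrix.conjTranspose_apply] using this)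
      rw [this, e1]
    have e3 : (Pi.single j a) ⬝ᵥ S.mulVec (Pi.single j a) = S j j * a ^ 2 := by
      simp [Matrix.mulVec_single, single_dotProduct]
      ring
    rw [Matrix.mulVec_sub, sub_dotProduct, dotProduct_sub, dotProduct_sub, e1, e2, e3]
    ring
  rw [hq]
  push_cast [Real.coe_toNNReal _ hj.le]
  ring

lemma map_neg_gaussianLaw (hS : S.PosSemidef) :
    (gaussianLaw S).map (fun x => -x) = gaussianLaw S := by
  have := Measure.isProbabilityMeasure_map (μ := gaussianLaw S)
    (f := fun x => -x) measurable_neg.aemeasurable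
  apply ext_of_integral_exp_dual
  intro ξ
  rw [integral_map (Measurable.aemeasurable (by fun_prop))
    (Measurable.aestronglyMeasurable (by fun_prop)), integral_exp_dual_gaussianLaw hS]
  have : ∀ x : Fin p → ℝ, ξ ⬝ᵥ -x = (-ξ) ⬝ᵥ x := fun x => by simp
  simp only [this]
  rw [integral_exp_dual_gaussianLaw hS]
  simp [Matrix.mulVec_neg]

end GaussianLaw

/-! ### Gaussian integration by parts and a tail comparison -/

lemma hasDerivAt_gaussianPDFReal {v : ℝ} (hv : 0 < v) (y : ℝ) :
    HasDerivAt (gaussianPDFReal 0 v.toNNReal) (-(y / v) * gaussianPDFReal 0 v.toNNReal y) y := by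
  rw [gaussianPDFReal_def, Real.coe_toNNReal _ hv.le]
  have h1 : HasDerivAt (fun x : ℝ => -(x - 0) ^ 2 / (2 * v)) (-(y / v)) y := by
    have := (((hasDerivAt_id y).sub_const 0).pow 2).neg.div_const (2 * v)
    refine this.congr_deriv ?_
    simp; field_simp
  refine (h1.exp.const_mul _).congr_deriv ?_
  simp only []
  ring

lemma integrable_gaussianReal_iff {v : ℝ} (hv : 0 < v) (f : ℝ → ℝ) :
    Integrable f (gaussianReal 0 v.toNNReal)
      ↔ Integrable (fun y => gaussianPDFReal 0 v.toNNReal y * f y) := by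
  have hv' : v.toNNReal ≠ 0 := by simpa using hv
  rw [gaussianReal_of_var_ne_zero _ hv', integrable_withDensity_iff_integrable_smul'
    (measurable_gaussianPDF _ _) (by simp [gaussianPDF_lt_top])]
  simp [toReal_gaussianPDF]

/-- Gaussian integration by parts on the line. -/
lemma integral_id_mul_gaussianReal {v C : ℝ} (hv : 0 < v) {f f' : ℝ → ℝ}
    (hf : ∀ y, HasDerivAt f (f' y) y) (hf' : Measurable f') (hC : ∀ y, |f y| ≤ C)
    (hC' : ∀ y, |f' y| ≤ C) :
    ∫ y, y * f y ∂gaussianReal 0 v.toNNReal = v * ∫ y, f' y ∂gaussianReal 0 v.toNNReal := by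
  have hv' : v.toNNReal ≠ 0 := by simpa using hv
  have hfm : Measurable f :=
    (continuous_iff_continuousAt.2 fun y => (hf y).continuousAt).measurable
  have i1 : Integrable (fun y => y * f y) (gaussianReal 0 v.toNNReal) :=
    Integrable.mul_bdd (c := C) (IsGaussian.integrable_id (μ := gaussianReal 0 v.toNNReal))
      hfm.aestronglyMeasurable (ae_of_all _ hC)
  have i2 : Integrable f' (gaussianReal 0 v.toNNReal) :=
    Integrable.of_bound hf'.aestronglyMeasurable C (ae_of_all _ hC')
  have i3 : Integrable f (gaussianReal 0 v.toNNReal) :=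
    Integrable.of_bound hfm.aestronglyMeasurable C (ae_of_all _ hC)
  have j1 := i1; have j2 := i2
  rw [integrable_gaussianReal_iff hv] at i1 i2 i3
  have key := integral_eq_zero_of_hasDerivAt_of_integrable
    (fun y => (hasDerivAt_gaussianPDFReal hv y).mul (hf y)) (by
      refine (i2.sub (i1.const_mul (1 / v))).congr (ae_of_all _ fun y => ?_)
      simp only [Pi.sub_apply]; field_simp; ring) i3
  have e : ∫ y, (v * f' y - y * f y) ∂gaussianReal 0 v.toNNReal = 0 := by
    rw [integral_gaussianReal_eq_integral_smul hv']
    refine Eq.trans ?_ ((congrArg (v * ·) key).trans (mul_zero v))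
    rw [← integral_const_mul]
    refine integral_congr_ae (ae_of_all _ fun y => ?_)
    simp only [smul_eq_mul]; field_simp; ring
  rw [integral_sub (j2.const_mul v) j1, integral_const_mul] at e
  linarith

/-- Gaussian integration by parts for the possibly degenerate law `N(0, Σ)`. -/
lemma integral_coord_mul_gaussianLaw {p : ℕ} {S : Matrix (Fin p) (Fin p) ℝ} (hS : S.PosSemidef)
    {j : Fin p} (hj : 0 < S j j) {F : (Fin p → ℝ) → ℝ} {F' : Fin p → (Fin p → ℝ) → ℝ} {C : ℝ}
    (hF : ∀ x d t, HasDerivAt (fun t : ℝ => F (x + t • d)) (∑ k, F' k (x + t • d) * d k) t)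
    (hFm : Measurable F) (hF' : ∀ k, Measurable (F' k)) (hC : ∀ x, |F x| ≤ C)
    (hC' : ∀ k x, |F' k x| ≤ C) :
    ∫ x, x j * F x ∂gaussianLaw S = ∑ k, S j k * ∫ x, F' k x ∂gaussianLaw S := by
  have hsym : ∀ k, S j k = S k j := fun k => by
    have := congrFun (congrFun hS.1 k) j
    simpa [Matrix.conjTranspose_apply] using this
  have hIF : ∀ k, Integrable (F' k) (gaussianLaw S) := fun k =>
    Integrable.of_bound (hF' k).aestronglyMeasurable C (ae_of_all _ (hC' k))
  set N := gaussianReal 0 (S j j).toNNReal with hN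
  have hTm := measurable_resample (S := S) j
  -- conditionally on the residuals, this is the one-dimensional case along a regression line
  have e1 : ∫ x, x j * F x ∂gaussianLaw S
      = ∫ x, ∫ y, y * F (resample S j y x) ∂N ∂gaussianLaw S := by
    conv_lhs => rw [← map_resample_gaussianLaw hS hj]
    rw [integral_map hTm.aemeasurable (by fun_prop)]
    simp only [resample_apply_self hj.ne']
    rw [← hN]
    refine integral_prod_symm (fun z : ℝ × (Fin p → ℝ) => z.1 * F (resample S j z.1 z.2)) ?_
    refine Integrable.mul_bdd (c := C) (f := fun z : ℝ × (Fin p → ℝ) => z.1) ?_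
      (hFm.comp hTm).aestronglyMeasurable (ae_of_all _ fun z => hC _)
    exact (IsGaussian.integrable_id (μ := N)).comp_fst _
  have e2 : ∀ x, ∫ y, y * F (resample S j y x) ∂N
      = ∑ k, S j k * ∫ y, F' k (resample S j y x) ∂N := by
    intro x
    have hm : ∀ k, Measurable fun y => F' k (resample S j y x) := fun k =>
      (hF' k).comp (hTm.comp (measurable_id.prodMk measurable_const))
    have hl : ∀ y, resample S j y x
        = (x - x j • fun k => S k j / S j j) + y • fun k => S k j / S j j := by
      intro y; ext k; simp [resample]; ring
    have hint : ∀ k, Integrable (fun y => F' k (resample S j y x)) N := fun k =>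
      Integrable.of_bound (hm k).aestronglyMeasurable C (ae_of_all _ fun y => hC' k _)
    rw [integral_id_mul_gaussianReal (f' := fun y => ∑ k, F' k (resample S j y x) * (S k j / S j j))
      (C := max C (∑ k, C * |S k j / S j j|)) hj (fun y => ?_)
      (Finset.measurable_sum _ fun k _ => (hm k).mul_const _)
      (fun y => (hC _).trans (le_max_left _ _)) (fun y => ?_), integral_finsetSum,
      Finset.mul_sum]
    · refine Finset.sum_congr rfl fun k _ => ?_
      rw [integral_mul_const, hsym k, ← hN]
      field_simp
    · exact fun k _ => (hint k).mul_const _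
    · simp only [hl]
      exact hF _ _ y
    · refine le_trans ?_ (le_max_right _ _)
      refine (Finset.abs_sum_le_sum_abs _ _).trans (Finset.sum_le_sum fun k _ => ?_)
      rw [abs_mul]
      exact mul_le_mul_of_nonneg_right (hC' k _) (abs_nonneg _)
  have e3 : ∀ k, ∫ x, F' k x ∂gaussianLaw S
      = ∫ x, ∫ y, F' k (resample S j y x) ∂N ∂gaussianLaw S := by
    intro k
    conv_lhs => rw [← map_resample_gaussianLaw hS hj]
    rw [integral_map hTm.aemeasurable (hF' k).aestronglyMeasurable, ← hN]
    exact integral_prod_symm (fun z : ℝ × (Fin p → ℝ) => F' k (resample S j z.1 z.2))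
      (Integrable.of_bound ((hF' k).comp hTm).aestronglyMeasurable C (ae_of_all _ fun z => hC' k _))
  rw [e1]
  simp only [e2, e3]
  rw [integral_finsetSum]
  · simp only [integral_const_mul]
  · intro k _
    refine Integrable.const_mul ?_ _
    have : Integrable (fun z : ℝ × (Fin p → ℝ) => F' k (resample S j z.1 z.2))
        (N.prod (gaussianLaw S)) :=
      Integrable.of_bound ((hF' k).comp hTm).aestronglyMeasurable C (ae_of_all _ fun z => hC' k _)
    exact this.integral_prod_right

/-- A bound of Mills type: up to `l` standard deviations the density is at most a multiple of
`(l + 1) / √v` times the tail, and beyond that it is at most `exp (-l ^ 2 / 2) / √v`. -/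
lemma gaussianPDF_le_tail {v l : ℝ} (hv : 0 < v) (hl : 0 ≤ l) (y : ℝ) :
    gaussianPDF 0 v.toNNReal y ≤ ENNReal.ofReal (1 / √v) *
      (ENNReal.ofReal (Real.exp (3 / 2) * (l + 1)) * gaussianReal 0 v.toNNReal (Set.Ioi y)
        + ENNReal.ofReal (Real.exp (-l ^ 2 / 2))) := by
  have hv' : v.toNNReal ≠ 0 := by simpa using hv
  have hs : 0 < √v := Real.sqrt_pos.2 hv
  have hsq : √v ^ 2 = v := Real.sq_sqrt hv.le
  have hpdf : ∀ z, gaussianPDFReal 0 v.toNNReal z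
      = (√(2 * Real.pi * v))⁻¹ * Real.exp (-z ^ 2 / (2 * v)) := by
    intro z; rw [gaussianPDFReal_def, Real.coe_toNNReal _ hv.le]; simp
  have hc0 : 0 < (√(2 * Real.pi * v))⁻¹ := by positivity
  by_cases hy : y ≤ √v * l
  · set a := max y 0 with ha
    have ha0 : 0 ≤ a := le_max_right _ _
    have hal : a ≤ √v * l := max_le hy (by positivity)
    -- on an interval of this length the density drops by at most a factor `exp (3 / 2)`
    set w := √v / (l + 1) with hw
    have hw0 : 0 < w := by positivity
    have h1 : gaussianPDF 0 v.toNNReal a * ENNReal.ofReal (Real.exp (-(3 / 2)) * w)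
        ≤ gaussianReal 0 v.toNNReal (Set.Ioi y) := by
      have hsub : Set.Ioc a (a + w) ⊆ Set.Ioi y := fun z hz =>
        lt_of_le_of_lt (le_max_left _ _) hz.1
      refine le_trans ?_ (measure_mono hsub)
      rw [gaussianReal_apply _ hv']
      have : ∀ z ∈ Set.Ioc a (a + w),
          gaussianPDF 0 v.toNNReal a * ENNReal.ofReal (Real.exp (-(3 / 2)))
            ≤ gaussianPDF 0 v.toNNReal z := by
        intro z hz
        rw [gaussianPDF, gaussianPDF, ← ENNReal.ofReal_mul (gaussianPDFReal_nonneg _ _ _)]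
        apply ENNReal.ofReal_le_ofReal
        rw [hpdf, hpdf, mul_assoc, ← Real.exp_add]
        refine mul_le_mul_of_nonneg_left (Real.exp_le_exp.2 ?_) hc0.le
        have hz2 : z ^ 2 ≤ (a + w) ^ 2 := by
          apply pow_le_pow_left₀ (ha0.trans hz.1.le) hz.2
        have hww : w * (l + 1) = √v := by rw [hw]; field_simp
        have hwv : w ≤ √v := by
          rw [← hww]; nlinarith
        have haw : a * w ≤ v := by
          calc a * w ≤ (√v * l) * w := mul_le_mul_of_nonneg_right hal hw0.le
            _ ≤ √v * (w * (l + 1)) := by nlinarith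
            _ = v := by rw [hww, ← sq, hsq]
        have hw2 : w ^ 2 ≤ v := by rw [← hsq]; exact pow_le_pow_left₀ hw0.le hwv 2
        have : -a ^ 2 / (2 * v) + -(3 / 2) = (-a ^ 2 - 3 * v) / (2 * v) := by field_simp; ring
        rw [this]
        apply div_le_div_of_nonneg_right _ (by positivity)
        nlinarith
      calc gaussianPDF 0 v.toNNReal a * ENNReal.ofReal (Real.exp (-(3 / 2)) * w)
          = ∫⁻ _ in Set.Ioc a (a + w),
              gaussianPDF 0 v.toNNReal a * ENNReal.ofReal (Real.exp (-(3 / 2))) := by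
            rw [setLIntegral_const, Real.volume_Ioc, ENNReal.ofReal_mul (Real.exp_nonneg _),
              mul_assoc]
            simp
        _ ≤ _ := setLIntegral_mono (measurable_gaussianPDF _ _) this
    have h2 : gaussianPDF 0 v.toNNReal y ≤ gaussianPDF 0 v.toNNReal a := by
      apply ENNReal.ofReal_le_ofReal
      rw [hpdf, hpdf]
      refine mul_le_mul_of_nonneg_left (Real.exp_le_exp.2 ?_) hc0.le
      apply div_le_div_of_nonneg_right _ (by positivity)
      have : a ^ 2 ≤ y ^ 2 := by
        rcases le_total y 0 with h | h
        · rw [ha, max_eq_right h]; nlinarith [sq_nonneg y]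
        · rw [ha, max_eq_left h]
      linarith
    have h3 : ENNReal.ofReal (1 / √v) * (ENNReal.ofReal (Real.exp (3 / 2) * (l + 1))
        * ENNReal.ofReal (Real.exp (-(3 / 2)) * w)) = 1 := by
      rw [← ENNReal.ofReal_mul (by positivity), ← ENNReal.ofReal_mul (by positivity),
        ← ENNReal.ofReal_one]
      congr 1
      have : Real.exp (3 / 2) * Real.exp (-(3 / 2)) = 1 := by rw [← Real.exp_add]; simp
      calc 1 / √v * (Real.exp (3 / 2) * (l + 1) * (Real.exp (-(3 / 2)) * w))
          = (Real.exp (3 / 2) * Real.exp (-(3 / 2))) * (1 / √v * ((l + 1) * w)) := by ring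
        _ = 1 := by rw [this, hw]; field_simp
    calc gaussianPDF 0 v.toNNReal y ≤ 1 * gaussianPDF 0 v.toNNReal a := by rwa [one_mul]
      _ = ENNReal.ofReal (1 / √v) * (ENNReal.ofReal (Real.exp (3 / 2) * (l + 1))
          * (gaussianPDF 0 v.toNNReal a * ENNReal.ofReal (Real.exp (-(3 / 2)) * w))) := by
            rw [← h3]; ring
      _ ≤ _ := by gcongr; exact le_add_right (by gcongr)
  · push Not at hy
    rw [mul_add]
    refine le_add_left ?_
    rw [gaussianPDF, ← ENNReal.ofReal_mul (by positivity)]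
    apply ENNReal.ofReal_le_ofReal
    rw [hpdf, one_div]
    have hl2 : (√v * l) ^ 2 ≤ y ^ 2 := pow_le_pow_left₀ (by positivity) hy.le 2
    refine mul_le_mul ?_ (Real.exp_le_exp.2 ?_) (Real.exp_nonneg _) (by positivity)
    · refine inv_anti₀ hs (Real.sqrt_le_sqrt ?_)
      nlinarith [Real.pi_gt_three]
    · rw [mul_pow, hsq] at hl2
      rw [div_le_div_iff₀ (by positivity) (by positivity)]
      nlinarith

/-! ### Nazarov's anti-concentration inequality -/

section Nazarov
variable {p : ℕ} {S : Matrix (Fin p) (Fin p) ℝ}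

/-- The points `x` for which `j` is the first index maximising `x k - b k`. -/
def firstArgmax (b : Fin p → ℝ) (j : Fin p) : Set (Fin p → ℝ) :=
  {x | (∀ k, x k - b k ≤ x j - b j) ∧ ∀ k < j, x k - b k < x j - b j}

lemma exists_mem_firstArgmax [NeZero p] (b x : Fin p → ℝ) : ∃ j, x ∈ firstArgmax b j := by
  obtain ⟨i, hi⟩ := Finite.exists_max fun k => x k - b k
  have hne : (Finset.univ.filter fun k => ∀ l, x l - b l ≤ x k - b k).Nonempty :=
    ⟨i, by simpa using hi⟩
  refine ⟨_, (Finset.mem_filter.1 (Finset.min'_mem _ hne)).2, fun k hk => ?_⟩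
  by_contra! h
  refine absurd (Finset.min'_le _ k ?_) (not_le.2 hk)
  simp only [Finset.mem_filter, Finset.mem_univ, true_and]
  intro l
  exact ((Finset.mem_filter.1 (Finset.min'_mem _ hne)).2 l).trans h

lemma measurableSet_firstArgmax (b : Fin p → ℝ) (j : Fin p) :
    MeasurableSet (firstArgmax b j) := by
  have : firstArgmax b j = (⋂ k, {x | x k - b k ≤ x j - b j})
      ∩ ⋂ k, ⋂ (_ : k < j), {x | x k - b k < x j - b j} := by
    ext x; simp [firstArgmax]
  rw [this]
  refine (MeasurableSet.iInter fun k => measurableSet_le (by fun_prop) (by fun_prop)).inter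
    (MeasurableSet.iInter fun k => MeasurableSet.iInter fun _ =>
      measurableSet_lt (by fun_prop) (by fun_prop))

lemma firstArgmax_add_const (b : Fin p → ℝ) (t : ℝ) (j : Fin p) :
    firstArgmax (fun k => b k + t) j = firstArgmax b j := by
  ext x
  simp [firstArgmax, ← sub_sub]

lemma Matrix.PosSemidef.sq_apply_le (hS : S.PosSemidef) (i j : Fin p) (hj : 0 < S j j) :
    S i j * S j i ≤ S i i * S j j := by
  have hsym : S j i = S i j := by
    have := congrFun (congrFun hS.1 j) i
    simpa [Matrix.conjTranspose_apply] using this.symm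
  have h := hS.dotProduct_mulVec_nonneg (Pi.single i (S j j) - Pi.single j (S i j))
  simp [Matrix.mulVec_sub, sub_dotProduct, dotProduct_sub, Matrix.mulVec_single] at h
  rw [hsym] at *
  nlinarith

/-- The rays that leave the facets of `{x | ∀ j, x j ≤ b j}` in the directions of regression are
disjoint: on two of them, each of two excesses would be at most a multiple of the other, with
regression coefficients whose product is at most one. Ties are excluded because `firstArgmax`
takes the first index. -/
lemma pairwise_disjoint_resample_firstArgmax (hS : S.PosSemidef) (hpos : ∀ j, 0 < S j j)
    (b : Fin p → ℝ) :
    Pairwise (Function.onFun Disjoint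
      fun j => {x | b j < x j ∧ resample S j (b j) x ∈ firstArgmax b j}) := by
  have main : ∀ i j, i < j → Disjoint {x | b i < x i ∧ resample S i (b i) x ∈ firstArgmax b i}
      {x | b j < x j ∧ resample S j (b j) x ∈ firstArgmax b j} := by
    intro i j hij
    rw [Set.disjoint_left]
    rintro x ⟨hi, hi'⟩ ⟨hj, hj'⟩
    have h1 := hi'.1 j
    have h2 := hj'.2 i hij
    rw [resample_apply_self (hpos _).ne'] at h1 h2
    simp only [resample, sub_self] at h1 h2
    have hcs := hS.sq_apply_le i j (hpos j)
    have hr : (S j i / S i i) * (S i j / S j j) ≤ 1 := by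
      rw [div_mul_div_comm, div_le_one (mul_pos (hpos i) (hpos j)), mul_comm (S j i)]
      exact hcs
    set r1 := S j i / S i i
    set r2 := S i j / S j j
    have h1' : x j - b j ≤ (x i - b i) * r1 := by linarith
    have h2' : x i - b i < (x j - b j) * r2 := by linarith
    have hr1 : 0 < r1 := by
      by_contra! h
      nlinarith [mul_nonpos_of_nonneg_of_nonpos (sub_pos.2 hi).le h]
    nlinarith
  intro i j hij
  rcases lt_or_gt_of_ne hij with h | h
  · exact main i j h
  · exact (main j i h).symm

/-- The Gaussian surface measure of the polyhedron `{x | ∀ j, x j ≤ b j}`: the outward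
regression rays over its facets are disjoint, so facets at distance at most `l` contribute at most a
multiple of `l + 1`, and each of the others at most a multiple of `exp (-l ^ 2 / 2)`. -/
lemma sum_facet_le (hS : S.PosSemidef) {s l : ℝ} (hs : 0 < s) (hpos : ∀ j, s ≤ √(S j j))
    (hl : 0 ≤ l) (b : Fin p → ℝ) :
    ∑ j, gaussianPDF 0 (S j j).toNNReal (b j)
        * gaussianLaw S {x | resample S j (b j) x ∈ firstArgmax b j}
      ≤ ENNReal.ofReal (s⁻¹ * (Real.exp (3 / 2) * (l + 1) + p * Real.exp (-l ^ 2 / 2))) := by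
  have hp : ∀ j, 0 < S j j := fun j => Real.sqrt_pos.1 (hs.trans_le (hpos j))
  set π := fun j => gaussianLaw S {x | resample S j (b j) x ∈ firstArgmax b j} with hπ
  set τ := fun j => gaussianReal 0 (S j j).toNNReal (Set.Ioi (b j)) with hτ
  have hres : ∀ j, Measurable (resample S j (b j)) := fun j =>
    (measurable_resample j).comp (measurable_const.prodMk measurable_id)
  have hset : ∀ j, MeasurableSet {x | resample S j (b j) x ∈ firstArgmax b j} := fun j =>
    (hres j) (measurableSet_firstArgmax b j)
  have hB : ∀ j, MeasurableSet {x | b j < x j ∧ resample S j (b j) x ∈ firstArgmax b j} := fun j =>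
    (measurableSet_lt (f := fun _ => b j) (g := fun x : Fin p → ℝ => x j) (by fun_prop)
      (by fun_prop)).inter (hset j)
  have h1 : ∀ j, gaussianLaw S {x | b j < x j ∧ resample S j (b j) x ∈ firstArgmax b j}
      = τ j * π j := by
    intro j
    conv_lhs => rw [← map_resample_gaussianLaw hS (hp j)]
    rw [Measure.map_apply (measurable_resample j) (hB j), hτ, hπ]
    simp only
    rw [← Measure.prod_prod]
    congr 1
    ext z
    simp [resample_apply_self (hp j).ne', resample_resample (hp j).ne']
  have h2 : ∑ j, τ j * π j ≤ 1 := by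
    simp only [← h1]
    rw [← tsum_fintype (L := .unconditional _),
      ← measure_iUnion (pairwise_disjoint_resample_firstArgmax hS hp b) hB]
    exact prob_le_one
  have h3 : ∀ j, gaussianPDF 0 (S j j).toNNReal (b j) * π j ≤ ENNReal.ofReal s⁻¹ *
      (ENNReal.ofReal (Real.exp (3 / 2) * (l + 1)) * (τ j * π j)
        + ENNReal.ofReal (Real.exp (-l ^ 2 / 2))) := by
    intro j
    have hπ1 : π j ≤ 1 := prob_le_one
    calc gaussianPDF 0 (S j j).toNNReal (b j) * π j
        ≤ (ENNReal.ofReal (1 / √(S j j)) * (ENNReal.ofReal (Real.exp (3 / 2) * (l + 1)) * τ j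
          + ENNReal.ofReal (Real.exp (-l ^ 2 / 2)))) * π j := by
          gcongr; exact gaussianPDF_le_tail (hp j) hl _
      _ ≤ (ENNReal.ofReal s⁻¹ * (ENNReal.ofReal (Real.exp (3 / 2) * (l + 1)) * τ j
          + ENNReal.ofReal (Real.exp (-l ^ 2 / 2)))) * π j := by
          gcongr
          rw [one_div]
          exact inv_anti₀ hs (hpos j)
      _ = ENNReal.ofReal s⁻¹ * (ENNReal.ofReal (Real.exp (3 / 2) * (l + 1)) * (τ j * π j)
          + ENNReal.ofReal (Real.exp (-l ^ 2 / 2)) * π j) := by ring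
      _ ≤ _ := by
          gcongr
          exact mul_le_of_le_one_right zero_le hπ1
  refine (Finset.sum_le_sum fun j _ => h3 j).trans ?_
  rw [← Finset.mul_sum, Finset.sum_add_distrib, ← Finset.mul_sum, Finset.sum_const,
    Finset.card_univ, Fintype.card_fin, nsmul_eq_mul, ENNReal.ofReal_mul (p := s⁻¹) (by positivity),
    ENNReal.ofReal_add (p := Real.exp (3 / 2) * (l + 1)) (by positivity) (by positivity),
    ENNReal.ofReal_mul (p := (p : ℝ)) (q := Real.exp (-l ^ 2 / 2)) (by positivity), ENNReal.ofReal_natCast]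
  gcongr
  exact mul_le_of_le_one_right zero_le h2

/-- **Nazarov's inequality**: Gaussian anti-concentration for a shifted maximum, with a covariance
matrix that may be singular. The free parameter `l` separates near from far facets. -/
lemma gaussianLaw_shell_le [NeZero p] (hS : S.PosSemidef) {s l : ℝ} (hs : 0 < s)
    (hpos : ∀ j, s ≤ √(S j j)) (hl : 0 ≤ l) (b : Fin p → ℝ) (δ : ℝ) :
    gaussianLaw S {x | (∃ j, b j < x j) ∧ ∀ j, x j ≤ b j + δ}
      ≤ ENNReal.ofReal (s⁻¹ * (Real.exp (3 / 2) * (l + 1) + p * Real.exp (-l ^ 2 / 2)))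
        * ENNReal.ofReal δ := by
  have hp : ∀ j, 0 < S j j := fun j => Real.sqrt_pos.1 (hs.trans_le (hpos j))
  -- the part of the shell above the `j`-th facet
  set A := fun j => {x : Fin p → ℝ | (b j < x j ∧ x j ≤ b j + δ) ∧ x ∈ firstArgmax b j} with hA
  have hAm : ∀ j, MeasurableSet (A j) := fun j =>
    ((measurableSet_lt (f := fun _ => b j) (g := fun x : Fin p → ℝ => x j) (by fun_prop)
      (by fun_prop)).inter (measurableSet_le (f := fun x : Fin p → ℝ => x j)
      (g := fun _ => b j + δ) (by fun_prop) (by fun_prop))).inter (measurableSet_firstArgmax b j)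
  have hsub : {x | (∃ j, b j < x j) ∧ ∀ j, x j ≤ b j + δ} ⊆ ⋃ j, A j := by
    rintro x ⟨⟨i, hi⟩, hx⟩
    obtain ⟨j, hj⟩ := exists_mem_firstArgmax b x
    refine Set.mem_iUnion.2 ⟨j, ⟨?_, hx j⟩, hj⟩
    have := hj.1 i
    linarith
  -- the Gaussian measure of the `j`-th facet of the polyhedron shifted by `t`
  set f := fun (j : Fin p) (t : ℝ) => gaussianPDF 0 (S j j).toNNReal (b j + t)
    * gaussianLaw S {x | resample S j (b j + t) x ∈ firstArgmax b j} with hf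
  have hfm0 : ∀ j, Measurable fun y =>
      gaussianLaw S {x | resample S j y x ∈ firstArgmax b j} := fun j =>
    measurable_measure_prodMk_left ((measurable_resample j) (measurableSet_firstArgmax b j))
  have hfm : ∀ j, Measurable (f j) := fun j =>
    ((measurable_gaussianPDF _ _).comp (measurable_const_add _)).mul
      ((hfm0 j).comp (measurable_const_add _))
  have h1 : ∀ j, gaussianLaw S (A j) = ∫⁻ t in Set.Ioc 0 δ, f j t := by
    intro j
    have hv : (S j j).toNNReal ≠ 0 := by simpa using hp j
    conv_lhs => rw [← map_resample_gaussianLaw hS (hp j)]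
    rw [Measure.map_apply (measurable_resample j) (hAm j), Measure.prod_apply
      ((measurable_resample j) (hAm j)), gaussianReal_of_var_ne_zero _ hv,
      lintegral_withDensity_eq_lintegral_mul _ (measurable_gaussianPDF _ _)
      (measurable_measure_prodMk_left ((measurable_resample j) (hAm j))),
      ← lintegral_add_left_eq_self _ (b j), ← lintegral_indicator measurableSet_Ioc]
    refine lintegral_congr fun t => ?_
    simp only [Pi.mul_apply, hf]
    by_cases ht : t ∈ Set.Ioc 0 δ
    · rw [Set.indicator_of_mem ht]
      congr 2
      ext x
      simp [hA, resample_apply_self (hp j).ne', ht.1, ht.2]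
    · rw [Set.indicator_of_notMem ht]
      have : Prod.mk (b j + t) ⁻¹' ((fun z : ℝ × (Fin p → ℝ) => resample S j z.1 z.2) ⁻¹' A j)
          = ∅ := by
        ext x
        simp only [hA, Set.mem_preimage, Set.mem_ofPred_eq, resample_apply_self (hp j).ne',
          Set.mem_empty_iff_false, iff_false]
        rintro ⟨⟨h, h'⟩, -⟩
        exact ht ⟨by linarith, by linarith⟩
      rw [this]; simp
  calc gaussianLaw S {x | (∃ j, b j < x j) ∧ ∀ j, x j ≤ b j + δ}
      ≤ ∑ j, gaussianLaw S (A j) :=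
        (measure_mono hsub).trans (measure_iUnion_fintype_le _ _)
    _ = ∫⁻ t in Set.Ioc 0 δ, ∑ j, f j t := by
        simp only [h1]
        rw [lintegral_finsetSum _ fun j _ => hfm j]
    _ ≤ ∫⁻ _ in Set.Ioc 0 δ, ENNReal.ofReal
          (s⁻¹ * (Real.exp (3 / 2) * (l + 1) + p * Real.exp (-l ^ 2 / 2))) := by
        refine lintegral_mono fun t => ?_
        have := sum_facet_le hS hs hpos hl (fun k => b k + t)
        simpa only [firstArgmax_add_const] using this
    _ = _ := by simp

/-- Nazarov's inequality for `l = √(2 log p)`, which makes `p * exp (-l ^ 2 / 2)` equal to `1`. -/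
lemma gaussianLaw_shell_le_sqrt_log (hp : 2 ≤ p) (hS : S.PosSemidef) {s : ℝ} (hs : 0 < s)
    (hpos : ∀ j, s ≤ √(S j j)) (b : Fin p → ℝ) (δ : ℝ) :
    gaussianLaw S {x | (∃ j, b j < x j) ∧ ∀ j, x j ≤ b j + δ}
      ≤ ENNReal.ofReal (25 * √(Real.log p) / s * δ) := by
  have : NeZero p := ⟨by omega⟩
  have hp2 : (2 : ℝ) ≤ p := by exact_mod_cast hp
  have hL : 1 / 2 ≤ Real.log p :=
    (by linarith [Real.log_two_gt_d9] : (1 : ℝ) / 2 ≤ Real.log 2).trans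
      (Real.log_le_log (by norm_num) hp2)
  refine (gaussianLaw_shell_le hS hs hpos (Real.sqrt_nonneg (2 * Real.log p)) b δ).trans ?_
  rw [ENNReal.ofReal_mul (p := 25 * √(Real.log p) / s) (by positivity)]
  gcongr
  have he : Real.exp (3 / 2) ≤ 7.4 := by
    have h := Real.exp_one_lt_d9
    have h2 : Real.exp (3 / 2) ≤ Real.exp 1 * Real.exp 1 := by
      rw [← Real.exp_add]; exact Real.exp_le_exp.2 (by norm_num)
    nlinarith [Real.exp_pos 1]
  have hsq : √(2 * Real.log p) ^ 2 = 2 * Real.log p := Real.sq_sqrt (by linarith)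
  have hone : (p : ℝ) * Real.exp (-√(2 * Real.log p) ^ 2 / 2) = 1 := by
    rw [hsq, show -(2 * Real.log p) / 2 = -Real.log p by ring, Real.exp_neg,
      Real.exp_log (by linarith), mul_inv_cancel₀ (by linarith)]
  have h2 : √(2 * Real.log p) ≤ 3 / 2 * √(Real.log p) := by
    rw [Real.sqrt_mul (by norm_num)]
    gcongr
    rw [Real.sqrt_le_left (by norm_num)]; norm_num
  have h1 : 1 ≤ 3 / 2 * √(Real.log p) := by
    have : √(4 / 9) ≤ √(Real.log p) := Real.sqrt_le_sqrt (by linarith)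
    rw [show (4 / 9 : ℝ) = (2 / 3) ^ 2 by norm_num, Real.sqrt_sq (by norm_num)] at this
    linarith
  rw [hone, div_eq_inv_mul _ s]
  gcongr
  nlinarith [Real.sqrt_nonneg (2 * Real.log p), Real.sqrt_nonneg (Real.log p)]

/-- Anti-concentration near the boundary of a box: the shell of a two-sided box is covered by the
shells of two one-sided ones, and the law is symmetric. -/
lemma gaussianLaw_box_shell_le (hp : 2 ≤ p) (hS : S.PosSemidef) {s : ℝ} (hs : 0 < s)
    (hpos : ∀ j, s ≤ √(S j j)) (a b : Fin p → ℝ) (δ : ℝ) :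
    gaussianLaw S {x | (∃ j, b j < x j ∨ x j < a j) ∧ ∀ j, x j ≤ b j + δ ∧ a j - δ ≤ x j}
      ≤ ENNReal.ofReal (50 * √(Real.log p) / s * δ) := by
  have h1 := gaussianLaw_shell_le_sqrt_log hp hS hs hpos b δ
  have h2 := gaussianLaw_shell_le_sqrt_log hp hS hs hpos (fun j => -a j) δ
  have hm : MeasurableSet {x : Fin p → ℝ | (∃ j, -a j < x j) ∧ ∀ j, x j ≤ -a j + δ} := by
    measurability
  rw [← map_neg_gaussianLaw hS, Measure.map_apply measurable_neg hm] at h2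
  refine (measure_mono ?_).trans ((measure_union_le _ _).trans ((add_le_add h1 h2).trans ?_))
  · rintro x ⟨⟨j, hj | hj⟩, hx⟩
    · exact Or.inl ⟨⟨j, hj⟩, fun k => (hx k).1⟩
    · refine Or.inr ⟨⟨j, ?_⟩, fun k => ?_⟩
      · simpa using hj
      · have := (hx k).2
        simp only [Pi.neg_apply]
        linarith
  · rw [← two_mul]
    have : ENNReal.ofReal (50 * √(Real.log p) / s * δ)
        = 2 * ENNReal.ofReal (25 * √(Real.log p) / s * δ) := by
      rw [← ENNReal.ofReal_ofNat 2, ← ENNReal.ofReal_mul (by norm_num)]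
      congr 1; ring
    rw [this]

/-- The same shell, seen from the point `w` at noise level `t`. -/
lemma gaussianLaw_affine_box_shell_le (hp : 2 ≤ p) (hS : S.PosSemidef) {s : ℝ} (hs : 0 < s)
    (hpos : ∀ j, s ≤ √(S j j)) (a b w : Fin p → ℝ) (δ : ℝ) {t : ℝ} (ht : 0 < t) :
    gaussianLaw S {z | (∃ j, b j < (w + t • z) j ∨ (w + t • z) j < a j)
        ∧ ∀ j, (w + t • z) j ≤ b j + δ ∧ a j - δ ≤ (w + t • z) j}
      ≤ ENNReal.ofReal (50 * √(Real.log p) / s * (δ / t)) := by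
  refine (measure_mono ?_).trans (gaussianLaw_box_shell_le hp hS hs hpos
    (fun j => (a j - w j) / t) (fun j => (b j - w j) / t) (δ / t))
  rintro z ⟨⟨j, hj⟩, hz⟩
  refine ⟨⟨j, ?_⟩, fun k => ?_⟩
  · simp only [Pi.add_apply, Pi.smul_apply, smul_eq_mul] at hj
    rw [div_lt_iff₀ ht, lt_div_iff₀ ht]
    rcases hj with h | h
    · left; linarith
    · right; linarith
  · have := hz k
    simp only [Pi.add_apply, Pi.smul_apply, smul_eq_mul] at this
    rw [← add_div, ← sub_div, le_div_iff₀ ht, div_le_iff₀ ht]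
    exact ⟨by linarith, by linarith⟩

end Nazarov

/-! ### A smooth cutoff on the logarithmic scale -/

section Cutoff

/-- `H 0` is a smooth profile on `(0, ∞)` with values in `[0, 1]`, and `H 1, …, H 4` are its first four
derivatives: it is `1` up to `1` and `0` from `exp L` on, and the `k`-th derivative is at most
`C / (L q ^ k)`. Nothing is said about derivatives at `q ≤ 0`, nor about `H k` for `k > 4` except
measurability. -/
structure IsLogCutoff (C L : ℝ) (H : ℕ → ℝ → ℝ) : Prop where
  measurable : ∀ k, Measurable (H k)
  hasDerivAt : ∀ k < 4, ∀ q, 0 < q → HasDerivAt (H k) (H (k + 1) q) q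
  mem_Icc : ∀ q, H 0 q ∈ Set.Icc (0 : ℝ) 1
  eq_one : ∀ q, 0 < q → q ≤ 1 → H 0 q = 1
  eq_zero : ∀ q, Real.exp L ≤ q → H 0 q = 0
  deriv_eq_zero : ∀ k, 1 ≤ k → k ≤ 4 → ∀ q, 0 < q → (q < 1 ∨ Real.exp L < q) → H k q = 0
  abs_deriv_le : ∀ k, 1 ≤ k → k ≤ 4 → ∀ q, 0 < q → |H k q| ≤ C / L * (q ^ k)⁻¹

lemma iteratedDeriv_smoothTransition_eq_zero {k : ℕ} (hk : 1 ≤ k) {u : ℝ} (hu : u < 0 ∨ 1 < u) :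
    iteratedDeriv k (fun u => Real.smoothTransition (1 - u)) u = 0 := by
  obtain ⟨c, hc⟩ : ∃ c : ℝ, (fun u => Real.smoothTransition (1 - u)) =ᶠ[nhds u] fun _ => c := by
    rcases hu with hu | hu
    · refine ⟨1, ?_⟩
      filter_upwards [Iio_mem_nhds hu] with v hv
      exact Real.smoothTransition.one_of_one_le (by linarith [Set.mem_Iio.1 hv])
    · refine ⟨0, ?_⟩
      filter_upwards [Ioi_mem_nhds hu] with v hv
      exact Real.smoothTransition.zero_of_nonpos (by linarith [Set.mem_Ioi.1 hv])
  rw [hc.iteratedDeriv_eq, iteratedDeriv_const]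
  simp; omega

lemma exists_iteratedDeriv_smoothTransition_bound :
    ∃ C : ℝ, 0 < C ∧ ∀ k ≤ 4, ∀ u,
      |iteratedDeriv k (fun u => Real.smoothTransition (1 - u)) u| ≤ C := by
  set g : ℝ → ℝ := fun u => Real.smoothTransition (1 - u) with hg
  have hgs : ContDiff ℝ 5 g := Real.smoothTransition.contDiff.comp (contDiff_const.sub contDiff_id)
  have hone : ∀ k ≤ 4, ∃ C : ℝ, ∀ u, |iteratedDeriv k g u| ≤ C := by
    intro k hk
    have hc := hgs.continuous_iteratedDeriv k (by exact_mod_cast (by omega : k ≤ 5))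
    obtain ⟨C, hC⟩ := (isCompact_Icc (a := (0 : ℝ)) (b := 1)).exists_bound_of_continuousOn
      hc.continuousOn
    refine ⟨max C 1, fun u => ?_⟩
    by_cases hu : u ∈ Set.Icc (0 : ℝ) 1
    · exact (hC u hu).trans (le_max_left _ _)
    rcases k with _ | k
    · refine le_trans ?_ (le_max_right _ _)
      rw [iteratedDeriv_zero, abs_of_nonneg (Real.smoothTransition.nonneg _)]
      exact Real.smoothTransition.le_one _
    · rw [iteratedDeriv_smoothTransition_eq_zero (by omega)]
      · simp
      · rw [Set.mem_Icc, not_and_or, not_le, not_le] at hu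
        exact hu
  choose! C hC using hone
  refine ⟨∑ k ∈ Finset.range 5, |C k| + 1, by positivity, fun k hk u => ?_⟩
  have := Finset.single_le_sum (f := fun k => |C k|) (fun i _ => abs_nonneg _)
    (Finset.mem_range.2 (by omega : k < 5))
  linarith [hC k hk u, le_abs_self (C k)]

/-- The profile `q ↦ g (log q / L)`, for a smooth step `g`, is a cutoff on the logarithmic scale. As `L`
is bounded away from zero, one factor `1 / L` can be kept and the other ones absorbed in `C`. -/
theorem exists_isLogCutoff :
    ∃ C : ℝ, 0 < C ∧ ∀ L : ℝ, 1 / 2 ≤ L → ∃ H, IsLogCutoff C L H := by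
  set g : ℝ → ℝ := fun u => Real.smoothTransition (1 - u) with hg
  have hgs : ContDiff ℝ 5 g := Real.smoothTransition.contDiff.comp (contDiff_const.sub contDiff_id)
  obtain ⟨C, hC0, hC⟩ := exists_iteratedDeriv_smoothTransition_bound
  have hgd : ∀ k < 5, ∀ u, HasDerivAt (iteratedDeriv k g) (iteratedDeriv (k + 1) g u) u := by
    intro k hk u
    rw [iteratedDeriv_succ]
    exact ((hgs.differentiable_iteratedDeriv k (by exact_mod_cast hk)) u).hasDerivAt
  have hgm : ∀ k ≤ 4, Measurable (iteratedDeriv k g) := fun k hk =>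
    (hgs.continuous_iteratedDeriv k (by exact_mod_cast (by omega : k ≤ 5))).measurable
  have hg0 : ∀ k, 1 ≤ k → ∀ u, u < 0 ∨ 1 < u → iteratedDeriv k g u = 0 := fun k hk u hu =>
    iteratedDeriv_smoothTransition_eq_zero hk hu
  -- `60 = 8 + 24 + 22 + 6` bounds the coefficients of the fourth derivative, as `1 / L ≤ 2`
  refine ⟨60 * C, by positivity, fun L hL => ?_⟩
  have hL0 : 0 < L := by linarith
  set r := L⁻¹ with hr
  have hr0 : 0 < r := inv_pos.2 hL0
  have hr2 : r ≤ 2 := by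
    rw [hr, inv_le_comm₀ hL0 (by norm_num)]; linarith
  set G : ℕ → ℝ → ℝ := fun k q => iteratedDeriv k g (r * Real.log q) with hG
  have hGm : ∀ k ≤ 4, Measurable (G k) := fun k hk =>
    (hgm k hk).comp (Real.measurable_log.const_mul r)
  have hGd : ∀ k < 5, ∀ q, 0 < q → HasDerivAt (G k) (G (k + 1) q * (r * q⁻¹)) q := by
    intro k hk q hq
    exact (hgd k hk _).comp q ((Real.hasDerivAt_log hq.ne').const_mul r)
  have hG0 : ∀ k, 1 ≤ k → ∀ q, 0 < q → (q < 1 ∨ Real.exp L < q) → G k q = 0 := by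
    intro k hk q hq h
    refine hg0 k hk _ (h.imp (fun h => ?_) fun h => ?_)
    · exact mul_neg_of_pos_of_neg hr0 (Real.log_neg hq h)
    · have := (Real.lt_log_iff_exp_lt hq).2 h
      rw [hr, inv_mul_eq_div, lt_div_iff₀ hL0]; linarith
  have hGC : ∀ k ≤ 4, ∀ q, |G k q| ≤ C := fun k hk q => hC k hk _
  have hinv : ∀ q : ℝ, 0 < q → ∀ k : ℕ, HasDerivAt (fun q : ℝ => (q ^ k)⁻¹)
      (-(k * (q ^ (k + 1))⁻¹)) q := by
    intro q hq k
    refine ((hasDerivAt_pow k q).inv (by positivity)).congr_deriv ?_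
    rcases k with _ | k
    · simp
    · simp; field_simp; ring
  set H : ℕ → ℝ → ℝ := fun k => match k with
    | 0 => G 0
    | 1 => fun q => r * G 1 q * (q ^ 1)⁻¹
    | 2 => fun q => (r ^ 2 * G 2 q - r * G 1 q) * (q ^ 2)⁻¹
    | 3 => fun q => (r ^ 3 * G 3 q - 3 * r ^ 2 * G 2 q + 2 * r * G 1 q) * (q ^ 3)⁻¹
    | 4 => fun q => (r ^ 4 * G 4 q - 6 * r ^ 3 * G 3 q + 11 * r ^ 2 * G 2 q - 6 * r * G 1 q)
        * (q ^ 4)⁻¹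
    | _ => 0 with hH
  have hGm0 := hGm 0 (by norm_num); have hGm1 := hGm 1 (by norm_num)
  have hGm2 := hGm 2 (by norm_num); have hGm3 := hGm 3 (by norm_num)
  have hGm4 := hGm 4 (by norm_num)
  refine ⟨H, ⟨?_, ?_, ?_, ?_, ?_, ?_, ?_⟩⟩
  · rintro (_ | _ | _ | _ | _ | k) <;> simp only [hH] <;> fun_prop
  · intro k hk q hq
    have d0 := hGd 0 (by norm_num) q hq
    have d1 := hGd 1 (by norm_num) q hq
    have d2 := hGd 2 (by norm_num) q hq
    have d3 := hGd 3 (by norm_num) q hq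
    interval_cases k
    · refine d0.congr_deriv ?_
      simp only [hH]; ring
    · refine ((d1.const_mul r).mul (hinv q hq 1)).congr_deriv ?_
      simp only [hH]; push_cast; field_simp; ring
    · refine (((d2.const_mul (r ^ 2)).sub (d1.const_mul r)).mul (hinv q hq 2)).congr_deriv ?_
      simp only [hH, Pi.sub_apply]; push_cast; field_simp; ring
    · refine ((((d3.const_mul (r ^ 3)).sub (d2.const_mul (3 * r ^ 2))).add
        (d1.const_mul (2 * r))).mul (hinv q hq 3)).congr_deriv ?_
      simp only [hH, Pi.sub_apply, Pi.add_apply]; push_cast; field_simp; ring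
  · intro q
    simp only [hH, hG, iteratedDeriv_zero, hg]
    exact ⟨Real.smoothTransition.nonneg _, Real.smoothTransition.le_one _⟩
  · intro q hq hq1
    simp only [hH, hG, iteratedDeriv_zero, hg]
    refine Real.smoothTransition.one_of_one_le ?_
    have := mul_nonpos_of_nonneg_of_nonpos hr0.le (Real.log_nonpos hq.le hq1)
    linarith
  · intro q hq
    simp only [hH, hG, iteratedDeriv_zero, hg]
    refine Real.smoothTransition.zero_of_nonpos ?_
    have := (Real.le_log_iff_exp_le ((Real.exp_pos L).trans_le hq)).2 hq
    have : 1 ≤ r * Real.log q := by rw [hr, inv_mul_eq_div, le_div_iff₀ hL0]; linarith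
    linarith
  · intro k hk1 hk4 q hq h
    have z1 := hG0 1 (by norm_num) q hq h
    have z2 := hG0 2 (by norm_num) q hq h
    have z3 := hG0 3 (by norm_num) q hq h
    have z4 := hG0 4 (by norm_num) q hq h
    interval_cases k <;> simp [hH, z1, z2, z3, z4]
  · intro k hk1 hk4 q hq
    have b1 := hGC 1 (by norm_num) q
    have b2 := hGC 2 (by norm_num) q
    have b3 := hGC 3 (by norm_num) q
    have b4 := hGC 4 (by norm_num) q
    have e : 60 * C / L = r * (60 * C) := by rw [hr]; field_simp
    have key : ∀ A : ℝ, |A| ≤ 60 * C → |r * A * (q ^ k)⁻¹| ≤ 60 * C / L * (q ^ k)⁻¹ := by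
      intro A hA
      rw [abs_mul, abs_mul, abs_of_pos hr0, abs_of_pos (by positivity : 0 < (q ^ k)⁻¹), e]
      gcongr
    have hr4 : r ^ 2 ≤ 4 := by nlinarith
    have hr8 : r ^ 3 ≤ 8 := by nlinarith [sq_nonneg r]
    have m : ∀ y c M : ℝ, 0 ≤ c → c ≤ M → |y| ≤ C → |c * y| ≤ M * C := by
      intro y c M hc hM hy
      rw [abs_mul, abs_of_nonneg hc]
      exact mul_le_mul hM hy (abs_nonneg _) (hc.trans hM)
    interval_cases k
    · refine (key (G 1 q) (b1.trans (by linarith)))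
    · have := key (r * G 2 q - G 1 q) (by
        have h1 := m (G 2 q) r 2 hr0.le hr2 b2
        rw [abs_le] at *
        constructor <;> linarith [h1.1, h1.2, b1.1, b1.2])
      convert this using 2
      simp only [hH]; ring
    · have := key (r ^ 2 * G 3 q - 3 * r * G 2 q + 2 * G 1 q) (by
        have h1 := m (G 3 q) (r ^ 2) 4 (by positivity) hr4 b3
        have h2 := m (G 2 q) (3 * r) 6 (by positivity) (by linarith) b2
        rw [abs_le] at *
        constructor <;> linarith [h1.1, h1.2, h2.1, h2.2, b1.1, b1.2])
      convert this using 2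
      simp only [hH]; ring
    · have := key (r ^ 3 * G 4 q - 6 * r ^ 2 * G 3 q + 11 * r * G 2 q - 6 * G 1 q) (by
        have h1 := m (G 4 q) (r ^ 3) 8 (by positivity) hr8 b4
        have h2 := m (G 3 q) (6 * r ^ 2) 24 (by positivity) (by linarith) b3
        have h3 := m (G 2 q) (11 * r) 22 (by positivity) (by linarith) b2
        rw [abs_le] at *
        constructor <;> linarith [h1.1, h1.2, h2.1, h2.2, h3.1, h3.2, b1.1, b1.2])
      convert this using 2
      simp only [hH]; ring

end Cutoff

/-! ### Smooth functions of sums of exponentials -/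

section Trapezoid

/-- The trapezoidal rule for `f 1 - f 0 = ∫ f'`: its error is controlled by the third derivative of `f`
alone. -/
lemma abs_sub_trapezoid_le {f f1 f2 f3 : ℝ → ℝ} {M : ℝ} (h0 : ∀ t, HasDerivAt f (f1 t) t)
    (h1 : ∀ t, HasDerivAt f1 (f2 t) t) (h2 : ∀ t, HasDerivAt f2 (f3 t) t)
    (hM : ∀ t ∈ Set.Icc (0 : ℝ) 1, |f3 t| ≤ M) :
    |f 1 - f 0 - 1 / 2 * (f1 0 + f1 1)| ≤ M := by
  have hM0 : 0 ≤ M := (abs_nonneg _).trans (hM 0 (by simp))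
  set g1 : ℝ → ℝ := fun t => 1 / 2 * f1 t - 1 / 2 * f1 0 - t / 2 * f2 t with hg1
  have d1 : ∀ t, HasDerivAt g1 (-(t / 2) * f3 t) t := by
    intro t
    refine ((((h1 t).const_mul (1 / 2)).sub_const (1 / 2 * f1 0)).sub
      (((hasDerivAt_id t).div_const 2).mul (h2 t))).congr_deriv ?_
    simp
  set g : ℝ → ℝ := fun t => f t - f 0 - t / 2 * (f1 0 + f1 t) with hg
  have d0 : ∀ t, HasDerivAt g (g1 t) t := by
    intro t
    refine (((h0 t).sub_const (f 0)).sub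
      (((hasDerivAt_id t).div_const 2).mul ((h1 t).const_add (f1 0)))).congr_deriv ?_
    simp [hg1]; ring
  have b1 : ∀ t ∈ Set.Icc (0 : ℝ) 1, ‖g1 t‖ ≤ M := by
    intro t ht
    have := (convex_Icc (0 : ℝ) 1).norm_image_sub_le_of_norm_hasDerivWithin_le (C := M)
      (fun u _ => (d1 u).hasDerivWithinAt) (fun u hu => ?_) (by simp : (0 : ℝ) ∈ Set.Icc (0 : ℝ) 1)
      ht
    · have hg10 : g1 0 = 0 := by simp [hg1]
      rw [hg10, sub_zero, sub_zero, Real.norm_eq_abs t, abs_of_nonneg ht.1] at this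
      exact this.trans (by nlinarith [ht.2])
    · rw [norm_mul, norm_neg, Real.norm_eq_abs, Real.norm_eq_abs, abs_of_nonneg (by linarith [hu.1])]
      calc u / 2 * |f3 u| ≤ 1 * M :=
            mul_le_mul (by linarith [hu.2]) (hM u hu) (abs_nonneg _) zero_le_one
        _ = M := one_mul M
  have := (convex_Icc (0 : ℝ) 1).norm_image_sub_le_of_norm_hasDerivWithin_le
    (fun u _ => (d0 u).hasDerivWithinAt) b1 (by simp : (0 : ℝ) ∈ Set.Icc (0 : ℝ) 1)
    (by simp : (1 : ℝ) ∈ Set.Icc (0 : ℝ) 1)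
  simpa [hg] using this

end Trapezoid

/-- A finite family of exponentials `x ↦ exp (rate * sign i * x (coord i) - offset i)` of signed
coordinates. The logarithm of their sum is a smooth maximum. -/
structure ExpFamily (ι : Type*) (p : ℕ) where
  /-- The inverse temperature `β`. -/
  rate : ℝ
  /-- The sign of each coordinate. -/
  sign : ι → ℝ
  /-- The coordinate that each term reads. -/
  coord : ι → Fin p
  /-- The shift of each exponent. -/
  offset : ι → ℝ
  rate_pos : 0 < rate
  abs_sign : ∀ i, |sign i| = 1

namespace ExpFamily
variable {ι : Type*} {p : ℕ} (F : ExpFamily ι p)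

/-- The `i`-th exponential. -/
def term (i : ι) (x : Fin p → ℝ) : ℝ := Real.exp (F.rate * (F.sign i * x (F.coord i)) - F.offset i)

/-- The logarithmic derivative of the `i`-th exponential in direction `d`. -/
def lin (d : Fin p → ℝ) (i : ι) : ℝ := F.rate * F.sign i * d (F.coord i)

/-- The logarithmic partial derivative of the `i`-th exponential. -/
def unit (j : Fin p) (i : ι) : ℝ := if F.coord i = j then F.rate * F.sign i else 0

lemma term_pos (i : ι) (x : Fin p → ℝ) : 0 < F.term i x := Real.exp_pos _

lemma measurable_term (i : ι) : Measurable (F.term i) := by unfold term; fun_prop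

lemma abs_lin (d : Fin p → ℝ) (i : ι) : |F.lin d i| = F.rate * |d (F.coord i)| := by
  rw [lin, abs_mul, abs_mul, F.abs_sign, abs_of_pos F.rate_pos, mul_one]

lemma lin_eq_sum (d : Fin p → ℝ) (i : ι) : F.lin d i = ∑ j, F.unit j i * d j := by
  simp [lin, unit]

lemma sum_abs_unit (i : ι) : ∑ j, |F.unit j i| = F.rate := by
  have : ∀ j, |F.unit j i| = if F.coord i = j then F.rate else 0 := by
    intro j
    unfold unit
    split_ifs
    · rw [abs_mul, F.abs_sign, abs_of_pos F.rate_pos, mul_one]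
    · simp
  simp [this]

variable [Fintype ι]

/-- The sum of the exponentials with coefficients `κ`. -/
def wsum (κ : ι → ℝ) (x : Fin p → ℝ) : ℝ := ∑ i, F.term i x * κ i

/-- The sum of the exponentials. -/
def total (x : Fin p → ℝ) : ℝ := ∑ i, F.term i x

/-- The Gibbs weights: each exponential divided by their sum. -/
def gibbs (x : Fin p → ℝ) (i : ι) : ℝ := F.term i x / F.total x

/-- The average of `κ` under the Gibbs weights. -/
def avg (x : Fin p → ℝ) (κ : ι → ℝ) : ℝ := ∑ i, F.gibbs x i * κ i

lemma measurable_wsum (κ : ι → ℝ) : Measurable (F.wsum κ) :=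
  Finset.measurable_sum _ fun i _ => (F.measurable_term i).mul_const _

lemma measurable_total : Measurable F.total :=
  Finset.measurable_sum _ fun i _ => F.measurable_term i

lemma total_pos [Nonempty ι] (x : Fin p → ℝ) : 0 < F.total x :=
  Finset.sum_pos (fun i _ => F.term_pos i x) Finset.univ_nonempty

lemma wsum_one (x : Fin p → ℝ) : F.wsum (fun _ => 1) x = F.total x := by simp [wsum, total]

lemma hasDerivAt_wsum (κ : ι → ℝ) (x d : Fin p → ℝ) (t : ℝ) :
    HasDerivAt (fun t : ℝ => F.wsum κ (x + t • d)) (F.wsum (fun i => κ i * F.lin d i) (x + t • d))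
      t := by
  refine HasDerivAt.fun_sum fun i _ => ?_
  have h : HasDerivAt (fun t : ℝ => F.rate * (F.sign i * (x + t • d) (F.coord i)) - F.offset i)
      (F.lin d i) t := by
    simp only [Pi.add_apply, Pi.smul_apply, smul_eq_mul, lin]
    refine (((((hasDerivAt_id t).mul_const (d (F.coord i))).const_add (x (F.coord i))).const_mul
      (F.sign i)).const_mul F.rate |>.sub_const (F.offset i)).congr_deriv ?_
    ring
  refine (h.exp.mul_const (κ i)).congr_deriv ?_
  simp only [term]; ring

lemma hasDerivAt_total (x d : Fin p → ℝ) (t : ℝ) :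
    HasDerivAt (fun t : ℝ => F.total (x + t • d)) (F.wsum (F.lin d) (x + t • d)) t := by
  have := F.hasDerivAt_wsum (fun _ => 1) x d t
  simpa only [wsum_one, one_mul] using this

lemma wsum_lin_mul (κ : ι → ℝ) (d x : Fin p → ℝ) :
    F.wsum (fun i => κ i * F.lin d i) x = ∑ j, F.wsum (fun i => κ i * F.unit j i) x * d j := by
  simp only [wsum, lin_eq_sum, Finset.mul_sum, Finset.sum_mul]
  rw [Finset.sum_comm]
  exact Finset.sum_congr rfl fun j _ => Finset.sum_congr rfl fun i _ => by ring

lemma wsum_lin (d x : Fin p → ℝ) : F.wsum (F.lin d) x = ∑ j, F.wsum (F.unit j) x * d j := by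
  simpa only [one_mul] using F.wsum_lin_mul (fun _ => 1) d x

lemma abs_wsum_le (κ : ι → ℝ) (x : Fin p → ℝ) : |F.wsum κ x| ≤ ∑ i, F.term i x * |κ i| := by
  refine (Finset.abs_sum_le_sum_abs _ _).trans_eq (Finset.sum_congr rfl fun i _ => ?_)
  rw [abs_mul, abs_of_pos (F.term_pos i x)]

lemma sum_abs_wsum_unit_le (x : Fin p → ℝ) :
    ∑ j, |F.wsum (F.unit j) x| ≤ F.rate * F.total x := by
  calc ∑ j, |F.wsum (F.unit j) x| ≤ ∑ j, ∑ i, F.term i x * |F.unit j i| :=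
        Finset.sum_le_sum fun j _ => F.abs_wsum_le _ _
    _ = F.rate * F.total x := by
        rw [Finset.sum_comm, total, Finset.mul_sum]
        refine Finset.sum_congr rfl fun i _ => ?_
        rw [← Finset.mul_sum, F.sum_abs_unit, mul_comm]

lemma sum_abs_wsum_unit_mul_unit_le (x : Fin p → ℝ) :
    ∑ j, ∑ k, |F.wsum (fun i => F.unit j i * F.unit k i) x| ≤ F.rate ^ 2 * F.total x := by
  calc ∑ j, ∑ k, |F.wsum (fun i => F.unit j i * F.unit k i) x|
      ≤ ∑ j, ∑ k, ∑ i, F.term i x * |F.unit j i * F.unit k i| :=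
        Finset.sum_le_sum fun j _ => Finset.sum_le_sum fun k _ => F.abs_wsum_le _ _
    _ = ∑ j, ∑ i, F.term i x * |F.unit j i| * F.rate := by
        refine Finset.sum_congr rfl fun j _ => ?_
        rw [Finset.sum_comm]
        refine Finset.sum_congr rfl fun i _ => ?_
        rw [← F.sum_abs_unit i, Finset.mul_sum]
        exact Finset.sum_congr rfl fun k _ => by rw [abs_mul, mul_assoc]
    _ = F.rate ^ 2 * F.total x := by
        rw [Finset.sum_comm, total, Finset.mul_sum]
        refine Finset.sum_congr rfl fun i _ => ?_
        rw [← Finset.sum_mul, ← Finset.mul_sum, F.sum_abs_unit]; ring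

section Profile
variable {C L : ℝ} {H : ℕ → ℝ → ℝ}

/-- The partial derivatives of `H 0 ∘ F.total`. -/
def grad (H : ℕ → ℝ → ℝ) (j : Fin p) (x : Fin p → ℝ) : ℝ :=
  H 1 (F.total x) * F.wsum (F.unit j) x

/-- The second partial derivatives of `H 0 ∘ F.total`. -/
def hess (H : ℕ → ℝ → ℝ) (j k : Fin p) (x : Fin p → ℝ) : ℝ :=
  H 2 (F.total x) * F.wsum (F.unit j) x * F.wsum (F.unit k) x
    + H 1 (F.total x) * F.wsum (fun i => F.unit j i * F.unit k i) x

/-- The transition region of the profile, enlarged by a factor `e` on both sides so that it absorbs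
moves of size at most `1 / β`. -/
def band (L : ℝ) : Set (Fin p → ℝ) :=
  {x | Real.exp (-1) ≤ F.total x ∧ F.total x ≤ Real.exp (L + 1)}

lemma measurableSet_band : MeasurableSet (F.band L) := by
  have : F.band L = F.total ⁻¹' Set.Icc (Real.exp (-1)) (Real.exp (L + 1)) := by
    ext x; simp [band]
  rw [this]
  exact F.measurable_total measurableSet_Icc

lemma measurable_grad (hH : IsLogCutoff C L H) (j : Fin p) : Measurable (F.grad H j) :=
  ((hH.measurable 1).comp F.measurable_total).mul (F.measurable_wsum _)

lemma measurable_hess (hH : IsLogCutoff C L H) (j k : Fin p) : Measurable (F.hess H j k) :=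
  ((((hH.measurable 2).comp F.measurable_total).mul (F.measurable_wsum _)).mul
    (F.measurable_wsum _)).add
    (((hH.measurable 1).comp F.measurable_total).mul (F.measurable_wsum _))

variable [Nonempty ι]

lemma hasDerivAt_profile (hH : IsLogCutoff C L H) {k : ℕ} (hk : k < 4) (x d : Fin p → ℝ) (t : ℝ) :
    HasDerivAt (fun t : ℝ => H k (F.total (x + t • d)))
      (H (k + 1) (F.total (x + t • d)) * F.wsum (F.lin d) (x + t • d)) t :=
  HasDerivAt.comp t (hH.hasDerivAt k hk _ (F.total_pos _)) (F.hasDerivAt_total x d t)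

lemma hasDerivAt_grad (hH : IsLogCutoff C L H) (j : Fin p) (x d : Fin p → ℝ) (t : ℝ) :
    HasDerivAt (fun t : ℝ => F.grad H j (x + t • d)) (∑ k, F.hess H j k (x + t • d) * d k) t := by
  refine ((F.hasDerivAt_profile hH (by norm_num : 1 < 4) x d t).mul
    (F.hasDerivAt_wsum (F.unit j) x d t)).congr_deriv ?_
  rw [wsum_lin, wsum_lin_mul, Finset.mul_sum, Finset.mul_sum, Finset.sum_mul,
    ← Finset.sum_add_distrib]
  exact Finset.sum_congr rfl fun k _ => by rw [hess]; ring

lemma abs_profile_le (hH : IsLogCutoff C L H) {k : ℕ} (hk : 1 ≤ k) (hk4 : k ≤ 4)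
    (x : Fin p → ℝ) :
    |H k (F.total x)| ≤ (F.band L).indicator (fun _ => C / L) x * (F.total x ^ k)⁻¹ := by
  by_cases hx : x ∈ F.band L
  · rw [Set.indicator_of_mem hx]
    exact hH.abs_deriv_le k hk hk4 _ (F.total_pos x)
  · rw [Set.indicator_of_notMem hx, zero_mul, hH.deriv_eq_zero k hk hk4 _ (F.total_pos x), abs_zero]
    by_contra! h
    refine hx ⟨le_trans ?_ h.1, h.2.trans (Real.exp_le_exp.2 (by linarith))⟩
    rw [Real.exp_le_one_iff]; norm_num

lemma sum_abs_grad_le (hH : IsLogCutoff C L H) (hC : 0 ≤ C / L) (x : Fin p → ℝ) :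
    ∑ j, |F.grad H j x| ≤ (F.band L).indicator (fun _ => C / L * F.rate) x := by
  have hq := F.total_pos x
  have hI : 0 ≤ (F.band L).indicator (fun _ => C / L) x := Set.indicator_nonneg (fun _ _ => hC) x
  have h1 := F.abs_profile_le hH le_rfl (by norm_num) x
  calc ∑ j, |F.grad H j x| = |H 1 (F.total x)| * ∑ j, |F.wsum (F.unit j) x| := by
        rw [Finset.mul_sum]; simp only [grad, abs_mul]
    _ ≤ ((F.band L).indicator (fun _ => C / L) x * (F.total x ^ 1)⁻¹) * (F.rate * F.total x) :=
        mul_le_mul h1 (F.sum_abs_wsum_unit_le x) (Finset.sum_nonneg fun _ _ => abs_nonneg _)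
          (by positivity)
    _ = (F.band L).indicator (fun _ => C / L) x * F.rate := by field_simp
    _ = _ := by rw [← Set.indicator_mul_const]

lemma sum_abs_hess_le (hH : IsLogCutoff C L H) (hC : 0 ≤ C / L) (x : Fin p → ℝ) :
    ∑ j, ∑ k, |F.hess H j k x| ≤ (F.band L).indicator (fun _ => 2 * (C / L) * F.rate ^ 2) x := by
  have hq := F.total_pos x
  have hI : 0 ≤ (F.band L).indicator (fun _ => C / L) x := Set.indicator_nonneg (fun _ _ => hC) x
  have h1 := F.abs_profile_le hH le_rfl (by norm_num) x
  have h2 := F.abs_profile_le hH (by norm_num : 1 ≤ 2) (by norm_num) x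
  have hs := F.sum_abs_wsum_unit_le x
  have hs0 : 0 ≤ ∑ j, |F.wsum (F.unit j) x| := Finset.sum_nonneg fun _ _ => abs_nonneg _
  calc ∑ j, ∑ k, |F.hess H j k x|
      ≤ ∑ j, ∑ k, (|H 2 (F.total x)| * |F.wsum (F.unit j) x| * |F.wsum (F.unit k) x|
        + |H 1 (F.total x)| * |F.wsum (fun i => F.unit j i * F.unit k i) x|) := by
        gcongr with j _ k _
        rw [hess, ← abs_mul, ← abs_mul, ← abs_mul]
        exact abs_add_le _ _
    _ = |H 2 (F.total x)| * ((∑ j, |F.wsum (F.unit j) x|) * ∑ k, |F.wsum (F.unit k) x|)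
        + |H 1 (F.total x)| * ∑ j, ∑ k, |F.wsum (fun i => F.unit j i * F.unit k i) x| := by
        rw [Finset.sum_mul_sum]
        simp only [Finset.sum_add_distrib, Finset.mul_sum, mul_assoc]
    _ ≤ ((F.band L).indicator (fun _ => C / L) x * (F.total x ^ 2)⁻¹)
          * ((F.rate * F.total x) * (F.rate * F.total x))
        + ((F.band L).indicator (fun _ => C / L) x * (F.total x ^ 1)⁻¹)
          * (F.rate ^ 2 * F.total x) := by
        have hr := F.rate_pos
        refine add_le_add (mul_le_mul h2 (mul_le_mul hs hs hs0 (by positivity))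
          (mul_nonneg hs0 hs0) (by positivity))
          (mul_le_mul h1 (F.sum_abs_wsum_unit_mul_unit_le x)
          (Finset.sum_nonneg fun _ _ => Finset.sum_nonneg fun _ _ => abs_nonneg _) (by positivity))
    _ = (F.band L).indicator (fun _ => C / L) x * (2 * F.rate ^ 2) := by field_simp; ring
    _ = _ := by
        rw [← Set.indicator_mul_const]
        congr 1; ext; ring

end Profile
end ExpFamily

/-! ### The trapezoidal remainder -/

lemma abs_add_seven_le {x₁ x₂ x₃ x₄ x₅ x₆ x₇ K m₁ m₂ m₃ m₄ m₅ m₆ m₇ : ℝ} (h₁ : |x₁| ≤ K * m₁)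
    (h₂ : |x₂| ≤ K * m₂) (h₃ : |x₃| ≤ K * m₃) (h₄ : |x₄| ≤ K * m₄) (h₅ : |x₅| ≤ K * m₅)
    (h₆ : |x₆| ≤ K * m₆) (h₇ : |x₇| ≤ K * m₇) :
    |x₁ + 3 * x₂ + 3 * x₃ + x₄ + 3 * x₅ + 3 * x₆ + x₇|
      ≤ 3 * K * (m₁ + m₂ + m₃ + m₄ + m₅ + m₆ + m₇) := by
  have n₁ := (abs_nonneg _).trans h₁
  have n₄ := (abs_nonneg _).trans h₄
  have n₇ := (abs_nonneg _).trans h₇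
  rw [abs_le] at *
  constructor <;> linarith [h₁.1, h₂.1, h₃.1, h₄.1, h₅.1, h₆.1, h₇.1, h₁.2, h₂.2, h₃.2, h₄.2, h₅.2,
    h₆.2, h₇.2]

namespace ExpFamily
variable {ι : Type*} {p : ℕ} (F : ExpFamily ι p)

lemma term_add_smul_le {d : Fin p → ℝ} (hd : ∀ j, F.rate * |d j| ≤ 1) {t : ℝ} (ht : |t| ≤ 1)
    (i : ι) (x : Fin p → ℝ) : F.term i (x + t • d) ≤ Real.exp 1 * F.term i x := by
  rw [term, term, ← Real.exp_add]
  apply Real.exp_le_exp.2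
  have h : F.lin d i * t ≤ 1 := by
    refine (le_abs_self _).trans ?_
    rw [abs_mul, abs_lin]
    calc F.rate * |d (F.coord i)| * |t| ≤ 1 * 1 :=
          mul_le_mul (hd _) ht (abs_nonneg _) zero_le_one
      _ = 1 := one_mul 1
  simp only [Pi.add_apply, Pi.smul_apply, smul_eq_mul]
  rw [lin] at h
  linarith

variable [Fintype ι]

lemma total_add_smul_le {d : Fin p → ℝ} (hd : ∀ j, F.rate * |d j| ≤ 1) {t : ℝ} (ht : |t| ≤ 1)
    (x : Fin p → ℝ) : F.total (x + t • d) ≤ Real.exp 1 * F.total x := by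
  rw [total, total, Finset.mul_sum]
  exact Finset.sum_le_sum fun i _ => F.term_add_smul_le hd ht i x

lemma total_le_add_smul {d : Fin p → ℝ} (hd : ∀ j, F.rate * |d j| ≤ 1) {t : ℝ} (ht : |t| ≤ 1)
    (x : Fin p → ℝ) : F.total x ≤ Real.exp 1 * F.total (x + t • d) := by
  have := F.total_add_smul_le hd (t := -t) (by simpa using ht) (x + t • d)
  simpa using this

lemma avg_nonneg (x : Fin p → ℝ) {κ : ι → ℝ} (hκ : ∀ i, 0 ≤ κ i) : 0 ≤ F.avg x κ :=
  Finset.sum_nonneg fun i _ => mul_nonneg (div_nonneg (F.term_pos i x).le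
    (Finset.sum_nonneg fun i _ => (F.term_pos i x).le)) (hκ i)

lemma measurable_gibbs (i : ι) : Measurable fun x => F.gibbs x i :=
  (F.measurable_term i).div F.measurable_total

lemma sum_gibbs_mul_eq (x : Fin p → ℝ) (A₁ A₂ A₃ A₄ : ι → ℝ) :
    ∑ i : ι × ι × ι × ι, (F.gibbs x i.1 * F.gibbs x i.2.1 * F.gibbs x i.2.2.1 * F.gibbs x i.2.2.2)
      * (A₁ i.1 * A₂ i.2.1 * A₃ i.2.2.1 * A₄ i.2.2.2)
      = F.avg x A₁ * F.avg x A₂ * F.avg x A₃ * F.avg x A₄ := by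
  simp only [Fintype.sum_prod_type]
  have : ∀ a b c d, (F.gibbs x a * F.gibbs x b * F.gibbs x c * F.gibbs x d)
      * (A₁ a * A₂ b * A₃ c * A₄ d) = (F.gibbs x a * A₁ a) * ((F.gibbs x b * A₂ b)
        * ((F.gibbs x c * A₃ c) * (F.gibbs x d * A₄ d))) := fun a b c d => by ring
  simp only [this, ← Finset.mul_sum, ← Finset.sum_mul]
  simp only [avg]; ring

/-- The ways in which the four slots of the fourth derivative of a function of
`∑ i, exp (ℓ i x)` share their indices. Unused components of the index are summed out. -/
def slotPattern (n : Fin 7) (i : ι × ι × ι × ι) : ι × ι × ι × ι :=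
  match n with
  | 0 => i
  | 1 => (i.1, i.2.1, i.2.1, i.2.2.1)
  | 2 => (i.1, i.1, i.2.1, i.2.2.1)
  | 3 => (i.1, i.2.1, i.2.1, i.2.1)
  | 4 => (i.1, i.1, i.2.1, i.2.1)
  | 5 => (i.1, i.1, i.1, i.2.1)
  | 6 => (i.1, i.1, i.1, i.1)

/-- The coordinates read by the four slots. -/
def slotCoord (κ : Fin 7 × ι × ι × ι × ι) : Fin p × Fin p × Fin p × Fin p :=
  (F.coord (slotPattern κ.1 κ.2).1, F.coord (slotPattern κ.1 κ.2).2.1,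
    F.coord (slotPattern κ.1 κ.2).2.2.1, F.coord (slotPattern κ.1 κ.2).2.2.2)

/-- The weight of a choice of slots in the bound for the fourth derivative. The factor `3` is the
largest multiplicity of a pattern; the factor `exp 8` pays for moves of size at most `1 / β`, a factor
`e` for each exponential and each inverse power of their sum. -/
def slotWeight (C L : ℝ) (x : Fin p → ℝ) (κ : Fin 7 × ι × ι × ι × ι) : ℝ :=
  (F.band L).indicator (fun _ => 3 * Real.exp 8 * (C / L) * F.rate ^ 4) x *
    (F.gibbs x κ.2.1 * F.gibbs x κ.2.2.1 * F.gibbs x κ.2.2.2.1 * F.gibbs x κ.2.2.2.2)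

lemma measurable_slotWeight (C L : ℝ) (κ : Fin 7 × ι × ι × ι × ι) :
    Measurable fun x => F.slotWeight C L x κ :=
  (measurable_const.indicator F.measurableSet_band).mul
    ((((F.measurable_gibbs _).mul (F.measurable_gibbs _)).mul (F.measurable_gibbs _)).mul
      (F.measurable_gibbs _))

variable [Nonempty ι]

lemma gibbs_nonneg (x : Fin p → ℝ) (i : ι) : 0 ≤ F.gibbs x i :=
  div_nonneg (F.term_pos i x).le (F.total_pos x).le

lemma sum_gibbs (x : Fin p → ℝ) : ∑ i, F.gibbs x i = 1 := by
  simp only [gibbs]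
  rw [← Finset.sum_div]
  exact div_self (F.total_pos x).ne'

lemma abs_wsum_add_smul_le {d : Fin p → ℝ} (hd : ∀ j, F.rate * |d j| ≤ 1) {t : ℝ} (ht : |t| ≤ 1)
    (κ : ι → ℝ) (x : Fin p → ℝ) :
    |F.wsum κ (x + t • d)| ≤ Real.exp 1 * F.total x * F.avg x fun i => |κ i| := by
  refine (F.abs_wsum_le κ _).trans ?_
  rw [avg, Finset.mul_sum]
  refine Finset.sum_le_sum fun i _ => ?_
  have := F.total_pos x
  calc F.term i (x + t • d) * |κ i| ≤ (Real.exp 1 * F.term i x) * |κ i| :=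
        mul_le_mul_of_nonneg_right (F.term_add_smul_le hd ht i x) (abs_nonneg _)
    _ = _ := by rw [gibbs]; field_simp

variable {C L : ℝ} {H : ℕ → ℝ → ℝ}

/-- On the enlarged transition region the derivatives of the profile are stable under moves of size
at most `1 / β`. -/
lemma abs_profile_add_smul_le (hH : IsLogCutoff C L H) (hC : 0 ≤ C / L) {d : Fin p → ℝ}
    (hd : ∀ j, F.rate * |d j| ≤ 1) {t : ℝ} (ht : |t| ≤ 1) {k : ℕ} (hk : 1 ≤ k) (hk4 : k ≤ 4)
    (x : Fin p → ℝ) :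
    |H k (F.total (x + t • d))|
      ≤ (F.band L).indicator (fun _ => C / L) x * (Real.exp 1 ^ k * (F.total x ^ k)⁻¹) := by
  have hq := F.total_pos x
  have hq' := F.total_pos (x + t • d)
  have h1 := F.total_add_smul_le hd ht x
  have h2 := F.total_le_add_smul hd ht x
  by_cases hx : x ∈ F.band L
  · rw [Set.indicator_of_mem hx]
    refine (hH.abs_deriv_le k hk hk4 _ hq').trans ?_
    gcongr
    rw [← div_eq_mul_inv, inv_eq_one_div, div_le_div_iff₀ (by positivity) (by positivity), one_mul,
      ← mul_pow]
    exact pow_le_pow_left₀ hq.le h2 k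
  · rw [Set.indicator_of_notMem hx, zero_mul, hH.deriv_eq_zero k hk hk4 _ hq', abs_zero]
    by_contra! h
    refine hx ⟨?_, ?_⟩
    · rw [Real.exp_neg, inv_le_iff_one_le_mul₀' (Real.exp_pos 1)]
      exact h.1.trans h1
    · rw [add_comm, Real.exp_add]
      exact h2.trans (mul_le_mul_of_nonneg_left h.2 (Real.exp_nonneg 1))

lemma avg_one (x : Fin p → ℝ) : F.avg x (fun _ => 1) = 1 := by
  simp only [avg, mul_one]; exact F.sum_gibbs x

lemma sum_slotWeight (x : Fin p → ℝ) :
    ∑ κ, F.slotWeight C L x κ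
      = (F.band L).indicator (fun _ => 21 * Real.exp 8 * (C / L) * F.rate ^ 4) x := by
  have h := F.sum_gibbs_mul_eq x (fun _ => 1) (fun _ => 1) (fun _ => 1) (fun _ => 1)
  simp only [avg_one, mul_one] at h
  rw [Fintype.sum_prod_type]
  simp only [slotWeight, ← Finset.mul_sum, h, mul_one]
  rw [Finset.sum_const, Finset.card_univ, Fintype.card_fin, nsmul_eq_mul,
    ← Set.indicator_const_mul]
  congr 1; ext; push_cast; ring

lemma slotWeight_nonneg (hC : 0 ≤ C / L) (x : Fin p → ℝ) (κ : Fin 7 × ι × ι × ι × ι) :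
    0 ≤ F.slotWeight C L x κ := by
  have := F.rate_pos
  refine mul_nonneg (Set.indicator_nonneg (fun _ _ => by positivity) _) ?_
  have := F.gibbs_nonneg x
  exact mul_nonneg (mul_nonneg (mul_nonneg (this _) (this _)) (this _)) (this _)

lemma sum_slotWeight_mul (x g d : Fin p → ℝ) :
    ∑ κ, F.slotWeight C L x κ * |g (F.slotCoord κ).1 * d (F.slotCoord κ).2.1
        * d (F.slotCoord κ).2.2.1 * d (F.slotCoord κ).2.2.2|
      = (F.band L).indicator (fun _ => C / L) x * (3 * Real.exp 8) *
        (F.avg x (fun i => |F.lin g i|) * F.avg x (fun i => |F.lin d i|)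
            * F.avg x (fun i => |F.lin d i|) * F.avg x (fun i => |F.lin d i|)
          + F.avg x (fun i => |F.lin g i|) * F.avg x (fun i => |F.lin d i * F.lin d i|)
            * F.avg x (fun i => |F.lin d i|)
          + F.avg x (fun i => |F.lin g i * F.lin d i|) * F.avg x (fun i => |F.lin d i|)
            * F.avg x (fun i => |F.lin d i|)
          + F.avg x (fun i => |F.lin g i|)
            * F.avg x (fun i => |F.lin d i * F.lin d i * F.lin d i|)
          + F.avg x (fun i => |F.lin g i * F.lin d i|) * F.avg x (fun i => |F.lin d i * F.lin d i|)
          + F.avg x (fun i => |F.lin g i * F.lin d i * F.lin d i|) * F.avg x (fun i => |F.lin d i|)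
          + F.avg x (fun i => |F.lin g i * F.lin d i * F.lin d i * F.lin d i|)) := by
  have hI : (F.band L).indicator (fun _ => 3 * Real.exp 8 * (C / L) * F.rate ^ 4) x
      = (F.band L).indicator (fun _ => C / L) x * (3 * Real.exp 8) * F.rate ^ 4 := by
    rw [← Set.indicator_mul_const, ← Set.indicator_mul_const]
    congr 1; ext; ring
  have hr := F.rate_pos
  have hl : ∀ i, |g (F.coord i)| = F.rate⁻¹ * |F.lin g i| := fun i => by
    rw [abs_lin]; field_simp
  have hl' : ∀ i, |d (F.coord i)| = F.rate⁻¹ * |F.lin d i| := fun i => by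
    rw [abs_lin]; field_simp
  rw [Fintype.sum_prod_type, Fin.sum_univ_seven, mul_add, mul_add, mul_add, mul_add, mul_add,
    mul_add]
  set I := (F.band L).indicator (fun _ => C / L) x * (3 * Real.exp 8) with hIdef
  have key : ∀ (n : Fin 7) (A₁ A₂ A₃ A₄ : ι → ℝ),
      (∀ i : ι × ι × ι × ι, |F.lin g (slotPattern n i).1| * |F.lin d (slotPattern n i).2.1|
        * |F.lin d (slotPattern n i).2.2.1| * |F.lin d (slotPattern n i).2.2.2|
        = A₁ i.1 * A₂ i.2.1 * A₃ i.2.2.1 * A₄ i.2.2.2) →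
      ∑ i : ι × ι × ι × ι, F.slotWeight C L x (n, i) * |g (F.slotCoord (n, i)).1
        * d (F.slotCoord (n, i)).2.1 * d (F.slotCoord (n, i)).2.2.1
        * d (F.slotCoord (n, i)).2.2.2|
      = I * (F.avg x A₁ * F.avg x A₂ * F.avg x A₃ * F.avg x A₄) := by
    intro n A₁ A₂ A₃ A₄ h
    rw [← F.sum_gibbs_mul_eq, Finset.mul_sum]
    refine Finset.sum_congr rfl fun i _ => ?_
    rw [← h i, slotWeight, hI, abs_mul, abs_mul, abs_mul]
    simp only [slotCoord, hl, hl']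
    field_simp
  rw [key 0 (fun i => |F.lin g i|) (fun i => |F.lin d i|) (fun i => |F.lin d i|)
      (fun i => |F.lin d i|) (fun i => rfl),
    key 1 (fun i => |F.lin g i|) (fun i => |F.lin d i * F.lin d i|) (fun i => |F.lin d i|)
      (fun _ => 1) (fun i => by simp only [slotPattern, abs_mul]; ring),
    key 2 (fun i => |F.lin g i * F.lin d i|) (fun i => |F.lin d i|) (fun i => |F.lin d i|)
      (fun _ => 1) (fun i => by simp only [slotPattern, abs_mul]; ring),
    key 3 (fun i => |F.lin g i|) (fun i => |F.lin d i * F.lin d i * F.lin d i|) (fun _ => 1)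
      (fun _ => 1) (fun i => by simp only [slotPattern, abs_mul]; ring),
    key 4 (fun i => |F.lin g i * F.lin d i|) (fun i => |F.lin d i * F.lin d i|) (fun _ => 1)
      (fun _ => 1) (fun i => by simp only [slotPattern, abs_mul]; ring),
    key 5 (fun i => |F.lin g i * F.lin d i * F.lin d i|) (fun i => |F.lin d i|) (fun _ => 1)
      (fun _ => 1) (fun i => by simp only [slotPattern, abs_mul]; ring),
    key 6 (fun i => |F.lin g i * F.lin d i * F.lin d i * F.lin d i|) (fun _ => 1) (fun _ => 1)
      (fun _ => 1) (fun i => by simp only [slotPattern, abs_mul]; ring)]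
  simp only [avg_one, mul_one]

/-- The trapezoidal rule for the gradient of the smoothed indicator, with an error that is a
weighted average of products of four coordinates. -/
lemma abs_grad_sub_trapezoid_le (hH : IsLogCutoff C L H) (hC : 0 ≤ C / L) (x g d : Fin p → ℝ)
    (hd : ∀ j, F.rate * |d j| ≤ 1) :
    |∑ j, g j * (F.grad H j (x + d) - F.grad H j x)
        - 1 / 2 * ∑ j, ∑ k, g j * d k * (F.hess H j k x + F.hess H j k (x + d))|
      ≤ ∑ κ, F.slotWeight C L x κ * |g (F.slotCoord κ).1 * d (F.slotCoord κ).2.1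
        * d (F.slotCoord κ).2.2.1 * d (F.slotCoord κ).2.2.2| := by
  rw [sum_slotWeight_mul]
  set a := F.lin g with ha
  set δ := F.lin d with hδ
  set y : ℝ → Fin p → ℝ := fun t => x + t • d with hy
  set q : ℝ → ℝ := fun t => F.total (y t) with hq
  have dw : ∀ (κ : ι → ℝ) t, HasDerivAt (fun t => F.wsum κ (y t))
      (F.wsum (fun i => κ i * δ i) (y t)) t := fun κ t => F.hasDerivAt_wsum κ x d t
  have dH : ∀ k < 4, ∀ t, HasDerivAt (fun t => H k (q t)) (H (k + 1) (q t) * F.wsum δ (y t)) t :=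
    fun k hk t => F.hasDerivAt_profile hH hk x d t
  set f : ℝ → ℝ := fun t => H 1 (q t) * F.wsum a (y t) with hf
  set f1 : ℝ → ℝ := fun t => H 2 (q t) * F.wsum δ (y t) * F.wsum a (y t)
    + H 1 (q t) * F.wsum (fun i => a i * δ i) (y t) with hf1
  set f2 : ℝ → ℝ := fun t => H 3 (q t) * F.wsum δ (y t) * F.wsum δ (y t) * F.wsum a (y t)
    + H 2 (q t) * F.wsum (fun i => δ i * δ i) (y t) * F.wsum a (y t)
    + 2 * (H 2 (q t) * F.wsum δ (y t) * F.wsum (fun i => a i * δ i) (y t))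
    + H 1 (q t) * F.wsum (fun i => a i * δ i * δ i) (y t) with hf2
  -- one summand for each way of distributing the three `δ` over the factors of `f`
  set f3 : ℝ → ℝ := fun t =>
    H 4 (q t) * (F.wsum a (y t) * F.wsum δ (y t) * F.wsum δ (y t) * F.wsum δ (y t))
    + 3 * (H 3 (q t) * (F.wsum a (y t) * F.wsum (fun i => δ i * δ i) (y t) * F.wsum δ (y t)))
    + 3 * (H 3 (q t) * (F.wsum (fun i => a i * δ i) (y t) * F.wsum δ (y t) * F.wsum δ (y t)))
    + H 2 (q t) * (F.wsum a (y t) * F.wsum (fun i => δ i * δ i * δ i) (y t))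
    + 3 * (H 2 (q t) * (F.wsum (fun i => a i * δ i) (y t) * F.wsum (fun i => δ i * δ i) (y t)))
    + 3 * (H 2 (q t) * (F.wsum (fun i => a i * δ i * δ i) (y t) * F.wsum δ (y t)))
    + H 1 (q t) * F.wsum (fun i => a i * δ i * δ i * δ i) (y t) with hf3
  have d0 : ∀ t, HasDerivAt f (f1 t) t := fun t =>
    (dH 1 (by norm_num) t).mul (dw a t)
  have d1 : ∀ t, HasDerivAt f1 (f2 t) t := fun t => by
    refine ((((dH 2 (by norm_num) t).mul (dw δ t)).mul (dw a t)).add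
      ((dH 1 (by norm_num) t).mul (dw _ t))).congr_deriv ?_
    simp only [hf2, Pi.mul_apply]; ring
  have d2 : ∀ t, HasDerivAt f2 (f3 t) t := fun t => by
    refine ((((((dH 3 (by norm_num) t).mul (dw δ t)).mul (dw δ t)).mul (dw a t)).add
      (((dH 2 (by norm_num) t).mul (dw _ t)).mul (dw a t))).add
      ((((dH 2 (by norm_num) t).mul (dw δ t)).mul (dw _ t)).const_mul 2)).add
      ((dH 1 (by norm_num) t).mul (dw _ t)) |>.congr_deriv ?_
    simp only [hf3, Pi.mul_apply]; ring
  have e0 : ∀ t, f t = ∑ j, g j * F.grad H j (y t) := fun t => by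
    simp only [hf, ha, wsum_lin, Finset.mul_sum, grad]
    exact Finset.sum_congr rfl fun j _ => by ring
  have e1 : ∀ t, f1 t = ∑ j, ∑ k, g j * d k * F.hess H j k (y t) := fun t => by
    have h3 : F.wsum (fun i => F.lin g i * δ i) (y t)
        = ∑ j, ∑ k, g j * d k * F.wsum (fun i => F.unit j i * F.unit k i) (y t) := by
      have := F.wsum_lin_mul δ g (y t)
      simp only [mul_comm (δ _)] at this
      rw [this]
      refine Finset.sum_congr rfl fun j _ => ?_
      rw [hδ, wsum_lin_mul, Finset.sum_mul]
      exact Finset.sum_congr rfl fun k _ => by ring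
    simp only [hf1, ha, hδ] at h3 ⊢
    rw [h3, wsum_lin, wsum_lin, mul_assoc, mul_comm (∑ j, _ * d j), Finset.sum_mul_sum,
      Finset.mul_sum, Finset.mul_sum, ← Finset.sum_add_distrib]
    refine Finset.sum_congr rfl fun j _ => ?_
    rw [Finset.mul_sum, Finset.mul_sum, ← Finset.sum_add_distrib]
    exact Finset.sum_congr rfl fun k _ => by rw [hess]; ring
  have hy0 : y 0 = x := by simp [hy]
  have hy1 : y 1 = x + d := by simp [hy]
  have hmain := abs_sub_trapezoid_le d0 d1 d2 (M := (F.band L).indicator (fun _ => C / L) x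
      * (3 * Real.exp 8) * (F.avg x (fun i => |a i|) * F.avg x (fun i => |δ i|)
            * F.avg x (fun i => |δ i|) * F.avg x (fun i => |δ i|)
          + F.avg x (fun i => |a i|) * F.avg x (fun i => |δ i * δ i|)
            * F.avg x (fun i => |δ i|)
          + F.avg x (fun i => |a i * δ i|) * F.avg x (fun i => |δ i|)
            * F.avg x (fun i => |δ i|)
          + F.avg x (fun i => |a i|)
            * F.avg x (fun i => |δ i * δ i * δ i|)
          + F.avg x (fun i => |a i * δ i|) * F.avg x (fun i => |δ i * δ i|)
          + F.avg x (fun i => |a i * δ i * δ i|) * F.avg x (fun i => |δ i|)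
          + F.avg x (fun i => |a i * δ i * δ i * δ i|))) ?_
  · rw [e0, e0, e1, e1, hy0, hy1] at hmain
    convert hmain using 2
    simp only [mul_sub, mul_add, Finset.sum_sub_distrib, Finset.sum_add_distrib]
  intro t ht
  have ht1 : |t| ≤ 1 := by rw [abs_of_nonneg ht.1]; exact ht.2
  set I := (F.band L).indicator (fun _ => C / L) x with hI
  have hI0 : 0 ≤ I := Set.indicator_nonneg (fun _ _ => hC) x
  set Q := F.total x with hQ
  have hQ0 : 0 < Q := F.total_pos x
  set E := Real.exp 1 with hE
  have hE1 : 1 ≤ E := Real.one_le_exp zero_le_one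
  have hE0 : 0 < E := Real.exp_pos 1
  have hE8 : Real.exp 8 = E ^ 8 := by rw [hE, ← Real.exp_nat_mul]; norm_num
  have hw : ∀ κ : ι → ℝ, |F.wsum κ (y t)| ≤ E * Q * F.avg x fun i => |κ i| := fun κ =>
    F.abs_wsum_add_smul_le hd ht1 κ x
  have hm : ∀ κ : ι → ℝ, 0 ≤ F.avg x fun i => |κ i| := fun κ => F.avg_nonneg x fun i => abs_nonneg _
  have hH' : ∀ k, 1 ≤ k → k ≤ 4 → |H k (q t)| ≤ I * (E ^ k * (Q ^ k)⁻¹) := fun k h1 h4 =>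
    F.abs_profile_add_smul_le hH hC hd ht1 h1 h4 x
  have b4 : ∀ κ₁ κ₂ κ₃ κ₄ : ι → ℝ,
      |H 4 (q t) * (F.wsum κ₁ (y t) * F.wsum κ₂ (y t) * F.wsum κ₃ (y t) * F.wsum κ₄ (y t))|
      ≤ I * E ^ 8 * ((F.avg x fun i => |κ₁ i|) * (F.avg x fun i => |κ₂ i|)
        * (F.avg x fun i => |κ₃ i|) * (F.avg x fun i => |κ₄ i|)) := by
    intro κ₁ κ₂ κ₃ κ₄
    have := hm κ₁; have := hm κ₂; have := hm κ₃; have := hm κ₄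
    simp only [abs_mul]
    calc _ ≤ (I * (E ^ 4 * (Q ^ 4)⁻¹)) * ((E * Q * F.avg x fun i => |κ₁ i|)
          * (E * Q * F.avg x fun i => |κ₂ i|) * (E * Q * F.avg x fun i => |κ₃ i|)
          * (E * Q * F.avg x fun i => |κ₄ i|)) := by
            gcongr
            exacts [hH' 4 (by norm_num) le_rfl, hw _, hw _, hw _, hw _]
      _ = _ := by field_simp
  have b3 : ∀ κ₁ κ₂ κ₃ : ι → ℝ,
      |H 3 (q t) * (F.wsum κ₁ (y t) * F.wsum κ₂ (y t) * F.wsum κ₃ (y t))|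
      ≤ I * E ^ 8 * ((F.avg x fun i => |κ₁ i|) * (F.avg x fun i => |κ₂ i|)
        * (F.avg x fun i => |κ₃ i|)) := by
    intro κ₁ κ₂ κ₃
    have := hm κ₁; have := hm κ₂; have := hm κ₃
    simp only [abs_mul]
    calc _ ≤ (I * (E ^ 3 * (Q ^ 3)⁻¹)) * ((E * Q * F.avg x fun i => |κ₁ i|)
          * (E * Q * F.avg x fun i => |κ₂ i|) * (E * Q * F.avg x fun i => |κ₃ i|)) := by
            gcongr
            exacts [hH' 3 (by norm_num) (by norm_num), hw _, hw _, hw _]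
      _ = I * E ^ 6 * ((F.avg x fun i => |κ₁ i|) * (F.avg x fun i => |κ₂ i|)
        * (F.avg x fun i => |κ₃ i|)) := by field_simp
      _ ≤ _ := by gcongr; norm_num
  have b2 : ∀ κ₁ κ₂ : ι → ℝ, |H 2 (q t) * (F.wsum κ₁ (y t) * F.wsum κ₂ (y t))|
      ≤ I * E ^ 8 * ((F.avg x fun i => |κ₁ i|) * (F.avg x fun i => |κ₂ i|)) := by
    intro κ₁ κ₂
    have := hm κ₁; have := hm κ₂
    simp only [abs_mul]
    calc _ ≤ (I * (E ^ 2 * (Q ^ 2)⁻¹)) * ((E * Q * F.avg x fun i => |κ₁ i|)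
          * (E * Q * F.avg x fun i => |κ₂ i|)) := by
            gcongr
            exacts [hH' 2 (by norm_num) (by norm_num), hw _, hw _]
      _ = I * E ^ 4 * ((F.avg x fun i => |κ₁ i|) * (F.avg x fun i => |κ₂ i|)) := by field_simp
      _ ≤ _ := by gcongr; norm_num
  have b1 : ∀ κ₁ : ι → ℝ, |H 1 (q t) * F.wsum κ₁ (y t)|
      ≤ I * E ^ 8 * (F.avg x fun i => |κ₁ i|) := by
    intro κ₁
    have := hm κ₁
    simp only [abs_mul]
    calc _ ≤ (I * (E ^ 1 * (Q ^ 1)⁻¹)) * (E * Q * F.avg x fun i => |κ₁ i|) := by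
            gcongr
            exacts [hH' 1 le_rfl (by norm_num), hw _]
      _ = I * E ^ 2 * (F.avg x fun i => |κ₁ i|) := by field_simp
      _ ≤ _ := by gcongr; norm_num
  have t1 := b4 a δ δ δ
  have t2 := b3 a (fun i => δ i * δ i) δ
  have t3 := b3 (fun i => a i * δ i) δ δ
  have t4 := b2 a (fun i => δ i * δ i * δ i)
  have t5 := b2 (fun i => a i * δ i) (fun i => δ i * δ i)
  have t6 := b2 (fun i => a i * δ i * δ i) δ
  have t7 := b1 (fun i => a i * δ i * δ i * δ i)
  rw [hE8]
  refine (abs_add_seven_le t1 t2 t3 t4 t5 t6 t7).trans_eq ?_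
  ring

end ExpFamily

/-! ### Exchangeable pairs -/

section CondExp
variable {Ω E : Type*} [MeasurableSpace Ω] [mE : MeasurableSpace E] {P : Measure Ω}
  {Y Y' : Ω → E}

lemma integrable_condExpGiven (ξ : Ω → ℝ) : Integrable (condExpGiven P Y ξ) P :=
  integrable_condExp

/-- Functions of `Y` can be taken out of `E[· ∣ Y]` under the expectation. -/
lemma integral_condExpGiven_mul [IsProbabilityMeasure P] (hY : Measurable Y) {ξ : Ω → ℝ} (hξ : Integrable ξ P) {f : E → ℝ}
    (hf : Measurable f) {C : ℝ} (hC : ∀ y, |f y| ≤ C) :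
    ∫ ω, condExpGiven P Y ξ ω * f (Y ω) ∂P = ∫ ω, ξ ω * f (Y ω) ∂P := by
  have hfY : StronglyMeasurable[mE.comap Y] fun ω => f (Y ω) :=
    (hf.comp (comap_measurable Y)).stronglyMeasurable
  have hint : Integrable (fun ω => ξ ω * f (Y ω)) P :=
    hξ.mul_bdd (c := C) (hf.comp hY).aestronglyMeasurable (ae_of_all _ fun ω => hC _)
  rw [← integral_condExp hY.comap_le (f := fun ω => ξ ω * f (Y ω))]
  exact (integral_congr_ae (condExp_mul_of_stronglyMeasurable_right hfY hint hξ)).symm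

lemma IsExchangeablePair.integral_eq (h : IsExchangeablePair P Y Y') {f : E × E → ℝ}
    (hf : Measurable f) : ∫ ω, f (Y ω, Y' ω) ∂P = ∫ ω, f (Y' ω, Y ω) ∂P := by
  obtain ⟨hY, hY', h⟩ := h
  rw [← integral_map (hY.prodMk hY').aemeasurable hf.aestronglyMeasurable, h,
    integral_map (hY'.prodMk hY).aemeasurable hf.aestronglyMeasurable]

lemma integral_eq_zero_of_antisymm (h : IsExchangeablePair P Y Y') {f : E × E → ℝ}
    (hf : Measurable f) (hanti : ∀ᵐ ω ∂P, f (Y' ω, Y ω) = -f (Y ω, Y' ω)) :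
    ∫ ω, f (Y ω, Y' ω) ∂P = 0 := by
  have h1 := h.integral_eq hf
  rw [integral_congr_ae hanti, integral_neg] at h1
  linarith

lemma integrable_iSup_of_finite {K : Type*} [Finite K] {f : K → Ω → ℝ}
    (hf : ∀ i, Integrable (f i) P) : Integrable (fun ω => ⨆ i, f i ω) P := by
  have := Fintype.ofFinite K
  rcases isEmpty_or_nonempty K with h | h
  · simp
  refine (integrable_finsetSum Finset.univ fun i _ => (hf i).abs).mono'
    (AEMeasurable.iSup fun i => (hf i).aemeasurable).aestronglyMeasurable
    (ae_of_all _ fun ω => ?_)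
  obtain ⟨i, hi⟩ := exists_eq_ciSup_of_finite (f := fun i => f i ω)
  rw [← hi]
  exact Finset.single_le_sum (f := fun i => |f i ω|) (fun _ _ => abs_nonneg _) (Finset.mem_univ i)

lemma integrable_indicator_mul {T : Set Ω} (hT : MeasurableSet T) {f h : Ω → ℝ}
    (hf : Integrable f P) (hh : AEStronglyMeasurable h P) {C : ℝ} (hC : ∀ ω ∈ T, |h ω| ≤ C) :
    Integrable (T.indicator fun ω => f ω * h ω) P := by
  have : (T.indicator fun ω => f ω * h ω) = fun ω => f ω * T.indicator h ω := by
    ext ω; by_cases hω : ω ∈ T <;> simp [hω]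
  rw [this]
  refine hf.mul_bdd (c := |C|) (hh.indicator hT) (ae_of_all _ fun ω => ?_)
  by_cases hω : ω ∈ T
  · simpa [hω] using (hC ω hω).trans (le_abs_self C)
  · simp [hω]

end CondExp

section Exchange
variable {Ω E K : Type*} [MeasurableSpace Ω] [mE : MeasurableSpace E] {P : Measure Ω}
  {Y Y' : Ω → E} {p : ℕ} {W : E → Fin p → ℝ} {G : E × E → Fin p → ℝ}
  {R : Ω → Fin p → ℝ} {S : Matrix (Fin p) (Fin p) ℝ} {ε : ℝ}

lemma integrable_truncV [IsProbabilityMeasure P] (g d : Ω → Fin p → ℝ) (S : Matrix (Fin p) (Fin p) ℝ) (ε : ℝ) :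
    Integrable (truncV P Y g d S ε) P :=
  Integrable.of_eval fun _ => Integrable.of_eval fun _ =>
    ((integrable_condExpGiven (P := P) (Y := Y) _).const_mul (1 / 2)).sub (integrable_const _)

lemma integrable_truncΓ (g d : Ω → Fin p → ℝ) (ε : ℝ) : Integrable (truncΓ P Y g d ε) P :=
  integrable_iSup_of_finite fun _ => integrable_condExpGiven (P := P) (Y := Y) _

lemma truncΓ_nonneg (g d : Ω → Fin p → ℝ) (ε : ℝ) : ∀ᵐ ω ∂P, 0 ≤ truncΓ P Y g d ε ω := by
  have : ∀ᵐ ω ∂P, ∀ i : Fin p × Fin p × Fin p × Fin p, 0 ≤ condExpGiven P Y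
      ({ω' | ‖d ω'‖ ≤ (betaParam p ε)⁻¹}.indicator fun ω' =>
        |g ω' i.1 * d ω' i.2.1 * d ω' i.2.2.1 * d ω' i.2.2.2|) ω :=
    ae_all_iff.2 fun i => condExp_nonneg (ae_of_all _ fun ω =>
      Set.indicator_nonneg (fun _ _ => abs_nonneg _) ω)
  filter_upwards [this] with ω h using Real.iSup_nonneg h

/-- Truncating `G` to small increments turns the linear regression error `R` into `R^ε`. -/
lemma condExpGiven_truncated (hY : Measurable Y) (hY' : Measurable Y') (hW : Measurable W)
    (hGint : Integrable (fun ω => G (Y ω, Y' ω)) P)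
    (hcond : ∀ j, condExpGiven P Y (fun ω => G (Y ω, Y' ω) j)
      =ᵐ[P] fun ω => -(W (Y ω) j + R ω j)) (ε : ℝ) (j : Fin p) :
    condExpGiven P Y ({ω | ‖W (Y' ω) - W (Y ω)‖ ≤ (betaParam p ε)⁻¹}.indicator
        fun ω => G (Y ω, Y' ω) j)
      =ᵐ[P] fun ω => -(W (Y ω) j + truncR P Y R (fun ω => G (Y ω, Y' ω))
        (fun ω => W (Y' ω) - W (Y ω)) ε ω j) := by
  set T : Set Ω := {ω | ‖W (Y' ω) - W (Y ω)‖ ≤ (betaParam p ε)⁻¹} with hT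
  have hTm : MeasurableSet T :=
    measurableSet_le ((hW.comp hY').sub (hW.comp hY)).norm measurable_const
  have hgj : Integrable (fun ω => G (Y ω, Y' ω) j) P := hGint.eval j
  have hadd : condExpGiven P Y (fun ω => G (Y ω, Y' ω) j) =ᵐ[P]
      condExpGiven P Y (T.indicator fun ω => G (Y ω, Y' ω) j)
        + condExpGiven P Y (Tᶜ.indicator fun ω => G (Y ω, Y' ω) j) := by
    conv_lhs => rw [← Set.indicator_self_add_compl T fun ω => G (Y ω, Y' ω) j]
    exact condExp_add (hgj.indicator hTm) (hgj.indicator hTm.compl) _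
  have hTc : Tᶜ = {ω | (betaParam p ε)⁻¹ < ‖W (Y' ω) - W (Y ω)‖} := by ext ω; simp [hT]
  filter_upwards [hadd, hcond j] with ω h1 h2
  rw [h2, Pi.add_apply, hTc] at h1
  simp only [truncR]
  linarith

lemma integrable_comp_of_truncR (hY : Measurable Y) (hY' : Measurable Y') (hW : Measurable W)
    (hGint : Integrable (fun ω => G (Y ω, Y' ω)) P)
    (hcond : ∀ j, condExpGiven P Y (fun ω => G (Y ω, Y' ω) j)
      =ᵐ[P] fun ω => -(W (Y ω) j + R ω j))
    (hRint : Integrable (truncR P Y R (fun ω => G (Y ω, Y' ω))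
      (fun ω => W (Y' ω) - W (Y ω)) ε) P) :
    Integrable (fun ω => W (Y ω)) P := by
  refine Integrable.of_eval fun j => ?_
  refine ((hRint.eval j).neg.sub (integrable_condExpGiven (P := P) (Y := Y)
    ({ω | ‖W (Y' ω) - W (Y ω)‖ ≤ (betaParam p ε)⁻¹}.indicator fun ω => G (Y ω, Y' ω) j))).congr ?_
  filter_upwards [condExpGiven_truncated hY hY' hW hGint hcond ε j] with ω h
  simp only [Pi.sub_apply, Pi.neg_apply, h]; ring

/-- Stein's method of exchangeable pairs: testing `W` against `f₁(W)` differs from testing `Σ` against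
`f₂(W)` only by the errors `R^ε`, `V^ε`, `Γ^ε`, whenever `f₂` is the derivative of `f₁` up to a
trapezoidal remainder of fourth order. The derivatives appear only through this remainder, so that
`f₁`, `f₂` may be arbitrary bounded functions. -/
theorem abs_integral_stein_le [IsProbabilityMeasure P] [Fintype K] (hYY : IsExchangeablePair P Y Y') (hW : Measurable W)
    (hG : Measurable G) (hanti : ∀ᵐ ω ∂P, G (Y ω, Y' ω) = -G (Y' ω, Y ω))
    (hGint : Integrable (fun ω => G (Y ω, Y' ω)) P)
    (hcond : ∀ j, condExpGiven P Y (fun ω => G (Y ω, Y' ω) j)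
      =ᵐ[P] fun ω => -(W (Y ω) j + R ω j))
    (hRint : Integrable (truncR P Y R (fun ω => G (Y ω, Y' ω)) (fun ω => W (Y' ω) - W (Y ω)) ε) P)
    {f₁ : Fin p → (Fin p → ℝ) → ℝ} {f₂ : Fin p → Fin p → (Fin p → ℝ) → ℝ}
    {q : K → (Fin p → ℝ) → ℝ} {idx : K → Fin p × Fin p × Fin p × Fin p} {B₁ B₂ B₄ : ℝ}
    (hf₁ : ∀ j, Measurable (f₁ j)) (hf₂ : ∀ j k, Measurable (f₂ j k)) (hq : ∀ κ, Measurable (q κ))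
    (hB₁ : ∀ w, ∑ j, |f₁ j w| ≤ B₁) (hB₂ : ∀ w, ∑ j, ∑ k, |f₂ j k w| ≤ B₂)
    (hq0 : ∀ κ w, 0 ≤ q κ w) (hB₄ : ∀ w, ∑ κ, q κ w ≤ B₄)
    (hrem : ∀ w g d : Fin p → ℝ, ‖d‖ ≤ (betaParam p ε)⁻¹ →
      |∑ j, g j * (f₁ j (w + d) - f₁ j w)
          - 1 / 2 * ∑ j, ∑ k, g j * d k * (f₂ j k w + f₂ j k (w + d))|
        ≤ ∑ κ, q κ w * |g (idx κ).1 * d (idx κ).2.1 * d (idx κ).2.2.1 * d (idx κ).2.2.2|) :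
    |∫ ω, ∑ j, W (Y ω) j * f₁ j (W (Y ω)) ∂P - ∑ j, ∑ k, S j k * ∫ ω, f₂ j k (W (Y ω)) ∂P|
      ≤ B₁ * ∫ ω, ‖truncR P Y R (fun ω => G (Y ω, Y' ω)) (fun ω => W (Y' ω) - W (Y ω)) ε ω‖ ∂P
        + B₂ * ∫ ω, ‖truncV P Y (fun ω => G (Y ω, Y' ω)) (fun ω => W (Y' ω) - W (Y ω)) S ε ω‖ ∂P
        + B₄ * ∫ ω, truncΓ P Y (fun ω => G (Y ω, Y' ω)) (fun ω => W (Y' ω) - W (Y ω)) ε ω ∂P := by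
  obtain ⟨hY, hY', -⟩ := id hYY
  set g : Ω → Fin p → ℝ := fun ω => G (Y ω, Y' ω) with hg
  set d : Ω → Fin p → ℝ := fun ω => W (Y' ω) - W (Y ω) with hd
  set r := (betaParam p ε)⁻¹ with hr
  set T : Set Ω := {ω | ‖d ω‖ ≤ r} with hT
  set Rε := truncR P Y R g d ε with hRε
  set V := truncV P Y g d S ε with hV
  set Γ := truncΓ P Y g d ε with hΓ
  have hdm : Measurable d := (hW.comp hY').sub (hW.comp hY)
  have hdmj : ∀ j, Measurable fun ω => d ω j := fun j => (measurable_pi_apply j).comp hdm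
  have hTm : MeasurableSet T := measurableSet_le hdm.norm measurable_const
  have hgj : ∀ j, Integrable (fun ω => g ω j) P := fun j => hGint.eval j
  have hdT : ∀ ω ∈ T, ∀ j, |d ω j| ≤ r := fun ω hω j => (norm_le_pi_norm (d ω) j).trans hω
  have hrT : ∀ ω ∈ T, 0 ≤ r := fun ω hω => (norm_nonneg _).trans hω
  set u : Fin p → Ω → ℝ := fun j => T.indicator fun ω => g ω j with hu
  set uu : Fin p → Fin p → Ω → ℝ := fun j k => T.indicator fun ω => g ω j * d ω k with huu
  set u4 : Fin p × Fin p × Fin p × Fin p → Ω → ℝ := fun i => T.indicator fun ω =>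
    |g ω i.1 * d ω i.2.1 * d ω i.2.2.1 * d ω i.2.2.2| with hu4
  have hui : ∀ j, Integrable (u j) P := fun j => (hgj j).indicator hTm
  have huui : ∀ j k, Integrable (uu j k) P := fun j k =>
    integrable_indicator_mul hTm (hgj j) (hdmj k).aestronglyMeasurable fun ω hω => hdT ω hω k
  have hu4i : ∀ i, Integrable (u4 i) P := fun i => by
    have := integrable_indicator_mul hTm (hgj i.1).abs (C := r * r * r)
      (h := fun ω => |d ω i.2.1 * d ω i.2.2.1 * d ω i.2.2.2|)
      ((((hdmj _).mul (hdmj _)).mul (hdmj _)).abs.aestronglyMeasurable) (fun ω hω => by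
        have := hrT ω hω
        rw [abs_abs, abs_mul, abs_mul]
        gcongr <;> exact hdT ω hω _)
    simpa only [hu4, ← abs_mul, ← mul_assoc] using this
  have hw : ∀ j w, |f₁ j w| ≤ B₁ := fun j w =>
    (Finset.single_le_sum (f := fun j => |f₁ j w|) (fun _ _ => abs_nonneg _)
      (Finset.mem_univ j)).trans (hB₁ w)
  have hw2 : ∀ j k w, |f₂ j k w| ≤ B₂ := fun j k w =>
    (Finset.single_le_sum (f := fun k => |f₂ j k w|) (fun _ _ => abs_nonneg _)
      (Finset.mem_univ k)).trans ((Finset.single_le_sum (f := fun j => ∑ k, |f₂ j k w|)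
      (fun _ _ => Finset.sum_nonneg fun _ _ => abs_nonneg _) (Finset.mem_univ j)).trans (hB₂ w))
  have hw4 : ∀ κ w, |q κ w| ≤ B₄ := fun κ w => by
    rw [abs_of_nonneg (hq0 κ w)]
    exact (Finset.single_le_sum (fun κ _ => hq0 κ w) (Finset.mem_univ κ)).trans (hB₄ w)
  -- integrability of the products that occur below
  have i1 : ∀ (X : Ω → E), Measurable X → ∀ j {ξ : Ω → ℝ}, Integrable ξ P →
      Integrable (fun ω => ξ ω * f₁ j (W (X ω))) P := fun X hX j ξ hξ =>
    hξ.mul_bdd (c := B₁) ((hf₁ j).comp (hW.comp hX)).aestronglyMeasurable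
      (ae_of_all _ fun ω => hw j _)
  have i2 : ∀ (X : Ω → E), Measurable X → ∀ j k {ξ : Ω → ℝ}, Integrable ξ P →
      Integrable (fun ω => ξ ω * f₂ j k (W (X ω))) P := fun X hX j k ξ hξ =>
    hξ.mul_bdd (c := B₂) ((hf₂ j k).comp (hW.comp hX)).aestronglyMeasurable
      (ae_of_all _ fun ω => hw2 j k _)
  have i4 : ∀ κ {ξ : Ω → ℝ}, Integrable ξ P → Integrable (fun ω => ξ ω * q κ (W (Y ω))) P :=
    fun κ ξ hξ => hξ.mul_bdd (c := B₄) ((hq κ).comp (hW.comp hY)).aestronglyMeasurable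
      (ae_of_all _ fun ω => hw4 κ _)
  set x₁ : Ω → ℝ := fun ω => ∑ j, u j ω * f₁ j (W (Y ω)) with hx₁
  set x₂ : Ω → ℝ := fun ω => ∑ j, u j ω * f₁ j (W (Y' ω)) with hx₂
  set y₁ : Ω → ℝ := fun ω => ∑ j, ∑ k, uu j k ω * f₂ j k (W (Y ω)) with hy₁
  set y₂ : Ω → ℝ := fun ω => ∑ j, ∑ k, uu j k ω * f₂ j k (W (Y' ω)) with hy₂
  have ix₁ : Integrable x₁ P := integrable_finsetSum _ fun j _ => i1 Y hY j (hui j)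
  have ix₂ : Integrable x₂ P := integrable_finsetSum _ fun j _ => i1 Y' hY' j (hui j)
  have iy₁ : Integrable y₁ P := integrable_finsetSum _ fun j _ => integrable_finsetSum _
    fun k _ => i2 Y hY j k (huui j k)
  have iy₂ : Integrable y₂ P := integrable_finsetSum _ fun j _ => integrable_finsetSum _
    fun k _ => i2 Y' hY' j k (huui j k)
  set T' : Set (E × E) := {z | ‖W z.2 - W z.1‖ ≤ r} with hT'
  have hW1 : Measurable fun z : E × E => W z.1 := hW.comp measurable_fst
  have hW2 : Measurable fun z : E × E => W z.2 := hW.comp measurable_snd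
  have hT'm : MeasurableSet T' := measurableSet_le (hW2.sub hW1).norm measurable_const
  have hGj : ∀ j, Measurable fun z => G z j := fun j => (measurable_pi_apply j).comp hG
  have hTT' : ∀ ω, (Y ω, Y' ω) ∈ T' ↔ ω ∈ T := fun ω => Iff.rfl
  have hTT'' : ∀ ω, (Y' ω, Y ω) ∈ T' ↔ ω ∈ T := fun ω => by
    simp only [hT', hT, hd, Set.mem_ofPred_eq, norm_sub_rev]
  -- the antisymmetric function `G (f₁(W) + f₁(W'))` has mean zero
  have e1 : ∫ ω, x₁ ω ∂P + ∫ ω, x₂ ω ∂P = 0 := by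
    rw [← integral_add ix₁ ix₂]
    have := integral_eq_zero_of_antisymm hYY (f := T'.indicator fun z =>
      ∑ j, G z j * f₁ j (W z.1) + ∑ j, G z j * f₁ j (W z.2))
      (((Finset.measurable_sum _ fun j _ => (hGj j).mul ((hf₁ j).comp hW1)).add
        (Finset.measurable_sum _ fun j _ => (hGj j).mul ((hf₁ j).comp hW2))).indicator hT'm) (by
        filter_upwards [hanti] with ω hω
        by_cases hωT : ω ∈ T
        · rw [Set.indicator_of_mem ((hTT'' ω).2 hωT), Set.indicator_of_mem ((hTT' ω).2 hωT)]
          simp only [hω, Pi.neg_apply, neg_mul, Finset.sum_neg_distrib]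
          ring
        · rw [Set.indicator_of_notMem (mt (hTT'' ω).1 hωT),
            Set.indicator_of_notMem (mt (hTT' ω).1 hωT), neg_zero])
    rw [← this]
    refine integral_congr_ae (ae_of_all _ fun ω => ?_)
    by_cases hωT : ω ∈ T
    · simp only [Set.indicator_of_mem ((hTT' ω).2 hωT), hx₁, hx₂, hu, Set.indicator_of_mem hωT, hg]
    · simp only [Set.indicator_of_notMem (mt (hTT' ω).1 hωT), hx₁, hx₂, hu,
        Set.indicator_of_notMem hωT]
      simp
  -- the symmetric function `G D` lets `f₂(W')` be replaced by `f₂(W)`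
  have e2 : ∫ ω, y₂ ω ∂P = ∫ ω, y₁ ω ∂P := by
    have := hYY.integral_eq (f := T'.indicator fun z =>
      ∑ j, ∑ k, G z j * (W z.2 - W z.1) k * f₂ j k (W z.2))
      ((Finset.measurable_sum _ fun j _ => Finset.measurable_sum _ fun k _ =>
        ((hGj j).mul ((measurable_pi_apply k).comp (hW2.sub hW1))).mul
          ((hf₂ j k).comp hW2)).indicator hT'm)
    refine Eq.trans (integral_congr_ae (ae_of_all _ fun ω => ?_)) (this.trans (integral_congr_ae ?_))
    · by_cases hωT : ω ∈ T
      · simp only [Set.indicator_of_mem ((hTT' ω).2 hωT), hy₂, huu, Set.indicator_of_mem hωT, hg, hd]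
      · simp only [Set.indicator_of_notMem (mt (hTT' ω).1 hωT), hy₂, huu,
          Set.indicator_of_notMem hωT]
        simp
    · filter_upwards [hanti] with ω hω
      by_cases hωT : ω ∈ T
      · simp only [Set.indicator_of_mem ((hTT'' ω).2 hωT), hy₁, huu, Set.indicator_of_mem hωT, hg,
          hd, hω, Pi.neg_apply, Pi.sub_apply]
        refine Finset.sum_congr rfl fun j _ => Finset.sum_congr rfl fun k _ => by ring
      · simp only [Set.indicator_of_notMem (mt (hTT'' ω).1 hωT), hy₁, huu,
          Set.indicator_of_notMem hωT]
        simp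
  have iz : Integrable (fun ω => ∑ κ, u4 (idx κ) ω * q κ (W (Y ω))) P :=
    integrable_finsetSum _ fun κ _ => i4 κ (hu4i _)
  have e3 : |∫ ω, x₂ ω ∂P - ∫ ω, x₁ ω ∂P - 1 / 2 * (∫ ω, y₁ ω ∂P + ∫ ω, y₂ ω ∂P)|
      ≤ ∫ ω, ∑ κ, u4 (idx κ) ω * q κ (W (Y ω)) ∂P := by
    have hz : ∫ ω, x₂ ω ∂P - ∫ ω, x₁ ω ∂P - 1 / 2 * (∫ ω, y₁ ω ∂P + ∫ ω, y₂ ω ∂P)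
        = ∫ ω, (x₂ ω - x₁ ω - 1 / 2 * (y₁ ω + y₂ ω)) ∂P := by
      have ia : Integrable (fun ω => x₂ ω - x₁ ω) P := ix₂.sub ix₁
      have ib : Integrable (fun ω => y₁ ω + y₂ ω) P := iy₁.add iy₂
      rw [integral_sub ia (ib.const_mul _), integral_const_mul, integral_sub ix₂ ix₁,
        integral_add iy₁ iy₂]
    rw [hz]
    refine (abs_integral_le_integral_abs).trans (integral_mono_of_nonneg
      (ae_of_all _ fun ω => abs_nonneg _) iz (ae_of_all _ fun ω => ?_))
    by_cases hωT : ω ∈ T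
    · have := hrem (W (Y ω)) (g ω) (d ω) hωT
      rw [show W (Y ω) + d ω = W (Y' ω) by simp [hd]] at this
      simp only [hx₁, hx₂, hy₁, hy₂, hu, huu, hu4, Set.indicator_of_mem hωT]
      refine (le_of_eq (congrArg _ ?_)).trans (this.trans_eq
        (Finset.sum_congr rfl fun κ _ => mul_comm _ _))
      simp only [mul_sub, mul_add, Finset.sum_sub_distrib, Finset.sum_add_distrib]
    · simp only [hx₁, hx₂, hy₁, hy₂, hu, huu, hu4, Set.indicator_of_notMem hωT]
      simp
  have c1 : ∀ j, condExpGiven P Y (u j) =ᵐ[P] fun ω => -(W (Y ω) j + Rε ω j) :=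
    condExpGiven_truncated hY hY' hW hGint hcond ε
  have hRj : ∀ j, Integrable (fun ω => Rε ω j) P := fun j => hRint.eval j
  have hWj : ∀ j, Integrable (fun ω => W (Y ω) j) P := fun j =>
    (integrable_comp_of_truncR hY hY' hW hGint hcond hRint).eval j
  have hVj : ∀ j k, Integrable (fun ω => V ω j k) P := fun j k =>
    ((integrable_condExpGiven (P := P) (Y := Y) (uu j k)).const_mul (1 / 2)).sub
      (integrable_const _)
  have hVint : Integrable V P := integrable_truncV _ _ _ _
  have iR : Integrable (fun ω => ∑ j, Rε ω j * f₁ j (W (Y ω))) P :=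
    integrable_finsetSum _ fun j _ => i1 Y hY j (hRj j)
  have iW : Integrable (fun ω => ∑ j, W (Y ω) j * f₁ j (W (Y ω))) P :=
    integrable_finsetSum _ fun j _ => i1 Y hY j (hWj j)
  have iV : Integrable (fun ω => ∑ j, ∑ k, V ω j k * f₂ j k (W (Y ω))) P :=
    integrable_finsetSum _ fun j _ => integrable_finsetSum _ fun k _ => i2 Y hY j k (hVj j k)
  have if₂ : ∀ j k, Integrable (fun ω => f₂ j k (W (Y ω))) P := fun j k =>
    Integrable.of_bound ((hf₂ j k).comp (hW.comp hY)).aestronglyMeasurable B₂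
      (ae_of_all _ fun ω => hw2 j k _)
  have e4 : ∫ ω, x₁ ω ∂P = -(∫ ω, ∑ j, W (Y ω) j * f₁ j (W (Y ω)) ∂P)
      - ∫ ω, ∑ j, Rε ω j * f₁ j (W (Y ω)) ∂P := by
    have iWn : Integrable (fun ω => -∑ j, W (Y ω) j * f₁ j (W (Y ω))) P := iW.neg
    rw [← integral_neg, ← integral_sub iWn iR, hx₁, integral_finsetSum _ fun j _ => i1 Y hY j (hui j)]
    have : ∀ j, ∫ ω, u j ω * f₁ j (W (Y ω)) ∂P
        = ∫ ω, -(W (Y ω) j + Rε ω j) * f₁ j (W (Y ω)) ∂P := fun j => by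
      refine (integral_condExpGiven_mul hY (hui j) ((hf₁ j).comp hW)
        (fun y => hw j _)).symm.trans ?_
      refine integral_congr_ae ?_
      filter_upwards [c1 j] with ω h
      rw [h]; rfl
    simp only [this]
    have i5 : ∀ j, Integrable (fun ω => -(W (Y ω) j + Rε ω j) * f₁ j (W (Y ω))) P := fun j =>
      i1 Y hY j ((hWj j).add (hRj j)).neg
    rw [← integral_finsetSum _ fun j _ => i5 j]
    refine integral_congr_ae (ae_of_all _ fun ω => ?_)
    simp only [← Finset.sum_neg_distrib, ← Finset.sum_sub_distrib]
    exact Finset.sum_congr rfl fun j _ => by ring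
  have e5 : ∫ ω, y₁ ω ∂P = 2 * (∫ ω, ∑ j, ∑ k, V ω j k * f₂ j k (W (Y ω)) ∂P)
      + 2 * ∑ j, ∑ k, S j k * ∫ ω, f₂ j k (W (Y ω)) ∂P := by
    have h1 : ∀ j k, ∫ ω, uu j k ω * f₂ j k (W (Y ω)) ∂P
        = 2 * ∫ ω, V ω j k * f₂ j k (W (Y ω)) ∂P + 2 * (S j k * ∫ ω, f₂ j k (W (Y ω)) ∂P) := by
      intro j k
      refine (integral_condExpGiven_mul hY (huui j k) ((hf₂ j k).comp hW)
        (fun y => hw2 j k _)).symm.trans ?_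
      rw [← integral_const_mul, ← integral_const_mul, ← integral_const_mul,
        ← integral_add ((i2 Y hY j k (hVj j k)).const_mul 2)
          (((if₂ j k).const_mul (S j k)).const_mul 2)]
      refine integral_congr_ae (ae_of_all _ fun ω => ?_)
      have : V ω j k = 1 / 2 * condExpGiven P Y (uu j k) ω - S j k := rfl
      simp only [this, Function.comp_apply]
      ring
    rw [hy₁, integral_finsetSum _ fun j _ => integrable_finsetSum _
      fun k _ => i2 Y hY j k (huui j k), integral_finsetSum _ fun j _ => integrable_finsetSum _
      fun k _ => i2 Y hY j k (hVj j k), Finset.mul_sum, Finset.mul_sum, ← Finset.sum_add_distrib]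
    refine Finset.sum_congr rfl fun j _ => ?_
    rw [integral_finsetSum _ fun k _ => i2 Y hY j k (huui j k),
      integral_finsetSum _ fun k _ => i2 Y hY j k (hVj j k), Finset.mul_sum, Finset.mul_sum,
      ← Finset.sum_add_distrib]
    exact Finset.sum_congr rfl fun k _ => h1 j k
  have b1 : |∫ ω, ∑ j, Rε ω j * f₁ j (W (Y ω)) ∂P| ≤ B₁ * ∫ ω, ‖Rε ω‖ ∂P := by
    rw [← integral_const_mul]
    refine abs_integral_le_integral_abs.trans (integral_mono_of_nonneg
      (ae_of_all _ fun ω => abs_nonneg _) (hRint.norm.const_mul _) (ae_of_all _ fun ω => ?_))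
    simp only
    calc |∑ j, Rε ω j * f₁ j (W (Y ω))| ≤ ∑ j, ‖Rε ω‖ * |f₁ j (W (Y ω))| := by
          refine (Finset.abs_sum_le_sum_abs _ _).trans (Finset.sum_le_sum fun j _ => ?_)
          rw [abs_mul]
          exact mul_le_mul_of_nonneg_right (norm_le_pi_norm (Rε ω) j) (abs_nonneg _)
      _ ≤ B₁ * ‖Rε ω‖ := by
          rw [← Finset.mul_sum, mul_comm]
          exact mul_le_mul_of_nonneg_right (hB₁ _) (norm_nonneg _)
  have b2 : |∫ ω, ∑ j, ∑ k, V ω j k * f₂ j k (W (Y ω)) ∂P| ≤ B₂ * ∫ ω, ‖V ω‖ ∂P := by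
    rw [← integral_const_mul]
    refine abs_integral_le_integral_abs.trans (integral_mono_of_nonneg
      (ae_of_all _ fun ω => abs_nonneg _) (hVint.norm.const_mul _) (ae_of_all _ fun ω => ?_))
    simp only
    calc |∑ j, ∑ k, V ω j k * f₂ j k (W (Y ω))| ≤ ∑ j, ∑ k, ‖V ω‖ * |f₂ j k (W (Y ω))| := by
          refine (Finset.abs_sum_le_sum_abs _ _).trans (Finset.sum_le_sum fun j _ =>
            (Finset.abs_sum_le_sum_abs _ _).trans (Finset.sum_le_sum fun k _ => ?_))
          rw [abs_mul]
          exact mul_le_mul_of_nonneg_right ((norm_le_pi_norm (V ω j) k).trans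
            (norm_le_pi_norm (V ω) j)) (abs_nonneg _)
      _ ≤ B₂ * ‖V ω‖ := by
          simp only [← Finset.mul_sum]
          rw [mul_comm]
          exact mul_le_mul_of_nonneg_right (hB₂ _) (norm_nonneg _)
  have hc0 : ∀ᵐ ω ∂P, ∀ i, 0 ≤ condExpGiven P Y (u4 i) ω := by
    refine ae_all_iff.2 fun i => condExp_nonneg (ae_of_all _ fun ω => ?_)
    exact Set.indicator_nonneg (fun _ _ => abs_nonneg _) ω
  have hΓint : Integrable Γ P := integrable_truncΓ _ _ _
  have b4 : ∫ ω, ∑ κ, u4 (idx κ) ω * q κ (W (Y ω)) ∂P ≤ B₄ * ∫ ω, Γ ω ∂P := by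
    rw [integral_finsetSum _ fun κ _ => i4 κ (hu4i _)]
    have : ∀ κ, ∫ ω, u4 (idx κ) ω * q κ (W (Y ω)) ∂P
        = ∫ ω, condExpGiven P Y (u4 (idx κ)) ω * q κ (W (Y ω)) ∂P := fun κ =>
      (integral_condExpGiven_mul hY (hu4i _) ((hq κ).comp hW) (fun y => hw4 κ _)).symm
    simp only [this]
    rw [← integral_finsetSum _ fun κ _ => i4 κ (integrable_condExpGiven _), ← integral_const_mul]
    refine integral_mono_ae (integrable_finsetSum _ fun κ _ => i4 κ (integrable_condExpGiven _))
      (hΓint.const_mul _) ?_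
    filter_upwards [hc0] with ω h0
    have hle : ∀ i, condExpGiven P Y (u4 i) ω ≤ Γ ω := fun i =>
      le_ciSup (f := fun i => condExpGiven P Y (u4 i) ω) (Set.finite_range _).bddAbove i
    have hΓ0 : 0 ≤ Γ ω := Real.iSup_nonneg h0
    calc ∑ κ, condExpGiven P Y (u4 (idx κ)) ω * q κ (W (Y ω)) ≤ ∑ κ, Γ ω * q κ (W (Y ω)) :=
          Finset.sum_le_sum fun κ _ => mul_le_mul_of_nonneg_right (hle _) (hq0 _ _)
      _ ≤ B₄ * Γ ω := by
          rw [← Finset.mul_sum, mul_comm]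
          exact mul_le_mul_of_nonneg_right (hB₄ _) hΓ0
  have hfin := e3.trans b4
  rw [e2, e5] at hfin
  rw [e4] at e1 hfin
  have hΓ0 : 0 ≤ B₄ * ∫ ω, Γ ω ∂P := (abs_nonneg _).trans hfin
  rw [abs_le] at *
  constructor <;> linarith [b1.1, b1.2, b2.1, b2.2, hfin.1, hfin.2]

end Exchange

/-! ### Gaussian smoothing -/

section Smoothing
variable {p : ℕ} {S : Matrix (Fin p) (Fin p) ℝ}

lemma integrable_id_gaussianLaw (S : Matrix (Fin p) (Fin p) ℝ) :
    Integrable (fun z : Fin p → ℝ => z) (gaussianLaw S) := by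
  have h := IsGaussian.integrable_id (μ := multivariateGaussian 0 S)
  have hm : Measurable (WithLp.ofLp : EuclideanSpace ℝ (Fin p) → Fin p → ℝ) := by fun_prop
  refine (integrable_map_measure measurable_id.aestronglyMeasurable hm.aemeasurable).2 ?_
  exact (PiLp.continuousLinearEquiv 2 ℝ fun _ : Fin p => ℝ).toContinuousLinearMap.integrable_comp h

/-- The convolution `w ↦ E φ(c w + s Z)` with `Z ∼ N(0, S)`. -/
def gaussianSmooth (S : Matrix (Fin p) (Fin p) ℝ) (c s : ℝ) (φ : (Fin p → ℝ) → ℝ)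
    (w : Fin p → ℝ) : ℝ :=
  ∫ z, φ (c • w + s • z) ∂gaussianLaw S

lemma measurable_gaussianSmooth (c s : ℝ) {φ : (Fin p → ℝ) → ℝ} (hφ : Measurable φ) :
    Measurable (gaussianSmooth S c s φ) := by
  have : Measurable fun x : (Fin p → ℝ) × (Fin p → ℝ) => φ (c • x.1 + s • x.2) :=
    hφ.comp (by fun_prop)
  exact (this.stronglyMeasurable.integral_prod_right (ν := gaussianLaw S)).measurable

lemma integrable_comp_affine {φ : (Fin p → ℝ) → ℝ} (hφ : Measurable φ) {M : ℝ}
    (hM : ∀ x, |φ x| ≤ M) (w : Fin p → ℝ) (s : ℝ) :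
    Integrable (fun z => φ (w + s • z)) (gaussianLaw S) :=
  Integrable.of_bound (hφ.comp (by fun_prop)).aestronglyMeasurable M (ae_of_all _ fun _ => hM _)

lemma abs_le_of_sum_abs_le_indicator {J : Type*} [Fintype J] {φ : J → (Fin p → ℝ) → ℝ}
    {B : Set (Fin p → ℝ)} {M : ℝ} (hM : 0 ≤ M)
    (hφ : ∀ x, ∑ i, |φ i x| ≤ B.indicator (fun _ => M) x) (i : J) (x : Fin p → ℝ) :
    |φ i x| ≤ M :=
  (Finset.single_le_sum (f := fun i => |φ i x|) (fun _ _ => abs_nonneg _)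
    (Finset.mem_univ i)).trans ((hφ x).trans (Set.indicator_le_self' (fun _ _ => hM) x))

/-- Smoothing gains the Gaussian measure of the set on which the functions live. -/
lemma sum_abs_gaussianSmooth_le {J : Type*} [Fintype J] {φ : J → (Fin p → ℝ) → ℝ}
    (hφm : ∀ i, Measurable (φ i)) {B : Set (Fin p → ℝ)} (hB : MeasurableSet B) {M K s : ℝ}
    (hM : 0 ≤ M) (hφ : ∀ x, ∑ i, |φ i x| ≤ B.indicator (fun _ => M) x)
    (hK : ∀ w, (gaussianLaw S).real {z | w + s • z ∈ B} ≤ K) (c : ℝ) (w : Fin p → ℝ) :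
    ∑ i, |gaussianSmooth S c s (φ i) w| ≤ M * K := by
  have hi : ∀ i, Integrable (fun z => φ i (c • w + s • z)) (gaussianLaw S) := fun i =>
    integrable_comp_affine (hφm i) (abs_le_of_sum_abs_le_indicator hM hφ i) _ _
  have hT : MeasurableSet {z : Fin p → ℝ | c • w + s • z ∈ B} :=
    (by fun_prop : Measurable fun z : Fin p → ℝ => c • w + s • z) hB
  calc ∑ i, |gaussianSmooth S c s (φ i) w|
      ≤ ∑ i, ∫ z, |φ i (c • w + s • z)| ∂gaussianLaw S :=
        Finset.sum_le_sum fun i _ => abs_integral_le_integral_abs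
    _ = ∫ z, ∑ i, |φ i (c • w + s • z)| ∂gaussianLaw S :=
        (integral_finsetSum _ fun i _ => (hi i).abs).symm
    _ ≤ ∫ z, {z : Fin p → ℝ | c • w + s • z ∈ B}.indicator (fun _ => M) z ∂gaussianLaw S := by
        refine integral_mono (integrable_finsetSum _ fun i _ => (hi i).abs)
          ((integrable_const M).indicator hT) fun z => ?_
        exact hφ (c • w + s • z)
    _ = M * (gaussianLaw S).real {z | c • w + s • z ∈ B} := by
        rw [integral_indicator_const _ hT, smul_eq_mul, mul_comm]
    _ ≤ M * K := mul_le_mul_of_nonneg_left (hK _) hM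

end Smoothing

namespace ExpFamily
variable {ι : Type*} {p : ℕ} [Fintype ι] (F : ExpFamily ι p) {C L : ℝ} {H : ℕ → ℝ → ℝ}
  {S : Matrix (Fin p) (Fin p) ℝ}

/-- The trapezoidal estimate survives Gaussian smoothing. -/
lemma abs_gaussianSmooth_grad_sub_trapezoid_le [Nonempty ι] (hH : IsLogCutoff C L H)
    (hC : 0 ≤ C / L) {c : ℝ} (hc : |c| ≤ 1) (s : ℝ) (w g d : Fin p → ℝ)
    (hd : ∀ j, F.rate * |d j| ≤ 1) :
    |∑ j, g j * (gaussianSmooth S c s (F.grad H j) (w + d) - gaussianSmooth S c s (F.grad H j) w)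
        - 1 / 2 * ∑ j, ∑ k, g j * d k * (c * gaussianSmooth S c s (F.hess H j k) w
          + c * gaussianSmooth S c s (F.hess H j k) (w + d))|
      ≤ ∑ κ, gaussianSmooth S c s (fun x => F.slotWeight C L x κ) w
        * |g (F.slotCoord κ).1 * d (F.slotCoord κ).2.1
        * d (F.slotCoord κ).2.2.1 * d (F.slotCoord κ).2.2.2| := by
  have hr := F.rate_pos
  have ig : ∀ j w, Integrable (fun z => F.grad H j (c • w + s • z)) (gaussianLaw S) := fun j w =>
    integrable_comp_affine (F.measurable_grad hH j)
      (abs_le_of_sum_abs_le_indicator (by positivity) (F.sum_abs_grad_le hH hC) j) _ _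
  have ih : ∀ j k w, Integrable (fun z => F.hess H j k (c • w + s • z)) (gaussianLaw S) :=
    fun j k w => by
      refine integrable_comp_affine (F.measurable_hess hH j k) (M := 2 * (C / L) * F.rate ^ 2)
        (fun x => ?_) _ _
      refine abs_le_of_sum_abs_le_indicator (J := Fin p × Fin p) (B := F.band L)
        (φ := fun i => F.hess H i.1 i.2) (by positivity) (fun x => ?_) (j, k) x
      rw [Fintype.sum_prod_type]
      exact F.sum_abs_hess_le hH hC x
  have iq : ∀ κ, Integrable (fun z => F.slotWeight C L (c • w + s • z) κ) (gaussianLaw S) :=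
    fun κ => by
      refine integrable_comp_affine (F.measurable_slotWeight C L κ)
        (abs_le_of_sum_abs_le_indicator (B := F.band L)
        (φ := fun κ x => F.slotWeight C L x κ) (M := 21 * Real.exp 8 * (C / L) * F.rate ^ 4)
        (by positivity) (fun x => ?_) κ) _ _
      simp only [abs_of_nonneg (F.slotWeight_nonneg hC x _)]
      exact (F.sum_slotWeight x).le
  have hA : ∑ j, g j * (gaussianSmooth S c s (F.grad H j) (w + d)
        - gaussianSmooth S c s (F.grad H j) w)
        - 1 / 2 * ∑ j, ∑ k, g j * d k * (c * gaussianSmooth S c s (F.hess H j k) w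
          + c * gaussianSmooth S c s (F.hess H j k) (w + d))
      = ∫ z, (∑ j, g j * (F.grad H j (c • (w + d) + s • z) - F.grad H j (c • w + s • z))
        - 1 / 2 * ∑ j, ∑ k, g j * d k * (c * F.hess H j k (c • w + s • z)
          + c * F.hess H j k (c • (w + d) + s • z))) ∂gaussianLaw S := by
    have i1 : ∀ j, Integrable (fun z => g j * (F.grad H j (c • (w + d) + s • z)
        - F.grad H j (c • w + s • z))) (gaussianLaw S) := fun j =>
      ((ig j _).sub (ig j _)).const_mul _
    have i2 : ∀ j k, Integrable (fun z => g j * d k * (c * F.hess H j k (c • w + s • z)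
        + c * F.hess H j k (c • (w + d) + s • z))) (gaussianLaw S) := fun j k =>
      (((ih j k _).const_mul _).add ((ih j k _).const_mul _)).const_mul _
    rw [integral_sub (integrable_finsetSum _ fun j _ => i1 j)
      ((integrable_finsetSum _ fun j _ => integrable_finsetSum _ fun k _ => i2 j k).const_mul _),
      integral_const_mul, integral_finsetSum _ fun j _ => i1 j,
      integral_finsetSum _ fun j _ => integrable_finsetSum _ fun k _ => i2 j k]
    congr 1
    · refine Finset.sum_congr rfl fun j _ => ?_
      rw [integral_const_mul, integral_sub (ig j _) (ig j _)]; rfl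
    · congr 1
      refine Finset.sum_congr rfl fun j _ => ?_
      rw [integral_finsetSum _ fun k _ => i2 j k]
      refine Finset.sum_congr rfl fun k _ => ?_
      rw [integral_const_mul, integral_add ((ih j k _).const_mul _) ((ih j k _).const_mul _),
        integral_const_mul, integral_const_mul]; rfl
  have hB : ∑ κ, gaussianSmooth S c s (fun x => F.slotWeight C L x κ) w
        * |g (F.slotCoord κ).1 * d (F.slotCoord κ).2.1
        * d (F.slotCoord κ).2.2.1 * d (F.slotCoord κ).2.2.2|
      = ∫ z, ∑ κ, F.slotWeight C L (c • w + s • z) κ * |g (F.slotCoord κ).1 * d (F.slotCoord κ).2.1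
        * d (F.slotCoord κ).2.2.1 * d (F.slotCoord κ).2.2.2| ∂gaussianLaw S := by
    rw [integral_finsetSum _ fun κ _ => (iq κ).mul_const _]
    refine Finset.sum_congr rfl fun κ _ => ?_
    rw [integral_mul_const]; rfl
  rw [hA, hB]
  refine abs_integral_le_integral_abs.trans (integral_mono_of_nonneg
    (ae_of_all _ fun _ => abs_nonneg _) (integrable_finsetSum _ fun κ _ => (iq κ).mul_const _)
    (ae_of_all _ fun z => ?_))
  have hcd : ∀ j, |(c • d) j| ≤ |d j| := fun j => by
    rw [Pi.smul_apply, smul_eq_mul, abs_mul]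
    exact mul_le_of_le_one_left (abs_nonneg _) hc
  have key := F.abs_grad_sub_trapezoid_le hH hC (c • w + s • z) g (c • d)
    (fun j => (mul_le_mul_of_nonneg_left (hcd j) hr.le).trans (hd j))
  rw [show c • w + s • z + c • d = c • (w + d) + s • z by rw [smul_add]; abel] at key
  refine (le_of_eq (congrArg _ ?_)).trans (key.trans (Finset.sum_le_sum fun κ _ => ?_))
  · congr 1
    congr 1
    refine Finset.sum_congr rfl fun j _ => Finset.sum_congr rfl fun k _ => ?_
    rw [Pi.smul_apply, smul_eq_mul]; ring
  · refine mul_le_mul_of_nonneg_left ?_ (F.slotWeight_nonneg hC _ _)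
    simp only [abs_mul]
    exact mul_le_mul (mul_le_mul (mul_le_mul_of_nonneg_left (hcd _) (abs_nonneg _)) (hcd _)
      (abs_nonneg _) (by positivity)) (hcd _) (abs_nonneg _) (by positivity)

/-- Chain rule for the smoothed indicator along an arbitrary curve. -/
lemma hasDerivAt_smoothed_comp [Nonempty ι] (hH : IsLogCutoff C L H) {x : ℝ → Fin p → ℝ}
    {x' : Fin p → ℝ} {t : ℝ} (hx : ∀ j, HasDerivAt (fun t => x t j) (x' j) t) :
    HasDerivAt (fun t => H 0 (F.total (x t))) (∑ j, F.grad H j (x t) * x' j) t := by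
  have h1 : HasDerivAt (fun t => F.total (x t)) (F.wsum (F.lin x') (x t)) t := by
    refine HasDerivAt.fun_sum fun i _ => ?_
    refine ((((hx (F.coord i)).const_mul (F.sign i)).const_mul F.rate |>.sub_const
      (F.offset i)).exp).congr_deriv ?_
    simp only [term, lin]; ring
  refine (HasDerivAt.comp t (hH.hasDerivAt 0 (by norm_num) _ (F.total_pos _)) h1).congr_deriv ?_
  rw [wsum_lin, Finset.mul_sum]
  exact Finset.sum_congr rfl fun j _ => by rw [grad]; ring

end ExpFamily

/-! ### Slepian's interpolation -/

namespace ExpFamily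
variable {ι : Type*} {p : ℕ} [Fintype ι] [Nonempty ι] (F : ExpFamily ι p) {C L : ℝ}
  {H : ℕ → ℝ → ℝ} {S : Matrix (Fin p) (Fin p) ℝ}

lemma abs_grad_le (hH : IsLogCutoff C L H) (hC : 0 ≤ C / L) (j : Fin p) (x : Fin p → ℝ) :
    |F.grad H j x| ≤ C / L * F.rate :=
  abs_le_of_sum_abs_le_indicator (mul_nonneg hC F.rate_pos.le) (F.sum_abs_grad_le hH hC) j x

lemma abs_hess_le (hH : IsLogCutoff C L H) (hC : 0 ≤ C / L) (j k : Fin p) (x : Fin p → ℝ) :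
    |F.hess H j k x| ≤ 2 * (C / L) * F.rate ^ 2 := by
  refine abs_le_of_sum_abs_le_indicator (J := Fin p × Fin p) (B := F.band L)
    (φ := fun i => F.hess H i.1 i.2) (by positivity) (fun x => ?_) (j, k) x
  rw [Fintype.sum_prod_type]
  exact F.sum_abs_hess_le hH hC x

/-- Gaussian integration by parts along the interpolation path. -/
lemma integral_sum_grad_mul_coord (hH : IsLogCutoff C L H) (hC : 0 ≤ C / L) (hS : S.PosSemidef)
    (hpos : ∀ j, 0 < S j j) (c s : ℝ) (w : Fin p → ℝ) :
    ∑ j, ∫ z, z j * F.grad H j (c • w + s • z) ∂gaussianLaw S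
      = s * ∑ j, ∑ k, S j k * gaussianSmooth S c s (F.hess H j k) w := by
  have hr := F.rate_pos
  rw [Finset.mul_sum]
  refine Finset.sum_congr rfl fun j _ => ?_
  have hm : Measurable fun z : Fin p → ℝ => c • w + s • z := by fun_prop
  rw [integral_coord_mul_gaussianLaw hS (hpos j) (F := fun z => F.grad H j (c • w + s • z))
    (F' := fun k z => s * F.hess H j k (c • w + s • z))
    (C := C / L * F.rate + |s| * (2 * (C / L) * F.rate ^ 2)) ?_
    ((F.measurable_grad hH j).comp hm)
    (fun k => ((F.measurable_hess hH j k).comp hm).const_mul s) ?_ ?_]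
  · rw [Finset.mul_sum]
    refine Finset.sum_congr rfl fun k _ => ?_
    rw [integral_const_mul, gaussianSmooth]; ring
  · intro x d t
    have h := F.hasDerivAt_grad hH j (c • w + s • x) (s • d) t
    have e : ∀ t : ℝ, c • w + s • x + t • s • d = c • w + s • (x + t • d) := fun t => by
      rw [smul_add, smul_comm t s]; abel
    simp only [e] at h
    refine h.congr_deriv (Finset.sum_congr rfl fun k _ => ?_)
    rw [Pi.smul_apply, smul_eq_mul]; ring
  · intro x
    exact (F.abs_grad_le hH hC j _).trans (le_add_of_nonneg_right (by positivity))
  · intro k x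
    rw [abs_mul]
    exact (mul_le_mul_of_nonneg_left (F.abs_hess_le hH hC j k _) (abs_nonneg _)).trans
      (le_add_of_nonneg_left (by positivity))

variable {Ω : Type*} [MeasurableSpace Ω] {P : Measure Ω} [IsProbabilityMeasure P]

/-- The derivative of Slepian's interpolation `θ ↦ E h(cos θ X + sin θ Z)`. -/
lemma hasDerivAt_interpolation (hH : IsLogCutoff C L H) (hC : 0 ≤ C / L) (hS : S.PosSemidef)
    (hpos : ∀ j, 0 < S j j) {X : Ω → Fin p → ℝ} (hX : Measurable X) (hXi : Integrable X P)
    (θ : ℝ) :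
    HasDerivAt (fun θ => ∫ ω, gaussianSmooth S (Real.cos θ) (Real.sin θ)
        (fun x => H 0 (F.total x)) (X ω) ∂P)
      (-Real.sin θ * (∫ ω, ∑ j, X ω j
          * gaussianSmooth S (Real.cos θ) (Real.sin θ) (F.grad H j) (X ω) ∂P
        - ∑ j, ∑ k, S j k * ∫ ω, Real.cos θ
          * gaussianSmooth S (Real.cos θ) (Real.sin θ) (F.hess H j k) (X ω) ∂P)) θ := by
  have hr := F.rate_pos
  set γ := gaussianLaw S with hγ
  have hpath : ∀ θ, Measurable fun y : Ω × (Fin p → ℝ) =>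
      Real.cos θ • X y.1 + Real.sin θ • y.2 := fun θ => by fun_prop
  have h0m : Measurable fun x => H 0 (F.total x) := (hH.measurable 0).comp F.measurable_total
  have h0i : ∀ θ, Integrable (fun y : Ω × (Fin p → ℝ) =>
      H 0 (F.total (Real.cos θ • X y.1 + Real.sin θ • y.2))) (P.prod γ) := fun θ =>
    Integrable.of_bound (h0m.comp (hpath θ)).aestronglyMeasurable 1 (ae_of_all _ fun y => by
      have := hH.mem_Icc (F.total (Real.cos θ • X y.1 + Real.sin θ • y.2))
      rw [Real.norm_eq_abs, abs_le]; exact ⟨by linarith [this.1], this.2⟩)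
  have hΨ : (fun θ => ∫ ω, gaussianSmooth S (Real.cos θ) (Real.sin θ)
        (fun x => H 0 (F.total x)) (X ω) ∂P)
      = fun θ => ∫ y, H 0 (F.total (Real.cos θ • X y.1 + Real.sin θ • y.2)) ∂(P.prod γ) :=
    funext fun θ => (integral_prod _ (h0i θ)).symm
  have hzi := integrable_id_gaussianLaw S
  have hXj : ∀ j, Integrable (fun y : Ω × (Fin p → ℝ) => X y.1 j) (P.prod γ) := fun j =>
    (hXi.eval j).comp_fst γ
  have hzj : ∀ j, Integrable (fun y : Ω × (Fin p → ℝ) => y.2 j) (P.prod γ) := fun j =>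
    (hzi.eval j).comp_snd P
  set F' : ℝ → Ω × (Fin p → ℝ) → ℝ := fun θ y =>
    ∑ j, F.grad H j (Real.cos θ • X y.1 + Real.sin θ • y.2)
      * (-Real.sin θ * X y.1 j + Real.cos θ * y.2 j) with hF'
  have hgm : ∀ j θ, Measurable fun y : Ω × (Fin p → ℝ) =>
      F.grad H j (Real.cos θ • X y.1 + Real.sin θ • y.2) := fun j θ =>
    (F.measurable_grad hH j).comp (hpath θ)
  have hXjm : ∀ j, Measurable fun y : Ω × (Fin p → ℝ) => X y.1 j := fun j => by fun_prop
  obtain ⟨-, hd⟩ := hasDerivAt_integral_of_dominated_loc_of_deriv_le (μ := P.prod γ)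
    (F := fun θ y => H 0 (F.total (Real.cos θ • X y.1 + Real.sin θ • y.2))) (F' := F')
    (bound := fun y => ∑ j, C / L * F.rate * (|X y.1 j| + |y.2 j|)) (x₀ := θ) (s := Set.univ)
    Filter.univ_mem
    (Filter.Eventually.of_forall fun θ => (h0i θ).aestronglyMeasurable) (h0i θ)
    (Measurable.aestronglyMeasurable (Finset.measurable_sum _ fun j _ => (hgm j θ).mul
      (((hXjm j).const_mul _).add (by fun_prop))))
    (ae_of_all _ fun y θ _ => by
      rw [Real.norm_eq_abs]
      refine (Finset.abs_sum_le_sum_abs _ _).trans (Finset.sum_le_sum fun j _ => ?_)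
      rw [abs_mul]
      refine mul_le_mul (F.abs_grad_le hH hC j _) ((abs_add_le _ _).trans (add_le_add ?_ ?_))
        (abs_nonneg _) (by positivity)
      · rw [abs_mul, abs_neg]
        exact mul_le_of_le_one_left (abs_nonneg _) (Real.abs_sin_le_one θ)
      · rw [abs_mul]
        exact mul_le_of_le_one_left (abs_nonneg _) (Real.abs_cos_le_one θ))
    (integrable_finsetSum _ fun j _ => ((hXj j).abs.add (hzj j).abs).const_mul _)
    (ae_of_all _ fun y θ _ => by
      refine F.hasDerivAt_smoothed_comp hH (x := fun θ => Real.cos θ • X y.1 + Real.sin θ • y.2)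
        fun j => ?_
      exact ((Real.hasDerivAt_cos θ).mul_const _).add ((Real.hasDerivAt_sin θ).mul_const _))
  rw [hΨ]
  refine hd.congr_deriv ?_
  set c := Real.cos θ
  set s := Real.sin θ
  have i1 : ∀ j, Integrable (fun y : Ω × (Fin p → ℝ) =>
      X y.1 j * F.grad H j (c • X y.1 + s • y.2)) (P.prod γ) := fun j =>
    (hXj j).mul_bdd (c := C / L * F.rate) (hgm j θ).aestronglyMeasurable
      (ae_of_all _ fun y => F.abs_grad_le hH hC j _)
  have i2 : ∀ j, Integrable (fun y : Ω × (Fin p → ℝ) =>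
      y.2 j * F.grad H j (c • X y.1 + s • y.2)) (P.prod γ) := fun j =>
    (hzj j).mul_bdd (c := C / L * F.rate) (hgm j θ).aestronglyMeasurable
      (ae_of_all _ fun y => F.abs_grad_le hH hC j _)
  have ih : ∀ j k, Integrable (fun ω => gaussianSmooth S c s (F.hess H j k) (X ω)) P := fun j k => by
    refine Integrable.of_bound ((measurable_gaussianSmooth c s
      (F.measurable_hess hH j k)).comp hX).aestronglyMeasurable (2 * (C / L) * F.rate ^ 2)
      (ae_of_all _ fun ω => ?_)
    refine (norm_integral_le_of_norm_le_const (ae_of_all _ fun z =>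
      F.abs_hess_le hH hC j k _)).trans_eq ?_
    simp
  have i1' : ∀ j, Integrable (fun ω => X ω j * gaussianSmooth S c s (F.grad H j) (X ω)) P :=
    fun j => by
      have := (i1 j).integral_prod_left
      simp only [integral_const_mul] at this
      exact this
  have e1 : ∀ j, ∫ y, X y.1 j * F.grad H j (c • X y.1 + s • y.2) ∂(P.prod γ)
      = ∫ ω, X ω j * gaussianSmooth S c s (F.grad H j) (X ω) ∂P := fun j => by
    rw [integral_prod _ (i1 j)]
    simp only [integral_const_mul]; rfl
  have e2 : ∑ j, ∫ y, y.2 j * F.grad H j (c • X y.1 + s • y.2) ∂(P.prod γ)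
      = s * ∑ j, ∑ k, S j k * ∫ ω, gaussianSmooth S c s (F.hess H j k) (X ω) ∂P := by
    have : ∀ j, ∫ y, y.2 j * F.grad H j (c • X y.1 + s • y.2) ∂(P.prod γ)
        = ∫ ω, ∫ z, z j * F.grad H j (c • X ω + s • z) ∂γ ∂P := fun j => integral_prod _ (i2 j)
    simp only [this]
    rw [← integral_finsetSum _ fun j _ => (i2 j).integral_prod_left]
    simp only [hγ, F.integral_sum_grad_mul_coord hH hC hS hpos]
    refine (integral_const_mul _ _).trans (congrArg (s * ·) ?_)
    refine (integral_finsetSum _ fun j _ =>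
      integrable_finsetSum _ fun k _ => (ih j k).const_mul _).trans
      (Finset.sum_congr rfl fun j _ => ?_)
    refine (integral_finsetSum _ fun k _ => (ih j k).const_mul _).trans
      (Finset.sum_congr rfl fun k _ => integral_const_mul _ _)
  have e3 : ∫ y, F' θ y ∂(P.prod γ)
      = ∫ y, (-s * ∑ j, X y.1 j * F.grad H j (c • X y.1 + s • y.2)
        + c * ∑ j, y.2 j * F.grad H j (c • X y.1 + s • y.2)) ∂(P.prod γ) := by
    congr 1
    ext y
    simp only [hF', Finset.mul_sum, ← Finset.sum_add_distrib]
    exact Finset.sum_congr rfl fun j _ => by ring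
  rw [e3, integral_add ((integrable_finsetSum _ fun j _ => i1 j).const_mul _)
    ((integrable_finsetSum _ fun j _ => i2 j).const_mul _), integral_const_mul, integral_const_mul,
    integral_finsetSum _ fun j _ => i1 j, integral_finsetSum _ fun j _ => i2 j, e2,
    integral_finsetSum _ fun j _ => i1' j]
  simp only [e1, integral_const_mul]
  have e4 : ∑ j, ∑ k, S j k * (c * ∫ ω, gaussianSmooth S c s (F.hess H j k) (X ω) ∂P)
      = c * ∑ j, ∑ k, S j k * ∫ ω, gaussianSmooth S c s (F.hess H j k) (X ω) ∂P := by
    simp only [Finset.mul_sum]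
    exact Finset.sum_congr rfl fun j _ => Finset.sum_congr rfl fun k _ => by ring
  rw [e4]; ring

variable {E : Type*} [MeasurableSpace E] {Y Y' : Ω → E} {W : E → Fin p → ℝ}
  {G : E × E → Fin p → ℝ} {R : Ω → Fin p → ℝ} {ε : ℝ}

/-- The Gaussian approximation of smoothed indicators: every derivative of the smoothed indicator
costs a factor `β`, and the anti-concentration constant `K` of the transition region enters once,
whatever the order of the derivative. -/
theorem abs_smoothed_sub_le (hH : IsLogCutoff C L H) (hC : 0 ≤ C / L) (hS : S.PosSemidef)
    (hpos : ∀ j, 0 < S j j) (hYY : IsExchangeablePair P Y Y') (hW : Measurable W)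
    (hG : Measurable G) (hanti : ∀ᵐ ω ∂P, G (Y ω, Y' ω) = -G (Y' ω, Y ω))
    (hGint : Integrable (fun ω => G (Y ω, Y' ω)) P)
    (hcond : ∀ j, condExpGiven P Y (fun ω => G (Y ω, Y' ω) j)
      =ᵐ[P] fun ω => -(W (Y ω) j + R ω j))
    (hRint : Integrable (truncR P Y R (fun ω => G (Y ω, Y' ω)) (fun ω => W (Y' ω) - W (Y ω)) ε) P)
    (hrate : F.rate = betaParam p ε) {K : ℝ} (hK0 : 0 ≤ K)
    (hK : ∀ t, 0 < t → ∀ w, (gaussianLaw S).real {z | w + t • z ∈ F.band L} ≤ K / t) :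
    |∫ z, H 0 (F.total z) ∂gaussianLaw S - ∫ ω, H 0 (F.total (W (Y ω))) ∂P|
      ≤ C / L * K * (F.rate * ∫ ω, ‖truncR P Y R (fun ω => G (Y ω, Y' ω))
            (fun ω => W (Y' ω) - W (Y ω)) ε ω‖ ∂P
        + 2 * F.rate ^ 2 * ∫ ω, ‖truncV P Y (fun ω => G (Y ω, Y' ω))
            (fun ω => W (Y' ω) - W (Y ω)) S ε ω‖ ∂P
        + 21 * Real.exp 8 * F.rate ^ 4 * ∫ ω, truncΓ P Y (fun ω => G (Y ω, Y' ω))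
            (fun ω => W (Y' ω) - W (Y ω)) ε ω ∂P) * (Real.pi / 2) := by
  obtain ⟨hY, hY', -⟩ := id hYY
  have hr := F.rate_pos
  set ER := ∫ ω, ‖truncR P Y R (fun ω => G (Y ω, Y' ω)) (fun ω => W (Y' ω) - W (Y ω)) ε ω‖ ∂P
    with hER
  set EV := ∫ ω, ‖truncV P Y (fun ω => G (Y ω, Y' ω)) (fun ω => W (Y' ω) - W (Y ω)) S ε ω‖ ∂P
    with hEV
  set EΓ := ∫ ω, truncΓ P Y (fun ω => G (Y ω, Y' ω)) (fun ω => W (Y' ω) - W (Y ω)) ε ω ∂P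
    with hEΓ
  have hER0 : 0 ≤ ER := integral_nonneg fun _ => norm_nonneg _
  have hEV0 : 0 ≤ EV := integral_nonneg fun _ => norm_nonneg _
  have hEΓ0 : 0 ≤ EΓ := integral_nonneg_of_ae (truncΓ_nonneg _ _ _)
  have hXi : Integrable (fun ω => W (Y ω)) P :=
    integrable_comp_of_truncR hY hY' hW hGint hcond hRint
  have hderiv := F.hasDerivAt_interpolation hH hC hS hpos (hW.comp hY) hXi
  set B := C / L * K * (F.rate * ER + 2 * F.rate ^ 2 * EV
    + 21 * Real.exp 8 * F.rate ^ 4 * EΓ) with hB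
  have hB0 : 0 ≤ B := by positivity
  have hmv := norm_image_sub_le_of_norm_deriv_le_segment' (a := 0) (b := Real.pi / 2) (C := B)
    (fun θ _ => (hderiv θ).hasDerivWithinAt) (fun θ hθ => ?_) (Real.pi / 2)
    ⟨by positivity, le_rfl⟩
  · simpa [gaussianSmooth, Real.norm_eq_abs] using hmv
  · set c := Real.cos θ
    set s := Real.sin θ with hs
    have hs0 : 0 ≤ s := Real.sin_nonneg_of_nonneg_of_le_pi hθ.1 (by linarith [hθ.2, Real.pi_pos])
    have hc1 : |c| ≤ 1 := Real.abs_cos_le_one θ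
    -- at `θ = 0` the bound `K / s` is void, but the derivative vanishes
    rcases hs0.eq_or_lt with h0 | h0
    · rw [← h0]; simpa using hB0
    have hKs : 0 ≤ K / s := by positivity
    have hb := F.measurableSet_band (L := L)
    have key := abs_integral_stein_le (S := S) (ε := ε) hYY hW hG hanti hGint hcond hRint
      (f₁ := fun j => gaussianSmooth S c s (F.grad H j))
      (f₂ := fun j k w => c * gaussianSmooth S c s (F.hess H j k) w)
      (q := fun κ => gaussianSmooth S c s (fun x => F.slotWeight C L x κ)) (idx := F.slotCoord)
      (B₁ := C / L * F.rate * (K / s)) (B₂ := 2 * (C / L) * F.rate ^ 2 * (K / s))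
      (B₄ := 21 * Real.exp 8 * (C / L) * F.rate ^ 4 * (K / s))
      (fun j => measurable_gaussianSmooth c s (F.measurable_grad hH j))
      (fun j k => (measurable_gaussianSmooth c s (F.measurable_hess hH j k)).const_mul c)
      (fun κ => measurable_gaussianSmooth c s (F.measurable_slotWeight C L κ))
      (fun w => sum_abs_gaussianSmooth_le (fun j => F.measurable_grad hH j) hb (by positivity)
        (F.sum_abs_grad_le hH hC) (hK s h0) c w)
      (fun w => ?_)
      (fun κ w => integral_nonneg fun z => F.slotWeight_nonneg hC _ κ)
      (fun w => ?_)
      (fun w g d hd => ?_)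
    · rw [Real.norm_eq_abs, abs_mul, abs_neg, abs_of_nonneg hs0]
      refine (mul_le_mul_of_nonneg_left key hs0).trans_eq ?_
      rw [hB, hER, hEV, hEΓ]
      field_simp
    · have := sum_abs_gaussianSmooth_le (S := S) (s := s) (K := K / s)
        (φ := fun i : Fin p × Fin p => F.hess H i.1 i.2)
        (fun i => F.measurable_hess hH i.1 i.2) hb (M := 2 * (C / L) * F.rate ^ 2)
        (by positivity) (fun x => by
          rw [Fintype.sum_prod_type]; exact F.sum_abs_hess_le hH hC x) (hK s h0) c w
      rw [Fintype.sum_prod_type] at this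
      refine le_trans (Finset.sum_le_sum fun j _ => Finset.sum_le_sum fun k _ => ?_) this
      rw [abs_mul]
      exact mul_le_of_le_one_left (abs_nonneg _) hc1
    · have := sum_abs_gaussianSmooth_le (S := S) (s := s) (K := K / s)
        (φ := fun κ x => F.slotWeight C L x κ)
        (F.measurable_slotWeight C L) hb (M := 21 * Real.exp 8 * (C / L) * F.rate ^ 4)
        (by positivity) (fun x => by
          simp only [abs_of_nonneg (F.slotWeight_nonneg hC x _)]
          exact (F.sum_slotWeight x).le) (hK s h0) c w
      exact (Finset.sum_le_sum fun κ _ => le_abs_self _).trans this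
    · refine F.abs_gaussianSmooth_grad_sub_trapezoid_le hH hC hc1 s w g d fun j => ?_
      rw [hrate] at hr ⊢
      have := (norm_le_pi_norm d j).trans hd
      rw [Real.norm_eq_abs] at this
      calc betaParam p ε * |d j| ≤ betaParam p ε * (betaParam p ε)⁻¹ :=
            mul_le_mul_of_nonneg_left this hr.le
        _ = 1 := mul_inv_cancel₀ hr.ne'

end ExpFamily

/-! ### Boxes and their smoothed indicators -/

section Box
variable {p : ℕ}

/-- The exponentials `exp (β (x_j - b_j))` and `exp (β (a_j - x_j))`, which measure by how much `x`
leaves the box `[a, b]`. -/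
def boxFamily {β : ℝ} (hβ : 0 < β) (a b : Fin p → ℝ) : ExpFamily (Fin p ⊕ Fin p) p where
  rate := β
  sign := Sum.elim (fun _ => 1) (fun _ => -1)
  coord := Sum.elim id id
  offset := Sum.elim (fun j => β * b j) (fun j => -(β * a j))
  rate_pos := hβ
  abs_sign := by rintro (j | j) <;> simp

variable {β : ℝ} (hβ : 0 < β) (a b : Fin p → ℝ)

lemma boxFamily_term_inl (j : Fin p) (x : Fin p → ℝ) :
    (boxFamily hβ a b).term (Sum.inl j) x = Real.exp (β * (x j - b j)) := by
  simp only [ExpFamily.term, boxFamily, Sum.elim_inl, id]; congr 1; ring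

lemma boxFamily_term_inr (j : Fin p) (x : Fin p → ℝ) :
    (boxFamily hβ a b).term (Sum.inr j) x = Real.exp (β * (a j - x j)) := by
  simp only [ExpFamily.term, boxFamily, Sum.elim_inr, id]; congr 1; ring

lemma boxFamily_total (x : Fin p → ℝ) : (boxFamily hβ a b).total x
    = ∑ j, (Real.exp (β * (x j - b j)) + Real.exp (β * (a j - x j))) := by
  rw [ExpFamily.total, Fintype.sum_sum_type, ← Finset.sum_add_distrib]
  simp only [boxFamily_term_inl, boxFamily_term_inr]

lemma le_add_of_boxFamily_total_le {x : Fin p → ℝ} {u : ℝ}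
    (hx : (boxFamily hβ a b).total x ≤ Real.exp (β * u)) (j : Fin p) :
    x j ≤ b j + u ∧ a j - u ≤ x j := by
  have h := (Finset.single_le_sum (f := fun i => (boxFamily hβ a b).term i x)
    (fun i _ => ((boxFamily hβ a b).term_pos i x).le) (Finset.mem_univ (Sum.inl j))).trans hx
  have h' := (Finset.single_le_sum (f := fun i => (boxFamily hβ a b).term i x)
    (fun i _ => ((boxFamily hβ a b).term_pos i x).le) (Finset.mem_univ (Sum.inr j))).trans hx
  rw [boxFamily_term_inl, Real.exp_le_exp, mul_le_mul_iff_right₀ hβ] at h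
  rw [boxFamily_term_inr, Real.exp_le_exp, mul_le_mul_iff_right₀ hβ] at h'
  constructor <;> linarith

lemma boxFamily_total_le {x : Fin p → ℝ} {u : ℝ} (hx : ∀ j, x j ≤ b j + u ∧ a j - u ≤ x j) :
    (boxFamily hβ a b).total x ≤ 2 * p * Real.exp (β * u) := by
  rw [boxFamily_total]
  calc _ ≤ ∑ _j : Fin p, (Real.exp (β * u) + Real.exp (β * u)) := by
        gcongr with j
        · linarith [(hx j).1]
        · linarith [(hx j).2]
    _ = 2 * p * Real.exp (β * u) := by simp; ring

end Box

section Comparison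
variable {p : ℕ} {S : Matrix (Fin p) (Fin p) ℝ}

lemma log_two_le_log_cast (hp : 2 ≤ p) : Real.log 2 ≤ Real.log p :=
  Real.log_le_log (by norm_num) (by exact_mod_cast hp)

lemma half_lt_log_cast (hp : 2 ≤ p) : 1 / 2 < Real.log p :=
  lt_of_lt_of_le (by linarith [Real.log_two_gt_d9]) (log_two_le_log_cast hp)

lemma betaParam_pos (hp : 2 ≤ p) {ε : ℝ} (hε : 0 < ε) : 0 < betaParam p ε :=
  mul_pos (inv_pos.2 hε) (by linarith [half_lt_log_cast hp])

lemma betaParam_mul_self {ε : ℝ} (hε : 0 < ε) : betaParam p ε * ε = Real.log p := by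
  rw [betaParam]; field_simp

/-- The transition region of the smoothed indicator of a box is a shell of width `O(ε)`. -/
lemma band_boxFamily_subset (hp : 2 ≤ p) {ε : ℝ} (hε : 0 < ε) (a b : Fin p → ℝ) :
    (boxFamily (betaParam_pos hp hε) a b).band (Real.log p)
      ⊆ {x | (∃ j, b j - 6 * ε < x j ∨ x j < a j + 6 * ε)
        ∧ ∀ j, x j ≤ b j - 6 * ε + 9 * ε ∧ a j + 6 * ε - 9 * ε ≤ x j} := by
  intro x hx
  have hL := half_lt_log_cast hp
  have hL2 := log_two_le_log_cast hp
  have hβε := betaParam_mul_self (p := p) hε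
  have hp0 : (0 : ℝ) < p := by exact_mod_cast (by omega : 0 < p)
  constructor
  · by_contra! h
    have h1 := boxFamily_total_le (betaParam_pos hp hε) a b (x := x) (u := -(6 * ε))
      fun j => ⟨by linarith [(h j).1], by linarith [(h j).2]⟩
    have h2 := hx.1.trans h1
    rw [show (2 : ℝ) * p = Real.exp (Real.log 2 + Real.log p) by
      rw [Real.exp_add, Real.exp_log (by norm_num), Real.exp_log hp0], ← Real.exp_add,
      Real.exp_le_exp, show betaParam p ε * -(6 * ε) = -(6 * (betaParam p ε * ε)) by ring,
      hβε] at h2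
    linarith
  · intro j
    have := le_add_of_boxFamily_total_le (betaParam_pos hp hε) a b (x := x) (u := 3 * ε)
      (hx.2.trans (Real.exp_le_exp.2 (by
        rw [show betaParam p ε * (3 * ε) = 3 * (betaParam p ε * ε) by ring, hβε]; linarith))) j
    constructor <;> linarith [this.1, this.2]

lemma measureReal_band_boxFamily_le (hp : 2 ≤ p) (hS : S.PosSemidef) {s : ℝ} (hs : 0 < s)
    (hpos : ∀ j, s ≤ √(S j j)) {ε : ℝ} (hε : 0 < ε) (a b w : Fin p → ℝ) {t : ℝ} (ht : 0 < t) :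
    (gaussianLaw S).real {z | w + t • z ∈ (boxFamily (betaParam_pos hp hε) a b).band (Real.log p)}
      ≤ 450 * √(Real.log p) / s * ε / t := by
  refine ENNReal.toReal_le_of_le_ofReal (by positivity)
    ((measure_mono (Set.preimage_mono (f := fun z : Fin p → ℝ => w + t • z)
      (band_boxFamily_subset hp hε a b))).trans
      ((gaussianLaw_affine_box_shell_le hp hS hs hpos (fun j => a j + 6 * ε)
        (fun j => b j - 6 * ε) w (9 * ε) ht).trans_eq ?_))
  congr 1; ring

variable {C : ℝ} {H : ℕ → ℝ → ℝ}

lemma smoothed_eq_one (hp : 2 ≤ p) (hH : IsLogCutoff C (Real.log p) H) {ε : ℝ} (hε : 0 < ε)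
    (a b : Fin p → ℝ) {x : Fin p → ℝ} (hx : x ∈ Set.Icc (fun j => a j + 2 * ε) fun j => b j - 2 * ε) :
    H 0 ((boxFamily (betaParam_pos hp hε) a b).total x) = 1 := by
  have hp0 : (0 : ℝ) < p := by exact_mod_cast (by omega : 0 < p)
  have : Nonempty (Fin p ⊕ Fin p) := ⟨Sum.inl ⟨0, by omega⟩⟩
  refine hH.eq_one _ (ExpFamily.total_pos _ _) ?_
  refine (boxFamily_total_le (betaParam_pos hp hε) a b (u := -(2 * ε))
    fun j => ⟨by linarith [hx.2 j], by linarith [hx.1 j]⟩).trans ?_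
  rw [show betaParam p ε * -(2 * ε) = -(betaParam p ε * ε) + -(betaParam p ε * ε) by ring,
    betaParam_mul_self hε, Real.exp_add, Real.exp_neg, Real.exp_log hp0]
  have : (2 : ℝ) ≤ p := by exact_mod_cast hp
  rw [show 2 * (p : ℝ) * ((p : ℝ)⁻¹ * (p : ℝ)⁻¹) = 2 / p by field_simp, div_le_one hp0]
  exact this

lemma smoothed_eq_zero (hp : 2 ≤ p) (hH : IsLogCutoff C (Real.log p) H) {ε : ℝ} (hε : 0 < ε)
    (a b : Fin p → ℝ) {x : Fin p → ℝ} (hx : x ∉ Set.Icc (fun j => a j - ε) fun j => b j + ε) :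
    H 0 ((boxFamily (betaParam_pos hp hε) a b).total x) = 0 := by
  refine hH.eq_zero _ ?_
  by_contra! h
  rw [← betaParam_mul_self hε] at h
  have := le_add_of_boxFamily_total_le (betaParam_pos hp hε) a b h.le
  exact hx ⟨fun j => (this j).2, fun j => (this j).1⟩

section Sandwich
variable (hp : 2 ≤ p) (hH : IsLogCutoff C (Real.log p) H) {ε : ℝ} (hε : 0 < ε) (a b : Fin p → ℝ)
  (μ : Measure (Fin p → ℝ)) [IsProbabilityMeasure μ]

include hH

lemma integrable_smoothed :
    Integrable (fun x => H 0 ((boxFamily (betaParam_pos hp hε) a b).total x)) μ :=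
  Integrable.of_bound ((hH.measurable 0).comp (ExpFamily.measurable_total _)).aestronglyMeasurable 1
    (ae_of_all _ fun x => by
      have := hH.mem_Icc ((boxFamily (betaParam_pos hp hε) a b).total x)
      rw [Real.norm_eq_abs, abs_le]; exact ⟨by linarith [this.1], this.2⟩)

lemma measureReal_Icc_le_integral_smoothed :
    μ.real (Set.Icc (fun j => a j + 2 * ε) fun j => b j - 2 * ε)
      ≤ ∫ x, H 0 ((boxFamily (betaParam_pos hp hε) a b).total x) ∂μ := by
  rw [← integral_indicator_one measurableSet_Icc]
  refine integral_mono ((integrable_const _).indicator measurableSet_Icc)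
    (integrable_smoothed hp hH hε a b μ) fun x => ?_
  by_cases hx : x ∈ Set.Icc (fun j => a j + 2 * ε) fun j => b j - 2 * ε
  · simp only [Set.indicator_of_mem hx, smoothed_eq_one hp hH hε a b hx]; rfl
  · simpa only [Set.indicator_of_notMem hx] using (hH.mem_Icc _).1

lemma integral_smoothed_le_measureReal_Icc :
    ∫ x, H 0 ((boxFamily (betaParam_pos hp hε) a b).total x) ∂μ
      ≤ μ.real (Set.Icc (fun j => a j - ε) fun j => b j + ε) := by
  rw [← integral_indicator_one measurableSet_Icc]
  refine integral_mono (integrable_smoothed hp hH hε a b μ)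
    ((integrable_const _).indicator measurableSet_Icc) fun x => ?_
  by_cases hx : x ∈ Set.Icc (fun j => a j - ε) fun j => b j + ε
  · simp only [Set.indicator_of_mem hx]; exact (hH.mem_Icc _).2
  · simp only [Set.indicator_of_notMem hx, smoothed_eq_zero hp hH hε a b hx]; rfl

/-- A bound for all smoothed indicators of boxes transfers to boxes, at the price of the Gaussian
measure of two shells of width `3 ε`. -/
lemma abs_measureReal_Icc_sub_le (hS : S.PosSemidef) {s : ℝ} (hs : 0 < s)
    (hpos : ∀ j, s ≤ √(S j j)) {Δ : ℝ}
    (hΔ : ∀ a b, |∫ x, H 0 ((boxFamily (betaParam_pos hp hε) a b).total x) ∂gaussianLaw S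
      - ∫ x, H 0 ((boxFamily (betaParam_pos hp hε) a b).total x) ∂μ| ≤ Δ) :
    |μ.real (Set.Icc a b) - (gaussianLaw S).real (Set.Icc a b)|
      ≤ Δ + 150 * √(Real.log p) / s * ε := by
  have hshell : ∀ a b : Fin p → ℝ, (gaussianLaw S).real
      {x | (∃ j, b j < x j ∨ x j < a j) ∧ ∀ j, x j ≤ b j + 3 * ε ∧ a j - 3 * ε ≤ x j}
      ≤ 150 * √(Real.log p) / s * ε := fun a b => by
    refine ENNReal.toReal_le_of_le_ofReal (by positivity)
      ((gaussianLaw_box_shell_le hp hS hs hpos a b (3 * ε)).trans_eq ?_)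
    congr 1; ring
  have hgrow : ∀ a b : Fin p → ℝ,
      (gaussianLaw S).real (Set.Icc (fun j => a j - 3 * ε) fun j => b j + 3 * ε)
        ≤ (gaussianLaw S).real (Set.Icc a b) + 150 * √(Real.log p) / s * ε := fun a b => by
    refine le_trans (measureReal_mono ?_) ((measureReal_union_le _ _).trans
      (add_le_add_right (hshell a b) _))
    intro x hx
    by_cases h : x ∈ Set.Icc a b
    · exact Or.inl h
    · refine Or.inr ⟨?_, fun j => ⟨hx.2 j, hx.1 j⟩⟩
      by_contra! h'
      exact h ⟨fun j => (h' j).2, fun j => (h' j).1⟩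
  rw [abs_le]
  constructor
  -- lower bound: smooth a smaller box, so that the smoothed indicator lives in `[a, b]`
  · have h1 := integral_smoothed_le_measureReal_Icc hp hH hε (fun j => a j + ε) (fun j => b j - ε) μ
    have h2 := measureReal_Icc_le_integral_smoothed hp hH hε (fun j => a j + ε) (fun j => b j - ε)
      (gaussianLaw S)
    have h3 := (abs_le.1 (hΔ (fun j => a j + ε) (fun j => b j - ε))).2
    have h4 := hgrow (fun j => a j + ε + 2 * ε) (fun j => b j - ε - 2 * ε)
    have e1 : ∀ j, a j + ε + 2 * ε - 3 * ε = a j := fun j => by ring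
    have e2 : ∀ j, b j - ε - 2 * ε + 3 * ε = b j := fun j => by ring
    simp only [e1, e2, add_sub_cancel_right, sub_add_cancel] at h1 h2 h4
    linarith
  -- upper bound: smooth a larger box, so that the smoothed indicator is `1` on `[a, b]`
  · have h1 := integral_smoothed_le_measureReal_Icc hp hH hε (fun j => a j - 2 * ε)
      (fun j => b j + 2 * ε) (gaussianLaw S)
    have h2 := measureReal_Icc_le_integral_smoothed hp hH hε (fun j => a j - 2 * ε)
      (fun j => b j + 2 * ε) μ
    have h3 := (abs_le.1 (hΔ (fun j => a j - 2 * ε) (fun j => b j + 2 * ε))).1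
    have h4 := hgrow a b
    have e1 : ∀ j, a j - 2 * ε - ε = a j - 3 * ε := fun j => by ring
    have e2 : ∀ j, b j + 2 * ε + ε = b j + 3 * ε := fun j => by ring
    simp only [e1, e2, add_sub_cancel_right, sub_add_cancel] at h1 h2 h4
    linarith

end Sandwich

/-- Inside a rectangle there is a compact box that carries almost all of its measure. -/
lemma IsRectangle.exists_Icc_subset [NeZero p] {A : Set (Fin p → ℝ)} (hA : IsRectangle A)
    (ρ : Measure (Fin p → ℝ)) [IsFiniteMeasure ρ] {η : ℝ} (hη : 0 < η) :
    ∃ a b, Set.Icc a b ⊆ A ∧ MeasurableSet A ∧ ρ.real (A \ Set.Icc a b) ≤ η := by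
  obtain ⟨I, hI, rfl⟩ := hA
  have hm : MeasurableSet (Set.univ.pi I) := MeasurableSet.univ_pi fun j => (hI j).measurableSet
  obtain ⟨K, hKA, hK, hlt⟩ := hm.exists_isCompact_sdiff_lt (μ := ρ) (measure_ne_top _ _)
    (ENNReal.ofReal_pos.2 hη).ne'
  -- the bounding box of `K` stays inside, because each side is order-convex
  rcases K.eq_empty_or_nonempty with rfl | hne
  · refine ⟨fun _ => 1, fun _ => 0, ?_, hm, ?_⟩
    · rw [Set.Icc_eq_empty]
      · exact Set.empty_subset _
      · intro h; have := h 0; norm_num at this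
    · exact ENNReal.toReal_le_of_le_ofReal hη.le
        ((measure_mono (Set.sdiff_subset_sdiff_right (Set.empty_subset _))).trans hlt.le)
  have hc : ∀ j, Continuous fun x : Fin p → ℝ => x j := fun j => continuous_apply j
  choose u hu hu' using fun j => hK.exists_isMinOn hne (hc j).continuousOn
  choose v hv hv' using fun j => hK.exists_isMaxOn hne (hc j).continuousOn
  refine ⟨fun j => u j j, fun j => v j j, ?_, hm, ?_⟩
  · intro x hx j _
    exact (hI j).out (hKA (hu j) j trivial) (hKA (hv j) j trivial) ⟨hx.1 j, hx.2 j⟩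
  · refine ENNReal.toReal_le_of_le_ofReal hη.le ((measure_mono
      (Set.sdiff_subset_sdiff_right fun x hx => ?_)).trans hlt.le)
    exact ⟨fun j => hu' j hx, fun j => hv' j hx⟩

/-- Compact boxes determine the distance over all rectangles. -/
lemma rectDist_le_of_Icc [NeZero p] {μ ν : Measure (Fin p → ℝ)} [IsFiniteMeasure μ]
    [IsFiniteMeasure ν] {D : ℝ} (h : ∀ a b, |μ.real (Set.Icc a b) - ν.real (Set.Icc a b)| ≤ D) :
    rectDist μ ν ≤ ENNReal.ofReal D := by
  refine iSup₂_le fun A hA => ENNReal.ofReal_le_ofReal (le_of_forall_pos_le_add fun η hη => ?_)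
  obtain ⟨a, b, hsub, hm, hρ⟩ := hA.exists_Icc_subset (μ + ν) hη
  have hμ := measureReal_sdiff (μ := μ) hsub measurableSet_Icc
  have hν := measureReal_sdiff (μ := ν) hsub measurableSet_Icc
  rw [measureReal_add_apply] at hρ
  have h0 : 0 ≤ μ.real (A \ Set.Icc a b) := measureReal_nonneg
  have h1 : 0 ≤ ν.real (A \ Set.Icc a b) := measureReal_nonneg
  have h2 := abs_le.1 (h a b)
  rw [abs_le]
  constructor <;> linarith [h2.1, h2.2]

end Comparison

/-! ### The Gaussian approximation bound -/

section Approximation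
variable {Ω E : Type*} [MeasurableSpace Ω] [mE : MeasurableSpace E] {P : Measure Ω}
  {Y Y' : Ω → E} {p : ℕ} {W : E → Fin p → ℝ} {G : E × E → Fin p → ℝ}
  {R : Ω → Fin p → ℝ} {S : Matrix (Fin p) (Fin p) ℝ} {ε : ℝ}

lemma aestronglyMeasurable_truncR (hR : AEMeasurable R P)
    (g d : Ω → Fin p → ℝ) (ε : ℝ) : AEStronglyMeasurable (truncR P Y R g d ε) P := by
  refine (aemeasurable_pi_lambda _ fun j => ?_).aestronglyMeasurable
  exact ((measurable_pi_apply j).comp_aemeasurable hR).add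
    (integrable_condExpGiven _).aestronglyMeasurable.aemeasurable

/-- The bound for integrable `R^ε`, with real-valued expectations. -/
theorem rectDist_le_of_integrable_truncR [IsProbabilityMeasure P] {C : ℝ} {H : ℕ → ℝ → ℝ} (hC : 0 < C) (hp : 2 ≤ p)
    (hH : IsLogCutoff C (Real.log p) H)
    (hS : S.PosSemidef) {s : ℝ} (hs : 0 < s) (hpos : ∀ j, s ≤ √(S j j)) (hε : 0 < ε)
    (hYY : IsExchangeablePair P Y Y') (hW : Measurable W)
    (hG : Measurable G) (hanti : ∀ᵐ ω ∂P, G (Y ω, Y' ω) = -G (Y' ω, Y ω))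
    (hGint : Integrable (fun ω => G (Y ω, Y' ω)) P)
    (hcond : ∀ j, condExpGiven P Y (fun ω => G (Y ω, Y' ω) j)
      =ᵐ[P] fun ω => -(W (Y ω) j + R ω j))
    (hRint : Integrable (truncR P Y R (fun ω => G (Y ω, Y' ω))
      (fun ω => W (Y' ω) - W (Y ω)) ε) P) :
    rectDist (P.map fun ω => W (Y ω)) (gaussianLaw S) ≤ ENNReal.ofReal
      ((18900 * Real.exp 8 * C + 150) / s *
        ((∫ ω, ‖truncR P Y R (fun ω => G (Y ω, Y' ω))
              (fun ω => W (Y' ω) - W (Y ω)) ε ω‖ ∂P) * √(Real.log p)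
          + ε⁻¹ * (∫ ω, ‖truncV P Y (fun ω => G (Y ω, Y' ω))
              (fun ω => W (Y' ω) - W (Y ω)) S ε ω‖ ∂P) * Real.log p ^ (3 / 2 : ℝ)
          + ε⁻¹ ^ 3 * (∫ ω, truncΓ P Y (fun ω => G (Y ω, Y' ω))
              (fun ω => W (Y' ω) - W (Y ω)) ε ω ∂P) * Real.log p ^ (7 / 2 : ℝ)
          + ε * √(Real.log p))) := by
  obtain ⟨hY, hY', -⟩ := id hYY
  have hX : Measurable fun ω => W (Y ω) := hW.comp hY
  have := Measure.isProbabilityMeasure_map (μ := P) hX.aemeasurable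
  have : NeZero p := ⟨by omega⟩
  have hL : 0 < Real.log p := by linarith [half_lt_log_cast hp]
  have hSpos : ∀ j, 0 < S j j := fun j => Real.sqrt_pos.1 (hs.trans_le (hpos j))
  refine rectDist_le_of_Icc fun a b => ?_
  have hK0 : 0 ≤ 450 * √(Real.log p) / s * ε := by positivity
  set r := ∫ ω, ‖truncR P Y R (fun ω => G (Y ω, Y' ω)) (fun ω => W (Y' ω) - W (Y ω)) ε ω‖ ∂P
    with hr
  set v := ∫ ω, ‖truncV P Y (fun ω => G (Y ω, Y' ω)) (fun ω => W (Y' ω) - W (Y ω)) S ε ω‖ ∂P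
    with hv
  set g := ∫ ω, truncΓ P Y (fun ω => G (Y ω, Y' ω)) (fun ω => W (Y' ω) - W (Y ω)) ε ω ∂P with hg
  have hr0 : 0 ≤ r := integral_nonneg fun _ => norm_nonneg _
  have hv0 : 0 ≤ v := integral_nonneg fun _ => norm_nonneg _
  have hg0 : 0 ≤ g := integral_nonneg_of_ae (truncΓ_nonneg _ _ _)
  have hΔ : ∀ a b, |∫ x, H 0 ((boxFamily (betaParam_pos hp hε) a b).total x) ∂gaussianLaw S
      - ∫ x, H 0 ((boxFamily (betaParam_pos hp hε) a b).total x) ∂(P.map fun ω => W (Y ω))|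
      ≤ C / Real.log p * (450 * √(Real.log p) / s * ε) * (ε⁻¹ * Real.log p * r
        + 2 * (ε⁻¹ * Real.log p) ^ 2 * v + 21 * Real.exp 8 * (ε⁻¹ * Real.log p) ^ 4 * g)
        * (Real.pi / 2) := fun a b => by
    rw [integral_map hX.aemeasurable (f := fun x =>
      H 0 ((boxFamily (betaParam_pos hp hε) a b).total x))
      ((hH.measurable 0).comp (ExpFamily.measurable_total _)).aestronglyMeasurable]
    exact (boxFamily (betaParam_pos hp hε) a b).abs_smoothed_sub_le (ε := ε) hH
      (div_nonneg hC.le hL.le) hS hSpos hYY hW hG hanti hGint hcond hRint rfl hK0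
      (fun t ht w => measureReal_band_boxFamily_le hp hS hs hpos hε a b w ht)
  refine (abs_measureReal_Icc_sub_le hp hH hε a b (P.map fun ω => W (Y ω)) hS hs hpos hΔ).trans ?_
  clear_value r v g
  clear hΔ hK0 hH
  generalize Real.log p = L at *
  have h3 : L ^ (3 / 2 : ℝ) = L * √L := by
    rw [Real.sqrt_eq_rpow, ← Real.rpow_one_add' hL.le (by norm_num)]; norm_num
  have h7 : L ^ (7 / 2 : ℝ) = L ^ 3 * √L := by
    rw [Real.sqrt_eq_rpow, ← Real.rpow_natCast, ← Real.rpow_add hL]; norm_num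
  rw [h3, h7]
  have hq : 0 < √L := Real.sqrt_pos.2 hL
  have he : 1 ≤ Real.exp 8 := Real.one_le_exp (by norm_num)
  have hπ : Real.pi / 2 ≤ 2 := by linarith [Real.pi_le_four]
  -- `18900 = 450 * 21 * 2`, where `2` bounds the length `π / 2` of the interpolation path
  calc C / L * (450 * √L / s * ε) * (ε⁻¹ * L * r + 2 * (ε⁻¹ * L) ^ 2 * v
        + 21 * Real.exp 8 * (ε⁻¹ * L) ^ 4 * g) * (Real.pi / 2) + 150 * √L / s * ε
      ≤ C / L * (450 * √L / s * ε) * (ε⁻¹ * L * (21 * Real.exp 8 * r)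
        + 21 * Real.exp 8 * (ε⁻¹ * L) ^ 2 * v
        + 21 * Real.exp 8 * (ε⁻¹ * L) ^ 4 * g) * 2 + 150 * √L / s * ε := by
        gcongr
        · nlinarith
        · nlinarith
    _ = (18900 * Real.exp 8 * C) / s * (r * √L + ε⁻¹ * v * (L * √L) + ε⁻¹ ^ 3 * g * (L ^ 3 * √L))
        + 150 / s * (ε * √L) := by
        field_simp
        ring
    _ ≤ (18900 * Real.exp 8 * C + 150) / s
          * (r * √L + ε⁻¹ * v * (L * √L) + ε⁻¹ ^ 3 * g * (L ^ 3 * √L))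
        + (18900 * Real.exp 8 * C + 150) / s * (ε * √L) := by
        gcongr <;> linarith [show 0 ≤ 18900 * Real.exp 8 * C by positivity]
    _ = _ := by ring

end Approximation

end

theorem theorem3 :
    ∃ C : ℝ, 0 < C ∧
      ∀ (p : ℕ), 2 ≤ p →
      ∀ (Ω : Type*) [MeasurableSpace Ω] (P : Measure Ω) [IsProbabilityMeasure P]
        (E : Type*) [MeasurableSpace E] (Y Y' : Ω → E), IsExchangeablePair P Y Y' →
      ∀ (W : E → Fin p → ℝ), Measurable W →
      ∀ (G : E × E → Fin p → ℝ), Measurable G →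
        (∀ᵐ ω ∂P, G (Y ω, Y' ω) = -G (Y' ω, Y ω)) →
        Integrable (fun ω => G (Y ω, Y' ω)) P →
      ∀ (R : Ω → Fin p → ℝ), AEMeasurable R P →
        (∀ j, condExpGiven P Y (fun ω => G (Y ω, Y' ω) j)
          =ᵐ[P] fun ω => -(W (Y ω) j + R ω j)) →
      ∀ (S : Matrix (Fin p) (Fin p) ℝ), S.PosSemidef → 0 < minStdDev S →
      ∀ (ε : ℝ), 0 < ε →
        rectDist (P.map fun ω => W (Y ω)) (gaussianLaw S) ≤
          ENNReal.ofReal (C / minStdDev S) *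
            ((∫⁻ ω, ‖truncR P Y R (fun ω => G (Y ω, Y' ω))
                  (fun ω => W (Y' ω) - W (Y ω)) ε ω‖ₑ ∂P)
                * ENNReal.ofReal (√(Real.log p))
              + ENNReal.ofReal ε⁻¹
                * (∫⁻ ω, ‖truncV P Y (fun ω => G (Y ω, Y' ω))
                    (fun ω => W (Y' ω) - W (Y ω)) S ε ω‖ₑ ∂P)
                * ENNReal.ofReal (Real.log p ^ (3 / 2 : ℝ))
              + ENNReal.ofReal (ε⁻¹ ^ 3)
                * (∫⁻ ω, ENNReal.ofReal (truncΓ P Y (fun ω => G (Y ω, Y' ω))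
                    (fun ω => W (Y' ω) - W (Y ω)) ε ω) ∂P)
                * ENNReal.ofReal (Real.log p ^ (7 / 2 : ℝ))
              + ENNReal.ofReal (ε * √(Real.log p))) := by
  obtain ⟨C, hC, hcut⟩ := exists_isLogCutoff
  refine ⟨18900 * Real.exp 8 * C + 150, by positivity, ?_⟩
  intro p hp Ω _ P _ E _ Y Y' hYY W hW G hG hanti hGint R hR hcond S hS hs ε hε
  have hL : 0 < Real.log p := by linarith [half_lt_log_cast hp]
  have hpos : ∀ j, minStdDev S ≤ √(S j j) := fun j =>
    ciInf_le (Set.finite_range fun j => √(S j j)).bddBelow j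
  by_cases hfin : ∫⁻ ω, ‖truncR P Y R (fun ω => G (Y ω, Y' ω))
      (fun ω => W (Y' ω) - W (Y ω)) ε ω‖ₑ ∂P = ∞
  -- otherwise `W` is integrable, which the interpolation needs; here the right-hand side is infinite
  · have h1 : ENNReal.ofReal (√(Real.log p)) ≠ 0 := (ENNReal.ofReal_pos.2 (Real.sqrt_pos.2 hL)).ne'
    have h2 : ENNReal.ofReal ((18900 * Real.exp 8 * C + 150) / minStdDev S) ≠ 0 :=
      (ENNReal.ofReal_pos.2 (by positivity)).ne'
    rw [hfin, ENNReal.top_mul h1, top_add, top_add, top_add, ENNReal.mul_top h2]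
    exact le_top
  have hRint : Integrable (truncR P Y R (fun ω => G (Y ω, Y' ω))
      (fun ω => W (Y' ω) - W (Y ω)) ε) P :=
    ⟨aestronglyMeasurable_truncR hR _ _ _, lt_top_iff_ne_top.2 hfin⟩
  obtain ⟨H, hH⟩ := hcut (Real.log p) (half_lt_log_cast hp).le
  refine (rectDist_le_of_integrable_truncR hC hp hH hS hs hpos hε hYY hW hG hanti hGint hcond
    hRint).trans_eq ?_
  have hΓ := truncΓ_nonneg (P := P) (Y := Y) (fun ω => G (Y ω, Y' ω))
    (fun ω => W (Y' ω) - W (Y ω)) ε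
  have hEΓ := integral_nonneg_of_ae hΓ
  have hEV : 0 ≤ ∫ ω, ‖truncV P Y (fun ω => G (Y ω, Y' ω))
      (fun ω => W (Y' ω) - W (Y ω)) S ε ω‖ ∂P := integral_nonneg fun _ => norm_nonneg _
  have hER : 0 ≤ ∫ ω, ‖truncR P Y R (fun ω => G (Y ω, Y' ω))
      (fun ω => W (Y' ω) - W (Y ω)) ε ω‖ ∂P := integral_nonneg fun _ => norm_nonneg _
  rw [← ofReal_integral_norm_eq_lintegral_enorm hRint,
    ← ofReal_integral_norm_eq_lintegral_enorm (integrable_truncV _ _ _ _),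
    ← ofReal_integral_eq_lintegral_ofReal (integrable_truncΓ _ _ _) hΓ,
    ENNReal.ofReal_mul (by positivity), ENNReal.ofReal_add (by positivity) (by positivity),
    ENNReal.ofReal_add (by positivity) (by positivity),
    ENNReal.ofReal_add (by positivity) (by positivity),
    ENNReal.ofReal_mul hER, ENNReal.ofReal_mul (by positivity), ENNReal.ofReal_mul (by positivity),
    ENNReal.ofReal_mul (p := ε⁻¹ ^ 3 * _) (by positivity),
    ENNReal.ofReal_mul (p := ε⁻¹ ^ 3) (by positivity)]
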